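/- **Setting.** Let $0<\tau\le 1$ and let $Q:\mathbb{C}\to\mathbb{R}$ be $C^2$-smooth with $\liminf_{|z|\to\infty}Q(z)/\log|z|>1$. Let $\check Q_\tau$ be the pointwise supremum of all subharmonic $u\le Q$ on $\mathbb{C}$ with $u(z)\le\tau\log|z|+O(1)$ at infinity, let $\mathcal{S}=\{\check Q_\tau=Q\}$, let $\Omega$ be the unbounded component of $\mathbb{C}\setminus\mathcal{S}$, and $\Gamma=\partial\Omega$. Assume that $\mathcal{S}$ is connected, that $\Gamma$ is a real-analytically smooth simple closed curve, and that $Q$ is real-analytic and strictly subharmonic in a neighborhood of $\Gamma$. Let $\phi$ be the conformal map of $\Omega$ onto $\{|\zeta|>1\}$ with $\phi(\infty)=\infty$, $\phi'(\infty)>0$, together with its conformal extension past $\Gamma$. Let $\breve Q$ be the harmonic extension of $\check Q_\tau|_\Omega$ to a neighborhood of $\overline\Omega$, and let $V$ be the $C^2$-smooth square root of $Q-\breve Q$ in a neighborhood of $\overline\Omega$ which is positive on $\Omega$ and negative off $\overline\Omega$. Write $\partial,\bar\partial$ for the Wirtinger derivatives and $\Delta=\partial\bar\partial$. Let $\mathbf{P}_\Omega[f]$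 be the bounded harmonic extension of $f|_\Gamma$ to $\Omega$, continued harmonically past $\Gamma$. For $\vartheta\in\mathbb{C}$ put $$L=2|\partial V|^2\frac{\log|\phi|}{V}+\frac{\vartheta}{2}\Delta\frac{\log|\phi|}{V},$$ $$\mathbf{S}[f]=\partial V\,\bar\partial f+\bar\partial V\,\partial f+f\Delta V+|\partial V|^2\frac{(\mathbf{P}_\Omega-\mathbf{I})f}{V}+\frac{\vartheta}{4}\Delta\frac{(\mathbf{P}_\Omega-\mathbf{I})f}{V},$$ $$\mathbf{T}[f]=\frac{1}{4V|\partial V|^2}\Big\{L+\vartheta\mathbf{S}[f]-\exp\big(\mathbf{P}_\Omega[\log(L+\vartheta\mathbf{S}[f])]\big)\Big\},$$ where quotients by $V$ are extended by continuity to $\Gamma$ and $\log$ is the principal branch. Put $\mathcal{E}_k=\mathbf{T}^{k+1}[0]$ for $k=0,1,2,\ldots$. For $0<\sigma<1$ let $\rho(\sigma)=1/(\sigma+\sqrt{1+\sigma^2})$, $\mathbb{A}(\rho)=\{\rho\le|z|\le\rho^{-1}\}$, and $\hat{\mathbb{A}}(\sigma)=\{(z,w)\in\mathbb{A}(\rho(\sigma))^2:|z-w|\le2\sigma\}$.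 The space $\mathscr{H}^\infty_\sigma(\Gamma)$ consists of the real-analytic functions $f$ near $\Gamma$ for which $f\circ\phi^{-1}$ has a polarization $f_\phi(z,w)$ that is holomorphic in $z$ and $\bar w$ and bounded on the interior of $\hat{\mathbb{A}}(\sigma)$, with $f_\phi(z,z)=f(\phi^{-1}(z))$ for $z$ near the unit circle. Functions agreeing near $\Gamma$ are identified. The norm is $\|f\|_\sigma=\sup|f_\phi|$ over the interior of $\hat{\mathbb{A}}(\sigma)$. **Theorem 8.1.** There are $\sigma_0\in(0,1)$, such that $\phi^{-1}$ extends conformally to $\mathbb{A}(\rho(\sigma_0))$, and $C_1>0$ (both depending only on the data $V,\phi$), such that for every $\sigma^*\in(0,\sigma_0]$, with $$C_2=2\max\Big\{1,\,C_1\Big(\frac{16}{(\sigma^*)^4}+\frac{64}{(\sigma^*)^6}\Big)\Big\},$$ there is $\varrho_0>0$ such that the following hold. (a) For all $\vartheta\in\mathbb{D}(0,\varrho_0)$ and all positive integers $k\le|\vartheta|^{-1/2}C_2^{-1/2}$ (every positive integer $k$ if $\vartheta=0$) we have $\mathcal{E}_0\in\mathscr{H}^\infty_{\sigma^*}(\Gamma)$,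 $\mathcal{E}_k,\mathbf{T}[\mathcal{E}_k]\in\mathscr{H}^\infty_{\sigma^*/2}(\Gamma)$, and $$\big\|\mathcal{E}_k-\mathbf{T}[\mathcal{E}_k]\big\|_{\frac12\sigma^*}\le\big(\tfrac12C_2|\vartheta|k^2\big)^k\,\|\mathcal{E}_0\|_{\sigma^*}.$$ (b) There are $C_0,c_0>0$ such that for all $0<|\vartheta|<\varrho_0$, with $k$ the integer part of $\frac12|\vartheta|^{-1/2}C_2^{-1/2}$, $$\big\|\mathcal{E}_k-\mathbf{T}[\mathcal{E}_k]\big\|_{\frac12\sigma^*}\le C_0\exp\big(-c_0|\vartheta|^{-1/2}\big).$$ -/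

import Mathlib

open Set Filter Topology ComplexConjugate
open scoped ENNReal

noncomputable section

namespace BerezinOP

/-! ### Differential operators in the plane -/

/-- The Wirtinger derivative `∂ = ½(∂_x - i ∂_y)`. -/
def dz (f : ℂ → ℂ) (z : ℂ) : ℂ :=
  (1 / 2) * (fderiv ℝ f z 1 - Complex.I * fderiv ℝ f z Complex.I)

/-- The Wirtinger derivative `∂̄ = ½(∂_x + i ∂_y)`. -/
def dzbar (f : ℂ → ℂ) (z : ℂ) : ℂ :=
  (1 / 2) * (fderiv ℝ f z 1 + Complex.I * fderiv ℝ f z Complex.I)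

/-- The quarter Laplacian `∂∂̄ = ¼(∂_x² + ∂_y²)`. -/
def qLap (f : ℂ → ℂ) : ℂ → ℂ := dz (dzbar f)

/-! ### Potential theory: the obstacle problem with weight `Q` -/

/-- Finite-valued subharmonic functions on the plane: upper semicontinuous, with the sub-mean value
property.  (The value `-∞` plays no role for the envelope below: the external potential `Q` is
bounded below by some `m`, and a competitor `u` may be replaced by `max u m`.) -/
structure IsSubharmonic (u : ℂ → ℝ) : Prop where
  usc : UpperSemicontinuous u
  integrable : ∀ (c : ℂ) (r : ℝ), 0 < r → CircleIntegrable u c r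
  le_average : ∀ (c : ℂ) (r : ℝ), 0 < r → u c ≤ Real.circleAverage u c r

/-- The class `SH_τ` of subharmonic functions growing at most as `τ log|z| + O(1)`. -/
def SHClass (τ : ℝ) : Set (ℂ → ℝ) :=
  {u | IsSubharmonic u ∧ ∃ C R : ℝ, ∀ z : ℂ, R ≤ ‖z‖ → u z ≤ τ * Real.log ‖z‖ + C}

/-- The envelope `Q̌_τ(z) = sup {u(z) : u ∈ SH_τ, u ≤ Q}`. -/
def envelope (Q : ℂ → ℝ) (τ : ℝ) (z : ℂ) : ℝ :=
  sSup {x : ℝ | ∃ u ∈ SHClass τ, (∀ w, u w ≤ Q w) ∧ u z = x}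

/-- The coincidence set `S_τ = {Q̌_τ = Q}`. -/
def coincidenceSet (Q : ℂ → ℝ) (τ : ℝ) : Set ℂ := {z | envelope Q τ z = Q z}

/-- The unbounded component `Ω_τ` of the complement of the coincidence set. -/
def outerDomain (Q : ℂ → ℝ) (τ : ℝ) : Set ℂ :=
  {z | z ∈ (coincidenceSet Q τ)ᶜ ∧
    ¬ Bornology.IsBounded (connectedComponentIn (coincidenceSet Q τ)ᶜ z)}

/-- A real-analytically smooth simple closed curve. -/
def IsAnalyticJordanCurve (Γ : Set ℂ) : Prop :=
  ∃ γ : ℝ → ℂ, (∀ t, AnalyticAt ℝ γ t) ∧ Function.Periodic γ 1 ∧ InjOn γ (Ico 0 1) ∧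
    (∀ t, deriv γ t ≠ 0) ∧ range γ = Γ

/-- The standing assumptions on the external potential `Q` and the parameter `τ`.  The curve
`Γ_τ` is the boundary of `Ω_τ`. -/
structure IsAdmissible (Q : ℂ → ℝ) (τ : ℝ) : Prop where
  tau_pos : 0 < τ
  tau_le : τ ≤ 1
  smooth : ContDiff ℝ 2 Q
  growth : 1 < liminf (fun z : ℂ => ((Q z / Real.log ‖z‖ : ℝ) : EReal)) (Bornology.cobounded ℂ)
  connected : IsConnected (coincidenceSet Q τ)
  curve : IsAnalyticJordanCurve (frontier (outerDomain Q τ))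
  analytic : AnalyticOnNhd ℝ Q (frontier (outerDomain Q τ))
  strict : ∀ᶠ z in 𝓝ˢ (frontier (outerDomain Q τ)), 0 < Laplacian.laplacian Q z

/-- `φ` is the conformal map of `Ω` onto the exterior disk with `φ(∞) = ∞` and `φ'(∞) > 0`,
together with its conformal extension to an open set `U` containing the closure of `Ω`. -/
structure IsExteriorMap (Ω U : Set ℂ) (φ : ℂ → ℂ) : Prop where
  isOpen : IsOpen U
  closure_subset : closure Ω ⊆ U
  holo : DifferentiableOn ℂ φ U
  inj : InjOn φ U
  image : φ '' Ω = {ζ | 1 < ‖ζ‖}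
  infty : ∃ c : ℝ, 0 < c ∧
    Tendsto (fun z => φ z / z) (Bornology.cobounded ℂ) (𝓝 (c : ℂ))

/-- `Qb` is the harmonic extension of `Q̌_τ` from `Ω_τ` past the boundary curve, and `V` is the
`C²`-smooth square root of `Q - Qb` in a neighbourhood of the closure of `Ω_τ` which is positive
outside and negative inside the boundary curve. -/
structure IsSignedRoot (Q : ℂ → ℝ) (τ : ℝ) (Qb V : ℂ → ℝ) : Prop where
  harmonic : InnerProductSpace.HarmonicOnNhd Qb (closure (outerDomain Q τ))
  extends_envelope : EqOn Qb (envelope Q τ) (outerDomain Q τ)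
  smooth : ∀ z ∈ closure (outerDomain Q τ), ContDiffAt ℝ 2 V z
  sq : ∀ᶠ z in 𝓝ˢ (closure (outerDomain Q τ)), V z ^ 2 = Q z - Qb z
  pos : ∀ z ∈ outerDomain Q τ, 0 < V z
  neg : ∀ᶠ z in 𝓝ˢ (closure (outerDomain Q τ)), z ∉ closure (outerDomain Q τ) → V z < 0

/-! ### The Banach scale `ℋ^∞_σ(Γ)` -/

/-- `ρ(σ) = 1 / (σ + √(1 + σ²))`. -/
def rho (σ : ℝ) : ℝ := 1 / (σ + Real.sqrt (1 + σ ^ 2))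

/-- The closed annulus `𝔸(ρ(σ))`. -/
def annulus (σ : ℝ) : Set ℂ := {z | rho σ ≤ ‖z‖ ∧ ‖z‖ ≤ (rho σ)⁻¹}

/-- The (interior of the) `2σ`-fattened diagonal annulus `𝔸̂(σ) ⊆ ℂ²`. -/
def fatAnnulus (σ : ℝ) : Set (ℂ × ℂ) :=
  {p | (rho σ < ‖p.1‖ ∧ ‖p.1‖ < (rho σ)⁻¹) ∧ (rho σ < ‖p.2‖ ∧ ‖p.2‖ < (rho σ)⁻¹) ∧
    ‖p.1 - p.2‖ < 2 * σ}

/-- `F` is the Hermitian-analytic polarization of `f ∘ φ⁻¹` on the fattened diagonal annulus: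
`F(z, w)` is holomorphic in `(z, w̄)`, and `F(ζ, ζ) = f(φ⁻¹(ζ))` for `ζ` near the unit circle, i.e.
`f(z) = F(φ(z), φ(z))` for `z` near `Γ`. -/
def IsPolarization (Γ : Set ℂ) (φ : ℂ → ℂ) (σ : ℝ) (f : ℂ → ℂ) (F : ℂ × ℂ → ℂ) : Prop :=
  DifferentiableOn ℂ (fun p : ℂ × ℂ => F (p.1, conj p.2))
      {p : ℂ × ℂ | (p.1, conj p.2) ∈ fatAnnulus σ} ∧
    ∀ᶠ z in 𝓝ˢ Γ, f z = F (φ z, φ z)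

/-- The norm `‖f‖_σ = sup |f_φ|` over the fattened diagonal annulus, `f_φ` being the polarization
(which is unique there when it exists).  The value is `∞` when there is no polarization or when
it is unbounded. -/
def hNorm (Γ : Set ℂ) (φ : ℂ → ℂ) (σ : ℝ) (f : ℂ → ℂ) : ℝ≥0∞ :=
  ⨅ (F : ℂ × ℂ → ℂ) (_ : IsPolarization Γ φ σ f F), ⨆ p ∈ fatAnnulus σ, ‖F p‖ₑ

/-- Membership in the space `ℋ^∞_σ(Γ)` (as germs along `Γ`). -/
def MemH (Γ : Set ℂ) (φ : ℂ → ℂ) (σ : ℝ) (f : ℂ → ℂ) : Prop := hNorm Γ φ σ f < ∞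

/-! ### The operators `P_Ω`, `S` and `T` -/

/-- `u` is the bounded harmonic extension of `f|_{∂Ω}` to `Ω`, continued harmonically across
`∂Ω` to some neighbourhood of the closure. -/
def IsPoissonExtension (Ω : Set ℂ) (f u : ℂ → ℂ) : Prop :=
  InnerProductSpace.HarmonicOnNhd u (closure Ω) ∧ Bornology.IsBounded (u '' Ω) ∧
    EqOn u f (frontier Ω)

open Classical in
/-- The Poisson extension `P_Ω[f]`, extended harmonically past the boundary; near the closure of
an exterior domain it is unique.  It is `0` by convention if no such extension exists. -/
def poisson (Ω : Set ℂ) (f : ℂ → ℂ) : ℂ → ℂ :=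
  if h : ∃ u, IsPoissonExtension Ω f u then h.choose else 0

/-- The quotient `g / V`, extended by continuity across `Γ = ∂Ω`, where `V` vanishes. -/
def divExt (Ω : Set ℂ) (V : ℂ → ℝ) (g : ℂ → ℂ) : ℂ → ℂ :=
  extendFrom (frontier Ω)ᶜ (fun z => g z / (V z : ℂ))

/-- `V` as a complex-valued function. -/
def toC (V : ℂ → ℝ) : ℂ → ℂ := fun z => (V z : ℂ)

/-- `|∂V|²`. -/
def gradSq (V : ℂ → ℝ) (z : ℂ) : ℂ := ((‖dz (toC V) z‖ ^ 2 : ℝ) : ℂ)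

/-- `S[f] = ∂V ∂̄f + ∂̄V ∂f + f ΔV + |∂V|² (P_Ω f - f)/V + (ϑ/4) Δ((P_Ω f - f)/V)`. -/
def opS (Ω : Set ℂ) (V : ℂ → ℝ) (ϑ : ℂ) (f : ℂ → ℂ) (z : ℂ) : ℂ :=
  dz (toC V) z * dzbar f z + dzbar (toC V) z * dz f z + f z * qLap (toC V) z
    + gradSq V z * divExt Ω V (poisson Ω f - f) z
    + ϑ / 4 * qLap (divExt Ω V (poisson Ω f - f)) z

/-- `L = 2 |∂V|² log|φ|/V + (ϑ/2) Δ(log|φ|/V)`. -/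
def funL (Ω : Set ℂ) (φ : ℂ → ℂ) (V : ℂ → ℝ) (ϑ : ℂ) (z : ℂ) : ℂ :=
  2 * gradSq V z * divExt Ω V (fun w => (Real.log ‖φ w‖ : ℂ)) z
    + ϑ / 2 * qLap (divExt Ω V (fun w => (Real.log ‖φ w‖ : ℂ))) z

/-- The nonlinear operator
`T[f] = (4 V |∂V|²)⁻¹ { L + ϑ S[f] - exp(P_Ω[log(L + ϑ S[f])]) }`. -/
def opT (Ω : Set ℂ) (φ : ℂ → ℂ) (V : ℂ → ℝ) (ϑ : ℂ) (f : ℂ → ℂ) (z : ℂ) : ℂ :=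
  1 / (4 * gradSq V z) *
    divExt Ω V (fun w => funL Ω φ V ϑ w + ϑ * opS Ω V ϑ f w
      - Complex.exp (poisson Ω (fun ξ => Complex.log (funL Ω φ V ϑ ξ + ϑ * opS Ω V ϑ f ξ)) w)) z

/-- The iterates `𝓔_k = T^{k+1}[0]`. -/
def calE (Ω : Set ℂ) (φ : ℂ → ℂ) (V : ℂ → ℝ) (ϑ : ℂ) (k : ℕ) : ℂ → ℂ :=
  (opT Ω φ V ϑ)^[k + 1] 0

/-- `C₂ = 2 max {1, C₁ (16/(σ*)⁴ + 64/(σ*)⁶)}`. -/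
def constC2 (C₁ σs : ℝ) : ℝ := 2 * max 1 (C₁ * (16 / σs ^ 4 + 64 / σs ^ 6))

end BerezinOP

end

/-! Transport by `φ` turns a germ along `Γ` into a function near the unit circle, and polarization
turns that into a holomorphic function `F(z, w)` of two independent variables. The germ sits on `w =
conj z`, the complexified circle is `z w = 1`, and every ingredient of the operator becomes
explicit. The Poisson extension is a Laurent splitting: `F(ζ, 1/ζ)`, holomorphic on an annulus, is
the sum of a part holomorphic inside the outer circle, continued as a function of `1/w`, and a part
holomorphic outside the inner circle, continued as a function of `z` (`proj`). Since `Q - Qb`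
vanishes to exactly second order on `Γ`, its signed root is `V = (z w - 1) k` with `k` free of zeros
(`exists_isModel`), so division by `V` is division by `z w - 1`, that is, a divided difference
(`quot`). With `X = log(L + ϑ S[f])` and its Poisson extension `PX`, the bracket in `T` is `e^X -
e^{PX} = e^{PX} (X - PX) expQuot(X - PX)`, so `T` is an analytic expression in `quot X`, `PX` and
`X`.

When the domain shrinks by `δ`, each derivative, projection or divided difference costs a factor
`1/δ`. The operator `S` costs only `1/δ` in total, because the triple loss of its last term is paid
for by `‖ϑ‖ ≤ δ²`; forming `quot X` and `PX` costs another `1/δ`. As `S` enters with a factor `ϑ`,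
the operator `T` is Lipschitz with constant `K ‖ϑ‖ / δ²` on a ball (`exists_lipschitz_opT`).
Spending the available `σ*/2` in `k + 1` equal steps makes this constant at most `½ C₂ ‖ϑ‖ k² ≤ ½`.
Now `E_k = T^{k+1}[0]` and `T[E_k] = T^{k+1}[E_0]`, so the error is the distance between two orbits
after `k + 1` steps, started at `0` and at `E_0`; this is (a), see `iteration_estimate`. The choice
of `k` in (b) makes the base of the power at most `1/8`.

It remains to identify the polarized iteration with the given one on germs (`opT_eventuallyEq`). As
`poisson` is defined by choice, this rests on the uniqueness of bounded harmonic extensions, which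
follows from a maximum principle with barrier `log|φ|` (`harmonic_nonpos`). -/

noncomputable section
namespace BerezinOP

/-! ### Functions of two complex variables -/

/-- The partial derivative in the first variable. -/
def pd1 (F : ℂ × ℂ → ℂ) (p : ℂ × ℂ) : ℂ := deriv (fun z => F (z, p.2)) p.1

/-- The partial derivative in the second variable. -/
def pd2 (F : ℂ × ℂ → ℂ) (p : ℂ × ℂ) : ℂ := deriv (fun w => F (p.1, w)) p.2

theorem continuousOn_intervalIntegral_param {X : Type*} [TopologicalSpace X]
    {U : Set X} {K : X → ℝ → ℂ} (a b : ℝ)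
    (hK : ContinuousOn (fun q : X × ℝ => K q.1 q.2) (U ×ˢ univ)) :
    ContinuousOn (fun x => ∫ t in a..b, K x t) U := by
  rw [continuousOn_iff_continuous_domRestrict]
  refine intervalIntegral.continuous_parametric_intervalIntegral_of_continuous'
    (f := fun (x : U) t => K x t) ?_ a b
  have : Continuous (fun q : U × ℝ => ((q.1 : X), q.2)) := by fun_prop
  exact hK.comp_continuous this (fun q => ⟨q.1.2, mem_univ _⟩)

/-- The derivative is a pointwise limit of difference quotients along one fixed sequence of
increments, each continuous in `t`; continuity of the derivative itself is not needed. -/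
theorem aestronglyMeasurable_deriv_param {U : Set ℂ} (hU : IsOpen U) {K : ℂ → ℝ → ℂ}
    (hK : ContinuousOn (fun q : ℂ × ℝ => K q.1 q.2) (U ×ˢ univ))
    (hd : ∀ t, DifferentiableOn ℂ (fun x => K x t) U) {x : ℂ} (hx : x ∈ U)
    (μ : MeasureTheory.Measure ℝ) :
    MeasureTheory.AEStronglyMeasurable (fun t => deriv (fun x => K x t) x) μ := by
  obtain ⟨ε, hε, hb⟩ := Metric.isOpen_iff.1 hU x hx
  have hlim : Tendsto (fun n : ℕ => ((ε / 2 / (n + 1) : ℝ) : ℂ)) atTop (𝓝[≠] 0) := by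
    rw [tendsto_nhdsWithin_iff]
    constructor
    · have := tendsto_const_div_atTop_nhds_zero_nat (ε / 2)
      have h2 := (tendsto_add_atTop_iff_nat 1).2 this
      have h3 := (Complex.continuous_ofReal.tendsto 0).comp h2
      simpa [Function.comp_def] using h3
    · refine Eventually.of_forall fun n => ?_
      have : (ε / 2 / (n + 1) : ℝ) ≠ 0 := by positivity
      simpa using (Complex.ofReal_ne_zero.2 this)
  have hcont : ∀ y ∈ U, Continuous (fun t => K y t) := fun y hy =>
    hK.comp_continuous (f := fun t : ℝ => (y, t)) (by fun_prop) (fun t => ⟨hy, mem_univ _⟩)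
  refine aestronglyMeasurable_of_tendsto_ae (u := atTop)
    (f := fun (n : ℕ) t => (((ε / 2 / (n + 1)   : ℝ) : ℂ))⁻¹ *
      (K (x + ((ε / 2 / (n + 1) : ℝ) : ℂ)) t - K x t)) ?_ ?_
  · intro n
    have hmem : x + ((ε / 2 / (n + 1) : ℝ) : ℂ) ∈ U := by
      apply hb
      rw [Metric.mem_ball, dist_eq_norm, add_sub_cancel_left, Complex.norm_real, Real.norm_eq_abs,
        abs_of_pos (by positivity), div_lt_iff₀ (by positivity)]
      have : (0 : ℝ) ≤ n := Nat.cast_nonneg n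
      nlinarith
    exact (continuous_const.mul ((hcont _ hmem).sub (hcont x hx))).aestronglyMeasurable
  · refine Eventually.of_forall fun t => ?_
    have h := ((hd t).differentiableAt (hU.mem_nhds hx)).hasDerivAt
    rw [hasDerivAt_iff_tendsto_slope_zero] at h
    exact h.comp hlim

/-- Differentiation under the integral needs a locally uniform bound for the derivative; Cauchy's
estimate on circles of radius `ε/4` extracts it from the bound `M` for `K` alone. -/
theorem differentiableOn_intervalIntegral_param {U : Set ℂ} (hU : IsOpen U) {K : ℂ → ℝ → ℂ}
    {a b : ℝ} (hK : ContinuousOn (fun q : ℂ × ℝ => K q.1 q.2) (U ×ˢ univ))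
    (hd : ∀ t, DifferentiableOn ℂ (fun x => K x t) U) :
    DifferentiableOn ℂ (fun x => ∫ t in a..b, K x t) U := by
  intro x hx
  refine DifferentiableAt.differentiableWithinAt ?_
  obtain ⟨ε, hε, hb⟩ := Metric.isOpen_iff.1 hU x hx
  have hcont : ∀ y ∈ U, Continuous (fun t => K y t) := fun y hy =>
    hK.comp_continuous (f := fun t : ℝ => (y, t)) (by fun_prop) (fun t => ⟨hy, mem_univ _⟩)
  have hsub : Metric.closedBall x (ε / 2) ⊆ U :=
    (Metric.closedBall_subset_ball (by linarith)).trans hb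
  obtain ⟨M, hM⟩ := ((isCompact_closedBall x (ε / 2)).prod
    (isCompact_uIcc (a := a) (b := b))).exists_bound_of_continuousOn
    (hK.mono (prod_mono hsub (subset_univ _)))
  have hball : Metric.ball x (ε / 4) ∈ 𝓝 x := Metric.ball_mem_nhds _ (by linarith)
  refine (intervalIntegral.hasDerivAt_integral_of_dominated_loc_of_deriv_le (𝕜 := ℂ)
    (μ := MeasureTheory.volume)
    (F := K) (F' := fun y t => deriv (fun x => K x t) y) (x₀ := x) (s := Metric.ball x (ε / 4))
    (bound := fun _ => M / (ε / 4)) (a := a) (b := b) hball ?_ ?_ ?_ ?_ ?_ ?_).2.differentiableAt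
  · filter_upwards [hU.mem_nhds hx] with y hy using (hcont y hy).aestronglyMeasurable
  · exact (hcont x hx).intervalIntegrable _ _
  · exact aestronglyMeasurable_deriv_param hU hK hd hx _
  · refine Eventually.of_forall fun t ht y hy => ?_
    rw [Metric.mem_ball] at hy
    have hs : Metric.closedBall y (ε / 4) ⊆ Metric.closedBall x (ε / 2) := by
      apply Metric.closedBall_subset_closedBall'
      linarith
    refine Complex.norm_deriv_le_of_forall_mem_sphere_norm_le (by linarith) ?_ ?_
    · refine DifferentiableOn.diffContOnCl ?_
      rw [closure_ball _ (by linarith : ε / 4 ≠ 0)]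
      exact (hd t).mono (hs.trans hsub)
    · intro z hz
      exact hM (z, t) ⟨hs (Metric.sphere_subset_closedBall hz), uIoc_subset_uIcc ht⟩
  · exact intervalIntegrable_const
  · refine Eventually.of_forall fun t _ y hy => ?_
    refine ((hd t).differentiableAt (hU.mem_nhds (hb ?_))).hasDerivAt
    exact Metric.ball_subset_ball (by linarith) hy

theorem pd1_eq_circleIntegral {F : ℂ × ℂ → ℂ} {U : Set ℂ} (hU : IsOpen U) {w : ℂ}
    (hF : DifferentiableOn ℂ (fun z => F (z, w)) U) {c z : ℂ} {R : ℝ}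
    (hc : Metric.closedBall c R ⊆ U) (hz : z ∈ Metric.ball c R) :
    pd1 F (z, w) = (2 * Real.pi * Complex.I : ℂ)⁻¹ *
      ∫ θ in (0 : ℝ)..2 * Real.pi, deriv (circleMap c R) θ *
        (((circleMap c R θ - z) ^ 2)⁻¹ * F (circleMap c R θ, w)) :=
  (Complex.two_pi_I_inv_smul_circleIntegral_sub_sq_inv_smul_of_differentiable hU hc hF hz).symm

theorem circleMap_sub_ne_zero_of_mem_ball {c z : ℂ} {R : ℝ} (hz : z ∈ Metric.ball c R) (θ : ℝ) :
    circleMap c R θ - z ≠ 0 := by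
  intro h
  rw [sub_eq_zero] at h
  have hR : 0 < R := Metric.pos_of_mem_ball hz
  have := circleMap_mem_sphere c hR.le θ
  rw [h, Metric.mem_sphere] at this
  rw [Metric.mem_ball] at hz
  linarith

/-- Cauchy's formula over a fixed circle expresses the derivative through values of `F`, and the
kernel is jointly continuous while the point stays inside the circle. -/
theorem continuousOn_pd1_of_separately {F : ℂ × ℂ → ℂ} {D : Set (ℂ × ℂ)} (hD : IsOpen D)
    (hc : ContinuousOn F D)
    (h1 : ∀ p ∈ D, DifferentiableAt ℂ (fun z => F (z, p.2)) p.1) : ContinuousOn (pd1 F) D := by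
  rintro ⟨z₀, w₀⟩ hp
  obtain ⟨ε, hε, hb⟩ := Metric.isOpen_iff.1 hD _ hp
  have key : ∀ z ∈ Metric.ball z₀ ε, ∀ w ∈ Metric.ball w₀ ε, (z, w) ∈ D := by
    intro z hz w hw
    apply hb
    rw [← ball_prod_same]
    exact ⟨hz, hw⟩
  set N := Metric.ball z₀ (ε / 2) ×ˢ Metric.ball w₀ ε with hN
  have hNn : N ∈ 𝓝 (z₀, w₀) :=
    prod_mem_nhds (Metric.ball_mem_nhds _ (by linarith)) (Metric.ball_mem_nhds _ hε)
  have hsp : ∀ θ : ℝ, circleMap z₀ (ε / 2) θ ∈ Metric.ball z₀ ε := fun θ => by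
    have := circleMap_mem_sphere z₀ (by linarith : 0 ≤ ε / 2) θ
    rw [Metric.mem_sphere] at this
    rw [Metric.mem_ball]; linarith
  have hcon : ContinuousOn (fun p : ℂ × ℂ => (2 * Real.pi * Complex.I : ℂ)⁻¹ *
      ∫ θ in (0 : ℝ)..2 * Real.pi, deriv (circleMap z₀ (ε / 2)) θ *
        (((circleMap z₀ (ε / 2) θ - p.1) ^ 2)⁻¹ * F (circleMap z₀ (ε / 2) θ, p.2))) N := by
    refine continuousOn_const.mul (continuousOn_intervalIntegral_param (X := ℂ × ℂ) _ _ ?_)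
    refine ContinuousOn.mul ?_ (ContinuousOn.mul ?_ ?_)
    · simp only [deriv_circleMap]; fun_prop
    · refine ContinuousOn.inv₀ (by fun_prop) ?_
      rintro ⟨p, θ⟩ ⟨hp, -⟩
      exact pow_ne_zero _ (circleMap_sub_ne_zero_of_mem_ball hp.1 θ)
    · refine hc.comp (by fun_prop) ?_
      rintro ⟨p, θ⟩ ⟨hp, -⟩
      exact key _ (hsp θ) _ hp.2
  refine ((hcon.congr ?_).continuousAt hNn).continuousWithinAt
  rintro ⟨z, w⟩ ⟨hz, hw⟩
  refine pd1_eq_circleIntegral Metric.isOpen_ball (U := Metric.ball z₀ ε) ?_ ?_ hz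
  · intro y hy
    exact (h1 (y, w) (key y hy w hw)).differentiableWithinAt
  · exact Metric.closedBall_subset_ball (by linarith)

theorem isOpen_swap_preimage {D : Set (ℂ × ℂ)} (hD : IsOpen D) : IsOpen (Prod.swap ⁻¹' D) :=
  hD.preimage continuous_swap

theorem pd2_eq_pd1_swap (F : ℂ × ℂ → ℂ) : pd2 F = fun p => pd1 (F ∘ Prod.swap) p.swap := rfl

theorem continuousOn_pd2_of_separately {F : ℂ × ℂ → ℂ} {D : Set (ℂ × ℂ)} (hD : IsOpen D)
    (hc : ContinuousOn F D)
    (h2 : ∀ p ∈ D, DifferentiableAt ℂ (fun w => F (p.1, w)) p.2) : ContinuousOn (pd2 F) D := by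
  rw [pd2_eq_pd1_swap]
  have : ContinuousOn (pd1 (F ∘ Prod.swap)) (Prod.swap ⁻¹' D) :=
    continuousOn_pd1_of_separately (isOpen_swap_preimage hD)
      (hc.comp (t := D) continuous_swap.continuousOn fun p hp => hp) (fun p hp => h2 p.swap hp)
  exact this.comp continuous_swap.continuousOn (fun p hp => by simpa using hp)

/-- Osgood's lemma: a continuous function that is holomorphic in each variable is holomorphic. -/
theorem differentiableOn_of_separately {F : ℂ × ℂ → ℂ} {D : Set (ℂ × ℂ)} (hD : IsOpen D)
    (hc : ContinuousOn F D)
    (h1 : ∀ p ∈ D, DifferentiableAt ℂ (fun z => F (z, p.2)) p.1)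
    (h2 : ∀ p ∈ D, DifferentiableAt ℂ (fun w => F (p.1, w)) p.2) : DifferentiableOn ℂ F D := by
  intro p hp
  have c1 := (continuousOn_pd1_of_separately hD hc h1).continuousAt (hD.mem_nhds hp)
  have c2 := (continuousOn_pd2_of_separately hD hc h2).continuousAt (hD.mem_nhds hp)
  -- Partial derivatives that exist nearby and are continuous at `p` give strict differentiability
  -- in the pair.
  have := hasStrictFDerivAt_uncurry_coprod (𝕜 := ℂ) (u := p) (f := fun z w => F (z, w))
    (f₁ := fun z w => ContinuousLinearMap.toSpanSingleton ℂ (pd1 F (z, w)))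
    (f₂ := fun z w => ContinuousLinearMap.toSpanSingleton ℂ (pd2 F (z, w)))
    (by filter_upwards [hD.mem_nhds hp] with v hv using (h1 v hv).hasDerivAt.hasFDerivAt)
    (by filter_upwards [hD.mem_nhds hp] with v hv using (h2 v hv).hasDerivAt.hasFDerivAt)
    ((ContinuousLinearMap.toSpanSingletonCLE.continuous.continuousAt (x := pd1 F p)).comp c1)
    ((ContinuousLinearMap.toSpanSingletonCLE.continuous.continuousAt (x := pd2 F p)).comp c2)
  exact this.hasFDerivAt.differentiableAt.differentiableWithinAt

theorem DifferentiableOn.slice1 {F : ℂ × ℂ → ℂ} {D : Set (ℂ × ℂ)} (hF : DifferentiableOn ℂ F D)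
    (hD : IsOpen D) {p : ℂ × ℂ} (hp : p ∈ D) : DifferentiableAt ℂ (fun z => F (z, p.2)) p.1 :=
  DifferentiableAt.comp (g := F) (f := fun z => (z, p.2)) p.1
    (hF.differentiableAt (hD.mem_nhds hp)) (by fun_prop)

theorem DifferentiableOn.slice2 {F : ℂ × ℂ → ℂ} {D : Set (ℂ × ℂ)} (hF : DifferentiableOn ℂ F D)
    (hD : IsOpen D) {p : ℂ × ℂ} (hp : p ∈ D) : DifferentiableAt ℂ (fun w => F (p.1, w)) p.2 :=
  DifferentiableAt.comp (g := F) (f := fun w => (p.1, w)) p.2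
    (hF.differentiableAt (hD.mem_nhds hp)) (by fun_prop)

theorem differentiableOn_intervalIntegral_param₂ {D : Set (ℂ × ℂ)} (hD : IsOpen D)
    {K : ℂ × ℂ → ℝ → ℂ} {a b : ℝ}
    (hK : ContinuousOn (fun q : (ℂ × ℂ) × ℝ => K q.1 q.2) (D ×ˢ univ))
    (hd : ∀ t, DifferentiableOn ℂ (fun x => K x t) D) :
    DifferentiableOn ℂ (fun x => ∫ t in a..b, K x t) D := by
  refine differentiableOn_of_separately hD (continuousOn_intervalIntegral_param a b hK) ?_ ?_
  · rintro ⟨z, w⟩ hp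
    have hU : IsOpen {y : ℂ | (y, w) ∈ D} := hD.preimage (by fun_prop)
    refine (differentiableOn_intervalIntegral_param hU (K := fun y t => K (y, w) t) ?_ ?_
      ).differentiableAt (hU.mem_nhds hp)
    · exact hK.comp (f := fun q : ℂ × ℝ => ((q.1, w), q.2)) (by fun_prop)
        (fun q hq => ⟨hq.1, mem_univ _⟩)
    · intro t y hy
      exact (DifferentiableOn.slice1 (hd t) hD (p := (y, w)) hy).differentiableWithinAt
  · rintro ⟨z, w⟩ hp
    have hU : IsOpen {y : ℂ | (z, y) ∈ D} := hD.preimage (by fun_prop)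
    refine (differentiableOn_intervalIntegral_param hU (K := fun y t => K (z, y) t) ?_ ?_
      ).differentiableAt (hU.mem_nhds hp)
    · exact hK.comp (f := fun q : ℂ × ℝ => ((z, q.1), q.2)) (by fun_prop)
        (fun q hq => ⟨hq.1, mem_univ _⟩)
    · intro t y hy
      exact (DifferentiableOn.slice2 (hd t) hD (p := (z, y)) hy).differentiableWithinAt

theorem differentiableOn_pd1 {F : ℂ × ℂ → ℂ} {D : Set (ℂ × ℂ)} (hD : IsOpen D)
    (hF : DifferentiableOn ℂ F D) : DifferentiableOn ℂ (pd1 F) D := by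
  rintro ⟨z₀, w₀⟩ hp
  obtain ⟨ε, hε, hb⟩ := Metric.isOpen_iff.1 hD _ hp
  have key : ∀ z ∈ Metric.ball z₀ ε, ∀ w ∈ Metric.ball w₀ ε, (z, w) ∈ D := by
    intro z hz w hw
    apply hb
    rw [← ball_prod_same]
    exact ⟨hz, hw⟩
  set N := Metric.ball z₀ (ε / 2) ×ˢ Metric.ball w₀ ε with hN
  have hNn : N ∈ 𝓝 (z₀, w₀) :=
    prod_mem_nhds (Metric.ball_mem_nhds _ (by linarith)) (Metric.ball_mem_nhds _ hε)
  have hNo : IsOpen N := Metric.isOpen_ball.prod Metric.isOpen_ball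
  have hsp : ∀ θ : ℝ, circleMap z₀ (ε / 2) θ ∈ Metric.ball z₀ ε := fun θ => by
    have := circleMap_mem_sphere z₀ (by linarith : 0 ≤ ε / 2) θ
    rw [Metric.mem_sphere] at this
    rw [Metric.mem_ball]; linarith
  have hdif : DifferentiableOn ℂ (fun p : ℂ × ℂ => (2 * Real.pi * Complex.I : ℂ)⁻¹ *
      ∫ θ in (0 : ℝ)..2 * Real.pi, deriv (circleMap z₀ (ε / 2)) θ *
        (((circleMap z₀ (ε / 2) θ - p.1) ^ 2)⁻¹ * F (circleMap z₀ (ε / 2) θ, p.2))) N := by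
    refine (differentiableOn_const _).mul (differentiableOn_intervalIntegral_param₂ hNo ?_ ?_)
    · refine ContinuousOn.mul ?_ (ContinuousOn.mul ?_ ?_)
      · simp only [deriv_circleMap]; fun_prop
      · refine ContinuousOn.inv₀ (by fun_prop) ?_
        rintro ⟨p, θ⟩ ⟨hp, -⟩
        exact pow_ne_zero _ (circleMap_sub_ne_zero_of_mem_ball hp.1 θ)
      · refine hF.continuousOn.comp (by fun_prop) ?_
        rintro ⟨p, θ⟩ ⟨hp, -⟩
        exact key _ (hsp θ) _ hp.2
    · intro t
      refine (differentiableOn_const _).mul (DifferentiableOn.mul ?_ ?_)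
      · refine DifferentiableOn.fun_inv (by fun_prop) ?_
        intro p hp
        exact pow_ne_zero _ (circleMap_sub_ne_zero_of_mem_ball hp.1 t)
      · refine hF.comp (f := fun p : ℂ × ℂ => (circleMap z₀ (ε / 2) t, p.2)) (by fun_prop) ?_
        intro p hp
        exact key _ (hsp t) _ hp.2
  refine ((hdif.congr ?_).differentiableAt hNn).differentiableWithinAt
  rintro ⟨z, w⟩ ⟨hz, hw⟩
  refine pd1_eq_circleIntegral Metric.isOpen_ball (U := Metric.ball z₀ ε) ?_ ?_ hz
  · intro y hy
    exact (DifferentiableOn.slice1 hF hD (key y hy w hw)).differentiableWithinAt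
  · exact Metric.closedBall_subset_ball (by linarith)

theorem differentiableOn_comp_swap {F : ℂ × ℂ → ℂ} {D : Set (ℂ × ℂ)}
    (hF : DifferentiableOn ℂ F D) : DifferentiableOn ℂ (F ∘ Prod.swap) (Prod.swap ⁻¹' D) :=
  hF.comp (t := D) (f := Prod.swap) (fun _ _ =>
    (ContinuousLinearEquiv.prodComm ℂ ℂ ℂ).differentiableAt.differentiableWithinAt) fun _ hp => hp

theorem differentiableOn_pd2 {F : ℂ × ℂ → ℂ} {D : Set (ℂ × ℂ)} (hD : IsOpen D)
    (hF : DifferentiableOn ℂ F D) : DifferentiableOn ℂ (pd2 F) D := by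
  have h := differentiableOn_comp_swap (differentiableOn_pd1 (isOpen_swap_preimage hD)
    (differentiableOn_comp_swap hF))
  exact h

theorem dslope_eq_integral_deriv {f : ℂ → ℂ} {U : Set ℂ} (hU : IsOpen U) (hc : Convex ℝ U)
    (hf : DifferentiableOn ℂ f U) {c w : ℂ} (hcU : c ∈ U) (hw : w ∈ U) :
    dslope f c w = ∫ t in (0 : ℝ)..1, deriv f (c + t • (w - c)) := by
  rcases eq_or_ne w c with rfl | hne
  · simp
  · have hmem : ∀ t ∈ Icc (0 : ℝ) 1, c + t • (w - c) ∈ U := fun t ht =>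
      hc.add_smul_sub_mem hcU hw ht
    have := intervalIntegral.integral_unitInterval_deriv_eq_sub (𝕜 := ℂ) (f := f) (f' := deriv f)
      (z₀ := c) (z₁ := w - c) ?_ ?_
    · rw [dslope_of_ne _ hne, slope_def_module, inv_smul_eq_iff₀ (sub_ne_zero.2 hne)]
      rw [this]; simp
    · exact (hf.deriv hU).continuousOn.comp (by fun_prop) hmem
    · intro t ht
      exact (hf.differentiableAt (hU.mem_nhds (hmem t ht))).hasDerivAt

/-- The divided difference of `F` in the second variable, based at a holomorphically varying point,
is holomorphic. -/
theorem differentiableOn_dslope_param {F : ℂ × ℂ → ℂ} {D : Set (ℂ × ℂ)} (hD : IsOpen D)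
    (hF : DifferentiableOn ℂ F D) {c : ℂ → ℂ} (hc : ∀ p ∈ D, DifferentiableAt ℂ c p.1)
    (hcD : ∀ p ∈ D, (p.1, c p.1) ∈ D) :
    DifferentiableOn ℂ (fun p : ℂ × ℂ => dslope (fun w => F (p.1, w)) (c p.1) p.2) D := by
  have hcc : ∀ p ∈ D, DifferentiableAt ℂ (fun q : ℂ × ℂ => c q.1) p := fun p hp =>
    (hc p hp).comp p differentiableAt_fst
  rintro ⟨z₀, w₀⟩ hp
  refine DifferentiableAt.differentiableWithinAt ?_
  -- On the diagonal the difference quotient is singular and is represented by an average of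
  -- derivatives; off the diagonal the quotient formula is itself holomorphic.
  by_cases hw : w₀ = c z₀
  · subst hw
    obtain ⟨ε, hε, hb⟩ := Metric.isOpen_iff.1 hD _ hp
    have key : ∀ z ∈ Metric.ball z₀ ε, ∀ w ∈ Metric.ball (c z₀) ε, (z, w) ∈ D := by
      intro z hz w hw
      apply hb
      rw [← ball_prod_same]
      exact ⟨hz, hw⟩
    have hcont : ContinuousOn (fun q : ℂ × ℂ => c q.1) D := fun q hq =>
      (hcc q hq).continuousAt.continuousWithinAt
    set N : Set (ℂ × ℂ) := (Metric.ball z₀ ε ×ˢ Metric.ball (c z₀) ε) ∩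
      (D ∩ (fun q : ℂ × ℂ => c q.1) ⁻¹' Metric.ball (c z₀) ε) with hN
    have hNo : IsOpen N := (Metric.isOpen_ball.prod Metric.isOpen_ball).inter
      (hcont.isOpen_inter_preimage hD Metric.isOpen_ball)
    have hNn : N ∈ 𝓝 (z₀, c z₀) := hNo.mem_nhds
      ⟨⟨Metric.mem_ball_self hε, Metric.mem_ball_self hε⟩, hp, Metric.mem_ball_self hε⟩
    -- Clamping keeps the segment inside the domain for every real `t`, as the lemma on parameter
    -- integrals asks; on the interval of integration it changes nothing.
    set τ : ℝ → ℝ := fun t => max 0 (min t 1)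
    have hτ : Continuous τ := by fun_prop
    have hτI : ∀ t, τ t ∈ Icc (0 : ℝ) 1 := fun t => ⟨le_max_left _ _, by simp [τ]⟩
    have hmem : ∀ p ∈ N, ∀ t, (p.1, c p.1 + τ t • (p.2 - c p.1)) ∈ D := fun p hp t =>
      key _ hp.1.1 _ ((convex_ball (c z₀) ε).add_smul_sub_mem hp.2.2 hp.1.2 (hτI t))
    have hpd := differentiableOn_pd2 hD hF
    have hdif : DifferentiableOn ℂ (fun p : ℂ × ℂ =>
        ∫ t in (0 : ℝ)..1, pd2 F (p.1, c p.1 + τ t • (p.2 - c p.1))) N := by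
      refine differentiableOn_intervalIntegral_param₂ hNo ?_ ?_
      · refine hpd.continuousOn.comp ?_ (fun q hq => hmem q.1 hq.1 q.2)
        have h1 : ContinuousOn (fun q : (ℂ × ℂ) × ℝ => c q.1.1) (N ×ˢ univ) :=
          hcont.comp (f := fun q : (ℂ × ℂ) × ℝ => q.1) (by fun_prop) (fun q hq => hq.1.2.1)
        have h2 : ContinuousOn (fun q : (ℂ × ℂ) × ℝ => τ q.2) (N ×ˢ univ) := by fun_prop
        exact ContinuousOn.prodMk (by fun_prop)
          (h1.add (h2.smul (ContinuousOn.sub (by fun_prop) h1)))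
      · intro t
        refine hpd.comp ?_ (fun q hq => hmem q hq t)
        intro q hq
        have := hcc q hq.2.1
        exact (DifferentiableAt.prodMk differentiableAt_fst (this.add
          ((differentiableAt_snd.sub this).const_smul (τ t)))).differentiableWithinAt
    refine (hdif.congr ?_).differentiableAt hNn
    rintro ⟨z, w⟩ hzw
    rw [dslope_eq_integral_deriv (U := Metric.ball (c z₀) ε) Metric.isOpen_ball (convex_ball _ _)
      (fun y hy => (DifferentiableOn.slice2 hF hD (key z hzw.1.1 y hy)).differentiableWithinAt)
      hzw.2.2 hzw.1.2]
    refine intervalIntegral.integral_congr fun t ht => ?_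
    rw [uIcc_of_le zero_le_one] at ht
    have : τ t = t := by simp [τ, ht.1, ht.2]
    simp only [pd2, this]
  · have hcz := hcc _ hp
    have hev : (fun p : ℂ × ℂ => dslope (fun w => F (p.1, w)) (c p.1) p.2) =ᶠ[𝓝 (z₀, w₀)]
        fun p => (p.2 - c p.1)⁻¹ * (F p - F (p.1, c p.1)) := by
      have : ∀ᶠ p : ℂ × ℂ in 𝓝 (z₀, w₀), p.2 - c p.1 ≠ 0 :=
        (continuousAt_snd.sub hcz.continuousAt).eventually_ne (sub_ne_zero.2 hw)
      filter_upwards [this] with p hp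
      rw [dslope_of_ne _ (sub_ne_zero.1 hp), slope_def_module, smul_eq_mul]
    refine DifferentiableAt.congr_of_eventuallyEq ?_ hev
    refine DifferentiableAt.mul (DifferentiableAt.inv (differentiableAt_snd.sub hcz)
      (sub_ne_zero.2 hw)) (DifferentiableAt.sub (hF.differentiableAt (hD.mem_nhds hp)) ?_)
    exact DifferentiableAt.comp (g := F) (f := fun p : ℂ × ℂ => (p.1, c p.1)) (z₀, w₀)
      (hF.differentiableAt (hD.mem_nhds (hcD _ hp))) (differentiableAt_fst.prodMk hcz)

end BerezinOP
end

noncomputable section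
namespace BerezinOP

/-! ### The polarized domains -/

theorem sqrt_one_add_sq_bounds (σ : ℝ) : |σ| < Real.sqrt (1 + σ ^ 2) ∧ 1 ≤ Real.sqrt (1 + σ ^ 2) ∧
    Real.sqrt (1 + σ ^ 2) ^ 2 = 1 + σ ^ 2 := by
  refine ⟨?_, ?_, Real.sq_sqrt (by positivity)⟩
  · rw [← Real.sqrt_sq_eq_abs]
    exact Real.sqrt_lt_sqrt (sq_nonneg _) (by linarith)
  · rw [Real.one_le_sqrt]; nlinarith [sq_nonneg σ]

theorem rho_eq (σ : ℝ) : rho σ = Real.sqrt (1 + σ ^ 2) - σ := by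
  obtain ⟨h1, -, h3⟩ := sqrt_one_add_sq_bounds σ
  have : 0 < σ + Real.sqrt (1 + σ ^ 2) := by linarith [neg_abs_le σ]
  rw [rho, div_eq_iff this.ne']
  linear_combination -h3

theorem rho_inv_eq (σ : ℝ) : (rho σ)⁻¹ = σ + Real.sqrt (1 + σ ^ 2) := by
  rw [rho, one_div, inv_inv]

theorem rho_pos (σ : ℝ) : 0 < rho σ := by
  have := (sqrt_one_add_sq_bounds σ).1
  rw [rho_eq]; linarith [le_abs_self σ]

/-- This identity motivates the choice of `rho`: for `ρ < |z| < 1/ρ` the gap between `|z|` and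
`1/|z|` stays below `2σ`, so the complexified circle `z w = 1` over the annulus remains in the
fattened diagonal. -/
theorem rho_inv_sub_rho (σ : ℝ) : (rho σ)⁻¹ - rho σ = 2 * σ := by
  rw [rho_inv_eq, rho_eq]; ring

theorem continuous_rho : Continuous rho := by
  have : rho = fun σ => Real.sqrt (1 + σ ^ 2) - σ := funext rho_eq
  rw [this]; fun_prop

theorem rho_le_one {σ : ℝ} (h : 0 ≤ σ) : rho σ ≤ 1 := by
  have h1 := (sqrt_one_add_sq_bounds σ).2.1
  have h2 := rho_inv_eq σ
  have : 1 ≤ (rho σ)⁻¹ := by linarith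
  exact (one_le_inv₀ (rho_pos σ)).1 this

theorem one_le_rho_inv {σ : ℝ} (h : 0 ≤ σ) : 1 ≤ (rho σ)⁻¹ :=
  (one_le_inv₀ (rho_pos σ)).2 (rho_le_one h)

theorem rho_lt_one {σ : ℝ} (h : 0 < σ) : rho σ < 1 := by
  have h1 := (sqrt_one_add_sq_bounds σ).2.1
  have h2 := rho_inv_eq σ
  have : 1 < (rho σ)⁻¹ := by linarith
  exact (one_lt_inv₀ (rho_pos σ)).1 this

theorem one_sub_le_rho (σ : ℝ) : 1 - σ ≤ rho σ := by
  have h1 := (sqrt_one_add_sq_bounds σ).2.1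
  rw [rho_eq]; linarith

theorem rho_inv_le {σ : ℝ} (h : 0 ≤ σ) : (rho σ)⁻¹ ≤ 1 + 2 * σ := by
  have := rho_inv_sub_rho σ
  linarith [rho_le_one h]

/-- The constant is `1 - 3/4`: for `σ ≤ 1` one has `σ ≤ (3/4) √(1 + σ²)`, so the square root drops
by at most `3δ/4` while the term `-σ` gains `δ`. -/
theorem rho_add_le {σ δ : ℝ} (h0 : 0 ≤ δ) (h1 : δ ≤ σ) (h2 : σ ≤ 1) :
    rho σ + δ / 4 ≤ rho (σ - δ) := by
  obtain ⟨ha, ha', ha2⟩ := sqrt_one_add_sq_bounds σ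
  obtain ⟨hb, hb', hb2⟩ := sqrt_one_add_sq_bounds (σ - δ)
  rw [rho_eq, rho_eq]
  rw [abs_of_nonneg (by linarith)] at ha hb
  set a := Real.sqrt (1 + σ ^ 2)
  set b := Real.sqrt (1 + (σ - δ) ^ 2)
  have hσ : σ ≤ 3 / 4 * a := by nlinarith
  have hσ' : σ - δ ≤ 3 / 4 * b := by nlinarith
  have : (a - b) * (a + b) = δ * (σ + (σ - δ)) := by linear_combination ha2 - hb2
  have h3 : (a - b) * (a + b) ≤ (3 / 4 * δ) * (a + b) := by
    rw [this]; nlinarith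
  have := le_of_mul_le_mul_right h3 (by linarith)
  linarith

theorem rho_anti {s σ : ℝ} (h : s ≤ σ) : rho σ ≤ rho s := by
  obtain ⟨ha, ha', ha2⟩ := sqrt_one_add_sq_bounds σ
  obtain ⟨hb, hb', hb2⟩ := sqrt_one_add_sq_bounds s
  rw [rho_eq, rho_eq]
  set a := Real.sqrt (1 + σ ^ 2)
  set b := Real.sqrt (1 + s ^ 2)
  have : (a - b) * (a + b) = (σ - s) * (σ + s) := by linear_combination ha2 - hb2
  have h3 : (a - b) * (a + b) ≤ (σ - s) * (a + b) := by
    rw [this]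
    exact mul_le_mul_of_nonneg_left (by linarith [le_abs_self σ, le_abs_self s]) (by linarith)
  have := le_of_mul_le_mul_right h3 (by linarith)
  linarith

theorem rho_inv_mono {s σ : ℝ} (h : s ≤ σ) : (rho s)⁻¹ ≤ (rho σ)⁻¹ :=
  inv_anti₀ (rho_pos σ) (rho_anti h)

theorem rho_strictAnti {s σ : ℝ} (h : s < σ) : rho σ < rho s := by
  refine lt_of_le_of_ne (rho_anti h.le) fun he => ?_
  have h1 := rho_inv_sub_rho s
  have h2 := rho_inv_sub_rho σ
  rw [he] at h2; linarith

theorem rho_inv_add_le {σ δ : ℝ} (h0 : 0 ≤ δ) (h1 : δ ≤ σ) :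
    (rho (σ - δ))⁻¹ + δ ≤ (rho σ)⁻¹ := by
  rw [rho_inv_eq, rho_inv_eq]
  have : Real.sqrt (1 + (σ - δ) ^ 2) ≤ Real.sqrt (1 + σ ^ 2) :=
    Real.sqrt_le_sqrt (by nlinarith)
  linarith

/-- The open annulus `{ρ(σ) < |z| < 1/ρ(σ)}`. -/
def openAnnulus (σ : ℝ) : Set ℂ := {z | rho σ < ‖z‖ ∧ ‖z‖ < (rho σ)⁻¹}

/-- The domain of the variables `(z, w̄)` with `(z, w)` in the fattened diagonal annulus. -/
def Dom (σ : ℝ) : Set (ℂ × ℂ) := {p | (p.1, conj p.2) ∈ fatAnnulus σ}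

theorem mem_Dom {σ : ℝ} {p : ℂ × ℂ} :
    p ∈ Dom σ ↔ p.1 ∈ openAnnulus σ ∧ p.2 ∈ openAnnulus σ ∧ ‖p.1 - conj p.2‖ < 2 * σ := by
  simp [Dom, fatAnnulus, openAnnulus]

theorem isOpen_openAnnulus (σ : ℝ) : IsOpen (openAnnulus σ) :=
  (isOpen_lt continuous_const continuous_norm).inter (isOpen_lt continuous_norm continuous_const)

theorem isOpen_Dom (σ : ℝ) : IsOpen (Dom σ) := by
  have : Dom σ = (Prod.fst ⁻¹' openAnnulus σ) ∩ ((Prod.snd ⁻¹' openAnnulus σ) ∩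
      {p : ℂ × ℂ | ‖p.1 - conj p.2‖ < 2 * σ}) := by
    ext p; exact mem_Dom
  rw [this]
  refine ((isOpen_openAnnulus σ).preimage continuous_fst).inter
    (((isOpen_openAnnulus σ).preimage continuous_snd).inter (isOpen_lt ?_ continuous_const))
  exact (continuous_fst.sub (Complex.continuous_conj.comp continuous_snd)).norm

theorem openAnnulus_mono {s σ : ℝ} (h : s ≤ σ) : openAnnulus s ⊆ openAnnulus σ := fun _ hz =>
  ⟨(rho_anti h).trans_lt hz.1, hz.2.trans_le (rho_inv_mono h)⟩

theorem Dom_mono {s σ : ℝ} (h : s ≤ σ) : Dom s ⊆ Dom σ := fun p hp => by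
  rw [mem_Dom] at hp ⊢
  exact ⟨openAnnulus_mono h hp.1, openAnnulus_mono h hp.2.1, by linarith [hp.2.2]⟩

theorem ne_zero_of_mem_openAnnulus {σ : ℝ} {z : ℂ} (h : z ∈ openAnnulus σ) : z ≠ 0 :=
  norm_pos_iff.1 ((rho_pos σ).trans h.1)

theorem inv_mem_openAnnulus {σ : ℝ} {z : ℂ} (h : z ∈ openAnnulus σ) : z⁻¹ ∈ openAnnulus σ := by
  have hz := norm_pos_iff.2 (ne_zero_of_mem_openAnnulus h)
  refine ⟨?_, ?_⟩
  · rw [norm_inv, lt_inv_comm₀ (rho_pos σ) hz]; exact h.2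
  · rw [norm_inv, inv_lt_inv₀ hz (rho_pos σ)]; exact h.1

/-- A point and its reflection in the unit circle lie on one ray, so their distance is the
difference of `|z|` and `1/|z|`. -/
theorem norm_sub_conj_inv_lt {σ : ℝ} {z : ℂ} (h : z ∈ openAnnulus σ) :
    ‖z - conj z⁻¹‖ < 2 * σ := by
  have hz0 := ne_zero_of_mem_openAnnulus h
  have hz := norm_pos_iff.2 hz0
  have hi := inv_mem_openAnnulus h
  have e : z - conj z⁻¹ = z * ((1 - (‖z‖⁻¹) ^ 2 : ℝ) : ℂ) := by
    have h3 : z⁻¹ * conj z⁻¹ = (((‖z‖⁻¹) ^ 2 : ℝ) : ℂ) := by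
      rw [Complex.mul_conj, Complex.normSq_eq_norm_sq, norm_inv]
    push_cast at h3 ⊢
    rw [← h3]; field_simp
  have e2 : ‖z - conj z⁻¹‖ = |‖z‖ - ‖z‖⁻¹| := by
    rw [e, norm_mul, Complex.norm_real, Real.norm_eq_abs]
    nth_rewrite 1 [← abs_of_pos hz]
    rw [← abs_mul]
    congr 1
    field_simp
  rw [e2, ← rho_inv_sub_rho, abs_lt]
  have h2 := hi.1; have h4 := hi.2
  rw [norm_inv] at h2 h4
  constructor <;> linarith [h.1, h.2]

theorem mem_Dom_inv_right {σ : ℝ} {z : ℂ} (h : z ∈ openAnnulus σ) : (z, z⁻¹) ∈ Dom σ :=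
  mem_Dom.2 ⟨h, inv_mem_openAnnulus h, norm_sub_conj_inv_lt h⟩

/-- Room for Cauchy estimates after shrinking by `δ`. The radius `δ/4` is dictated by the inner
circle of the annulus; the other constraints leave more space. -/
theorem ball_subset_Dom {σ δ : ℝ} (h0 : 0 ≤ δ) (h1 : δ ≤ σ) (h2 : σ ≤ 1) {p : ℂ × ℂ}
    (hp : p ∈ Dom (σ - δ)) : Metric.ball p (δ / 4) ⊆ Dom σ := by
  rintro ⟨z, w⟩ hq
  obtain ⟨a, b⟩ := p
  rw [← ball_prod_same] at hq
  obtain ⟨hz, hw⟩ := hq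
  rw [Metric.mem_ball, dist_eq_norm] at hz hw
  obtain ⟨ha, hb, hab⟩ := mem_Dom.1 hp
  have hr := rho_add_le h0 h1 h2
  have hri := rho_inv_add_le h0 h1
  simp only at ha hb hab hz hw
  have key : ∀ {x y : ℂ}, y ∈ openAnnulus (σ - δ) → ‖x - y‖ < δ / 4 → x ∈ openAnnulus σ := by
    intro x y hy hxy
    have h3 : ‖x‖ ≤ ‖x - y‖ + ‖y‖ := by simpa using norm_add_le (x - y) y
    have h4 : ‖y‖ ≤ ‖x - y‖ + ‖x‖ := by
      rw [norm_sub_rev]; simpa using norm_add_le (y - x) x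
    exact ⟨by linarith [hy.1], by linarith [hy.2]⟩
  refine mem_Dom.2 ⟨key ha hz, key hb hw, ?_⟩
  have e : z - conj w = (z - a) + (a - conj b) - conj (w - b) := by
    rw [map_sub]; ring
  calc ‖z - conj w‖ ≤ ‖z - a‖ + ‖a - conj b‖ + ‖w - b‖ := by
        rw [e]
        refine (norm_sub_le _ _).trans ?_
        rw [RCLike.norm_conj]
        gcongr
        exact norm_add_le _ _
    _ < 2 * σ := by linarith

/-- Exhaustion from inside: contours can be placed on the boundary circles of a smaller annulus,
where a function on `Dom σ` is still holomorphic. -/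
theorem exists_lt_mem_Dom {σ : ℝ} {p : ℂ × ℂ} (hp : p ∈ Dom σ) :
    ∃ s, 0 < s ∧ s < σ ∧ p ∈ Dom s := by
  obtain ⟨h1, h2, h3⟩ := mem_Dom.1 hp
  have hσ : 0 < σ := by linarith [norm_nonneg (p.1 - conj p.2)]
  have hri : Continuous fun s => (rho s)⁻¹ := continuous_rho.inv₀ fun s => (rho_pos s).ne'
  have ho : ∀ᶠ s in 𝓝 σ, p ∈ Dom s := by
    have c1 := (continuous_rho.tendsto σ).eventually_lt_const h1.1
    have c2 := (hri.tendsto σ).eventually_const_lt h1.2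
    have c3 := (continuous_rho.tendsto σ).eventually_lt_const h2.1
    have c4 := (hri.tendsto σ).eventually_const_lt h2.2
    have c5 := ((continuous_const_mul (2 : ℝ)).tendsto σ).eventually_const_lt h3
    filter_upwards [c1, c2, c3, c4, c5] with s d1 d2 d3 d4 d5
    exact mem_Dom.2 ⟨⟨d1, d2⟩, ⟨d3, d4⟩, d5⟩
  have : ∀ᶠ s in 𝓝[<] σ, p ∈ Dom s ∧ 0 < s ∧ s < σ := by
    filter_upwards [nhdsWithin_le_nhds ho, nhdsWithin_le_nhds (lt_mem_nhds hσ),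
      self_mem_nhdsWithin] with s a b c using ⟨a, b, c⟩
  obtain ⟨s, a, b, c⟩ := this.exists
  exact ⟨s, b, c, a⟩

/-! ### Circle averages -/

theorem norm_circleAverage_le_circleAverage_norm {f : ℂ → ℂ} {c : ℂ} {R : ℝ} :
    ‖Real.circleAverage f c R‖ ≤ Real.circleAverage (fun z => ‖f z‖) c R := by
  rw [Real.circleAverage, Real.circleAverage, norm_smul, smul_eq_mul, Real.norm_of_nonneg
    (by positivity)]
  gcongr
  exact intervalIntegral.norm_integral_le_integral_norm Real.two_pi_pos.le

/-- The Poisson kernel has mean one. -/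
theorem circleAverage_inv_norm_sq {z : ℂ} {R : ℝ} (hz : ‖z‖ < R) :
    Real.circleAverage (fun ζ => (‖ζ - z‖ ^ 2)⁻¹) 0 R = (R ^ 2 - ‖z‖ ^ 2)⁻¹ := by
  have hR : 0 < R := (norm_nonneg z).trans_lt hz
  have h := InnerProductSpace.HarmonicOnNhd.circleAverage_poissonKernel_smul
    (f := fun _ : ℂ => (1 : ℝ)) (c := 0) (R := R) (w := z)
    (InnerProductSpace.harmonicOnNhd_const _) (by simpa using hz)
  have e : Real.circleAverage (poissonKernel 0 z • fun _ : ℂ => (1 : ℝ)) 0 R =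
      Real.circleAverage ((R ^ 2 - ‖z‖ ^ 2) • fun ζ => (‖ζ - z‖ ^ 2)⁻¹) 0 R := by
    refine Real.circleAverage_congr_sphere fun ζ hζ => ?_
    rw [abs_of_pos hR] at hζ
    have : ‖ζ‖ = R := by simpa using hζ
    simp [poissonKernel, this, div_eq_mul_inv]
  rw [e, Real.circleAverage_smul] at h
  exact eq_inv_of_mul_eq_one_right h

theorem circleAverage_eq_of_annulus {f : ℂ → ℂ} {r R : ℝ} (h0 : 0 < r) (hle : r ≤ R)
    (hf : ∀ z, r ≤ ‖z‖ → ‖z‖ ≤ R → DifferentiableAt ℂ f z) :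
    Real.circleAverage f 0 R = Real.circleAverage f 0 r := by
  rw [Real.circleAverage_eq_circleIntegral h0.ne', Real.circleAverage_eq_circleIntegral
    (h0.trans_le hle).ne']
  congr 1
  refine Complex.circleIntegral_sub_center_inv_smul_eq_of_differentiable_on_annulus_off_countable
    h0 hle countable_empty ?_ ?_
  · rintro z ⟨h1, h2⟩
    refine (hf z ?_ ?_).continuousAt.continuousWithinAt
    · simpa using h2
    · simpa using h1
  · rintro z ⟨⟨h1, h2⟩, -⟩
    refine hf z ?_ ?_
    · have : r < ‖z‖ := by simpa using h2
      exact this.le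
    · have : ‖z‖ < R := by simpa using h1
      exact this.le

/-- The Cauchy kernel integral over the circle of radius `r`. -/
def cauchyInt (r : ℝ) (g : ℂ → ℂ) (z : ℂ) : ℂ :=
  Real.circleAverage (fun ζ => ζ / (ζ - z) * g ζ) 0 r

/-- The divided difference of the Cauchy kernel integral. -/
def cauchyInt₂ (r : ℝ) (g : ℂ → ℂ) (z y : ℂ) : ℂ :=
  Real.circleAverage (fun ζ => ζ / ((ζ - z) * (ζ - y)) * g ζ) 0 r

theorem circleIntegrable_of_continuousOn {f : ℂ → ℂ} {R : ℝ} (hR : 0 < R)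
    (hf : ∀ z, ‖z‖ = R → ContinuousAt f z) : CircleIntegrable f 0 R := by
  refine ContinuousOn.circleIntegrable hR.le fun z hz => (hf z ?_).continuousWithinAt
  simpa using hz

theorem differentiableAt_cauchyKernel {ζ z : ℂ} (h : ζ - z ≠ 0) :
    DifferentiableAt ℂ (fun ζ : ℂ => ζ / (ζ - z)) ζ :=
  DifferentiableAt.fun_div (by fun_prop) (by fun_prop) h

theorem differentiableAt_cauchyKernel₂ {ζ z y : ℂ} (h1 : ζ - z ≠ 0) (h2 : ζ - y ≠ 0) :
    DifferentiableAt ℂ (fun ζ : ℂ => ζ / ((ζ - z) * (ζ - y))) ζ :=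
  DifferentiableAt.fun_div (by fun_prop) (by fun_prop) (mul_ne_zero h1 h2)

theorem circleIntegrable_cauchy {g : ℂ → ℂ} {R : ℝ} (hR : 0 < R) {z : ℂ} (hz : ‖z‖ ≠ R)
    (hg : ∀ ζ, ‖ζ‖ = R → ContinuousAt g ζ) :
    CircleIntegrable (fun ζ => ζ / (ζ - z) * g ζ) 0 R := by
  refine circleIntegrable_of_continuousOn hR fun ζ hζ => ?_
  have : ζ - z ≠ 0 := fun h => hz (by rw [← sub_eq_zero.1 h]; exact hζ)
  exact (differentiableAt_cauchyKernel this).continuousAt.mul (hg ζ hζ)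

theorem cauchyInt_sub {g h : ℂ → ℂ} {R : ℝ} (hR : 0 < R) {z : ℂ} (hz : ‖z‖ ≠ R)
    (hg : ∀ ζ, ‖ζ‖ = R → ContinuousAt g ζ) (hh : ∀ ζ, ‖ζ‖ = R → ContinuousAt h ζ) :
    cauchyInt R (g - h) z = cauchyInt R g z - cauchyInt R h z := by
  rw [cauchyInt, cauchyInt, cauchyInt, ← Real.circleAverage_fun_sub (circleIntegrable_cauchy hR hz hg)
    (circleIntegrable_cauchy hR hz hh)]
  congr 1; ext ζ; simp only [Pi.sub_apply]; ring

theorem circleIntegrable_cauchy₂ {g : ℂ → ℂ} {R : ℝ} (hR : 0 < R) {z y : ℂ} (hz : ‖z‖ ≠ R)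
    (hy : ‖y‖ ≠ R) (hg : ∀ ζ, ‖ζ‖ = R → ContinuousAt g ζ) :
    CircleIntegrable (fun ζ => ζ / ((ζ - z) * (ζ - y)) * g ζ) 0 R := by
  refine circleIntegrable_of_continuousOn hR fun ζ hζ => ?_
  have h1 : ζ - z ≠ 0 := fun h => hz (by rw [← sub_eq_zero.1 h]; exact hζ)
  have h2 : ζ - y ≠ 0 := fun h => hy (by rw [← sub_eq_zero.1 h]; exact hζ)
  exact (differentiableAt_cauchyKernel₂ h1 h2).continuousAt.mul (hg ζ hζ)

theorem cauchyInt₂_sub {g h : ℂ → ℂ} {R : ℝ} (hR : 0 < R) {z y : ℂ} (hz : ‖z‖ ≠ R) (hy : ‖y‖ ≠ R)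
    (hg : ∀ ζ, ‖ζ‖ = R → ContinuousAt g ζ) (hh : ∀ ζ, ‖ζ‖ = R → ContinuousAt h ζ) :
    cauchyInt₂ R (g - h) z y = cauchyInt₂ R g z y - cauchyInt₂ R h z y := by
  rw [cauchyInt₂, cauchyInt₂, cauchyInt₂, ← Real.circleAverage_fun_sub
    (circleIntegrable_cauchy₂ hR hz hy hg) (circleIntegrable_cauchy₂ hR hz hy hh)]
  congr 1; ext ζ; simp only [Pi.sub_apply]; ring

theorem cauchyInt_sub_cauchyInt {g : ℂ → ℂ} {R : ℝ} (hR : 0 < R) {z y : ℂ} (hz : ‖z‖ ≠ R)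
    (hy : ‖y‖ ≠ R) (hg : ∀ ζ, ‖ζ‖ = R → ContinuousAt g ζ) :
    cauchyInt R g y - cauchyInt R g z = (y - z) * cauchyInt₂ R g z y := by
  rw [cauchyInt, cauchyInt, cauchyInt₂, ← Real.circleAverage_fun_sub (circleIntegrable_cauchy hR hy hg)
    (circleIntegrable_cauchy hR hz hg), ← smul_eq_mul, ← Real.circleAverage_fun_smul]
  refine Real.circleAverage_congr_sphere fun ζ hζ => ?_
  rw [abs_of_pos hR] at hζ
  have hζ' : ‖ζ‖ = R := by simpa using hζ
  have h1 : ζ - z ≠ 0 := fun h => hz (by rw [← sub_eq_zero.1 h]; exact hζ')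
  have h2 : ζ - y ≠ 0 := fun h => hy (by rw [← sub_eq_zero.1 h]; exact hζ')
  simp only [smul_eq_mul]
  field_simp
  ring

theorem circleAverage_cauchy_one_of_lt {z : ℂ} {R : ℝ} (hz : ‖z‖ < R) :
    Real.circleAverage (fun ζ => ζ / (ζ - z)) 0 R = 1 := by
  have hR : 0 < R := (norm_nonneg z).trans_lt hz
  have := DiffContOnCl.circleAverage_smul_div (f := fun _ : ℂ => (1 : ℂ)) (c := 0) (R := R) (w := z)
    diffContOnCl_const (by simpa [abs_of_pos hR] using hz)
  simpa using this

theorem circleAverage_cauchy_one_of_gt {z : ℂ} {R : ℝ} (hR : 0 < R) (hz : R < ‖z‖) :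
    Real.circleAverage (fun ζ => ζ / (ζ - z)) 0 R = 0 := by
  have hd : DiffContOnCl ℂ (fun ζ => ζ / (ζ - z)) (Metric.ball 0 |R|) := by
    refine DifferentiableOn.diffContOnCl ?_
    rw [abs_of_pos hR, closure_ball _ hR.ne']
    intro ζ hζ
    have : ζ - z ≠ 0 := fun h => by
      rw [sub_eq_zero.1 h] at hζ
      have : ‖z‖ ≤ R := by simpa using hζ
      linarith
    exact (differentiableAt_cauchyKernel this).differentiableWithinAt
  rw [hd.circleAverage]; simp

/-- The Laurent splitting of a holomorphic function on an annulus. -/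
theorem cauchyInt_sub_cauchyInt_eq {g : ℂ → ℂ} {U : Set ℂ} (hU : IsOpen U) {r R : ℝ} (h0 : 0 < r)
    (hg : DifferentiableOn ℂ g U) (hsub : ∀ z, r ≤ ‖z‖ → ‖z‖ ≤ R → z ∈ U) {z : ℂ} (h1 : r < ‖z‖)
    (h2 : ‖z‖ < R) : cauchyInt R g z - cauchyInt r g z = g z := by
  have hzU : U ∈ 𝓝 z := hU.mem_nhds (hsub z h1.le h2.le)
  -- The divided difference removes the pole at `z`, so this function has equal means on the two
  -- circles; the kernel `ζ/(ζ - z)` has mean one on the outer circle and zero on the inner one.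
  have hd : DifferentiableOn ℂ (fun ζ => ζ * dslope g z ζ) U :=
    differentiableOn_id.mul ((Complex.differentiableOn_dslope hzU).2 hg)
  have hk := circleAverage_eq_of_annulus (f := fun ζ => ζ * dslope g z ζ) h0 (h1.trans h2).le
    (fun y hy1 hy2 => hd.differentiableAt (hU.mem_nhds (hsub y hy1 hy2)))
  have hgc : ∀ ζ, r ≤ ‖ζ‖ → ‖ζ‖ ≤ R → ContinuousAt g ζ := fun ζ a b =>
    (hg.differentiableAt (hU.mem_nhds (hsub ζ a b))).continuousAt
  have key : ∀ s, 0 < s → ‖z‖ ≠ s → r ≤ s → s ≤ R →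
      Real.circleAverage (fun ζ => ζ * dslope g z ζ) 0 s =
      cauchyInt s g z - Real.circleAverage (fun ζ => ζ / (ζ - z)) 0 s * g z := by
    intro s hs hzs hrs hsR
    have e : Real.circleAverage (fun ζ => ζ * dslope g z ζ) 0 s =
        Real.circleAverage (fun ζ => ζ / (ζ - z) * g ζ - (g z) • (ζ / (ζ - z))) 0 s := by
      refine Real.circleAverage_congr_sphere fun ζ hζ => ?_
      rw [abs_of_pos hs] at hζ
      have hζ' : ‖ζ‖ = s := by simpa using hζ
      have hne : ζ ≠ z := fun h => hzs (by rw [← h]; exact hζ')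
      simp only [dslope_of_ne _ hne, slope_def_module, smul_eq_mul]
      have : ζ - z ≠ 0 := sub_ne_zero.2 hne
      field_simp
    have hi := circleIntegrable_cauchy (g := fun _ => 1) hs hzs (fun _ _ => continuousAt_const)
    simp only [mul_one] at hi
    have hi' : CircleIntegrable (fun ζ => g z • (ζ / (ζ - z))) 0 s := hi.const_smul
    rw [e, Real.circleAverage_fun_sub (circleIntegrable_cauchy hs hzs
      (fun ζ hζ => hgc ζ (hζ ▸ hrs) (hζ ▸ hsR))) hi',
      Real.circleAverage_fun_smul, smul_eq_mul, mul_comm]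
    rfl
  rw [key R (h0.trans (h1.trans h2)) h2.ne (h1.trans h2).le le_rfl,
    key r h0 h1.ne' le_rfl (h1.trans h2).le, circleAverage_cauchy_one_of_lt h2,
    circleAverage_cauchy_one_of_gt h0 h1] at hk
  linear_combination hk

theorem cauchyInt_eq_of_annulus {g : ℂ → ℂ} {r R : ℝ} (h0 : 0 < r) (hle : r ≤ R)
    (hg : ∀ z, r ≤ ‖z‖ → ‖z‖ ≤ R → DifferentiableAt ℂ g z) {z : ℂ} (hz : ‖z‖ < r ∨ R < ‖z‖) :
    cauchyInt R g z = cauchyInt r g z := by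
  refine circleAverage_eq_of_annulus h0 hle fun ζ h1 h2 => ?_
  have : ζ - z ≠ 0 := fun h => by
    rw [sub_eq_zero.1 h] at h1 h2; rcases hz with hz | hz <;> linarith
  exact (differentiableAt_cauchyKernel this).mul (hg ζ h1 h2)

theorem cauchyInt₂_eq_of_annulus {g : ℂ → ℂ} {r R : ℝ} (h0 : 0 < r) (hle : r ≤ R)
    (hg : ∀ z, r ≤ ‖z‖ → ‖z‖ ≤ R → DifferentiableAt ℂ g z) {z y : ℂ} (hz : ‖z‖ < r)
    (hy : ‖y‖ < r) : cauchyInt₂ R g z y = cauchyInt₂ r g z y := by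
  refine circleAverage_eq_of_annulus h0 hle fun ζ h1 h2 => ?_
  have h3 : ζ - z ≠ 0 := fun h => by rw [sub_eq_zero.1 h] at h1; linarith
  have h4 : ζ - y ≠ 0 := fun h => by rw [sub_eq_zero.1 h] at h1; linarith
  exact (differentiableAt_cauchyKernel₂ h3 h4).mul (hg ζ h1 h2)

theorem norm_cauchyInt_le {g : ℂ → ℂ} {r B d : ℝ} (hr : 0 < r) (hd : 0 < d) (hB : 0 ≤ B)
    (hg : ∀ ζ, ‖ζ‖ = r → ContinuousAt g ζ) (hgB : ∀ ζ, ‖ζ‖ = r → ‖g ζ‖ ≤ B) {z : ℂ}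
    (hz : d ≤ |r - ‖z‖|) : ‖cauchyInt r g z‖ ≤ r * B / d := by
  have hne : ‖z‖ ≠ r := fun h => by rw [h, sub_self, abs_zero] at hz; linarith
  refine norm_circleAverage_le_circleAverage_norm.trans ?_
  refine Real.circleAverage_mono_on_of_le_circle (circleIntegrable_cauchy hr hne hg).norm ?_
  intro ζ hζ
  rw [abs_of_pos hr] at hζ
  have hζ' : ‖ζ‖ = r := by simpa using hζ
  have h1 : d ≤ ‖ζ - z‖ := by
    have := abs_norm_sub_norm_le ζ z
    rw [hζ'] at this; linarith
  rw [norm_mul, norm_div, hζ', div_mul_eq_mul_div]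
  have := hgB ζ hζ'
  gcongr

/-- Bounding the two factors of the kernel separately would cost `1/d²`. The arithmetic-geometric
mean inequality replaces their product by two squares, whose means are known from the Poisson
kernel, and only `1/d` is lost. This keeps the cost of `quot` at one power of `δ`. -/
theorem norm_cauchyInt₂_le {g : ℂ → ℂ} {R B d : ℝ} (hd : 0 < d) (hB : 0 ≤ B)
    (hg : ∀ ζ, ‖ζ‖ = R → ContinuousAt g ζ) (hgB : ∀ ζ, ‖ζ‖ = R → ‖g ζ‖ ≤ B) {z y : ℂ}
    (hz : ‖z‖ + d ≤ R) (hy : ‖y‖ + d ≤ R) : ‖cauchyInt₂ R g z y‖ ≤ B / d := by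
  have hR : 0 < R := by linarith [norm_nonneg z]
  have nz := norm_nonneg z
  have ny := norm_nonneg y
  have hint : ∀ x : ℂ, ‖x‖ + d ≤ R → CircleIntegrable (fun ζ => (‖ζ - x‖ ^ 2)⁻¹) 0 R := by
    intro x hx
    refine ContinuousOn.circleIntegrable hR.le fun ζ hζ => ContinuousAt.continuousWithinAt ?_
    have hζ' : ‖ζ‖ = R := by simpa using hζ
    have : ‖ζ - x‖ ^ 2 ≠ 0 := by
      refine pow_ne_zero _ (norm_ne_zero_iff.2 fun h => ?_)
      rw [← sub_eq_zero.1 h] at hx; linarith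
    exact ContinuousAt.inv₀ (by fun_prop) this
  have hq : ∀ x : ℂ, ‖x‖ + d ≤ R → R * (R ^ 2 - ‖x‖ ^ 2)⁻¹ ≤ 1 / d := by
    intro x hx
    have nx := norm_nonneg x
    have : R * d ≤ R ^ 2 - ‖x‖ ^ 2 := by nlinarith
    rw [← div_eq_mul_inv, div_le_div_iff₀ (by nlinarith) hd]
    linarith
  have hmono : Real.circleAverage (fun ζ => ‖ζ / ((ζ - z) * (ζ - y)) * g ζ‖) 0 R ≤
      Real.circleAverage (fun ζ => (B * R / 2) • ((‖ζ - z‖ ^ 2)⁻¹ + (‖ζ - y‖ ^ 2)⁻¹)) 0 R := by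
    refine Real.circleAverage_mono (circleIntegrable_cauchy₂ hR (by linarith) (by linarith) hg).norm
      (((hint z hz).add (hint y hy)).const_smul (a := B * R / 2)) ?_
    intro ζ hζ
    rw [abs_of_pos hR] at hζ
    have hζ' : ‖ζ‖ = R := by simpa using hζ
    have h1 : ‖ζ - z‖ ≠ 0 := norm_ne_zero_iff.2 fun h => by
      rw [← sub_eq_zero.1 h] at hz; linarith
    have h2 : ‖ζ - y‖ ≠ 0 := norm_ne_zero_iff.2 fun h => by
      rw [← sub_eq_zero.1 h] at hy; linarith
    rw [norm_mul, norm_div, norm_mul, hζ', smul_eq_mul]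
    have hb := hgB ζ hζ'
    have : (‖ζ - z‖ * ‖ζ - y‖)⁻¹ ≤ ((‖ζ - z‖ ^ 2)⁻¹ + (‖ζ - y‖ ^ 2)⁻¹) / 2 := by
      rw [mul_inv, ← inv_pow, ← inv_pow]
      nlinarith [sq_nonneg (‖ζ - z‖⁻¹ - ‖ζ - y‖⁻¹)]
    calc R / (‖ζ - z‖ * ‖ζ - y‖) * ‖g ζ‖ = R * ‖g ζ‖ * (‖ζ - z‖ * ‖ζ - y‖)⁻¹ := by ring
      _ ≤ R * B * (((‖ζ - z‖ ^ 2)⁻¹ + (‖ζ - y‖ ^ 2)⁻¹) / 2) := by gcongr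
      _ = _ := by ring
  refine norm_circleAverage_le_circleAverage_norm.trans (hmono.trans ?_)
  rw [Real.circleAverage_fun_smul, Real.circleAverage_fun_add (hint z hz) (hint y hy),
    circleAverage_inv_norm_sq (by linarith), circleAverage_inv_norm_sq (by linarith), smul_eq_mul]
  have a := hq z hz
  have b := hq y hy
  calc B * R / 2 * ((R ^ 2 - ‖z‖ ^ 2)⁻¹ + (R ^ 2 - ‖y‖ ^ 2)⁻¹)
      = B / 2 * (R * (R ^ 2 - ‖z‖ ^ 2)⁻¹ + R * (R ^ 2 - ‖y‖ ^ 2)⁻¹) := by ring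
    _ ≤ B / 2 * (1 / d + 1 / d) := by gcongr
    _ = B / d := by ring

end BerezinOP
end

noncomputable section
namespace BerezinOP

/-! ### The polarized Poisson extension and its divided difference -/

theorem differentiableOn_cauchyInt {g : ℂ → ℂ} {r : ℝ} (hr : 0 < r)
    (hg : ∀ ζ, ‖ζ‖ = r → ContinuousAt g ζ) :
    DifferentiableOn ℂ (cauchyInt r g) {z | ‖z‖ ≠ r} := by
  have hU : IsOpen {z : ℂ | ‖z‖ ≠ r} := isOpen_ne_fun continuous_norm continuous_const
  have hc : Continuous fun θ : ℝ => g (circleMap 0 r θ) :=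
    continuous_iff_continuousAt.2 fun θ =>
      (hg _ (by simp [abs_of_pos hr])).comp (continuous_circleMap 0 r).continuousAt
  have hne : ∀ (z : ℂ) (θ : ℝ), ‖z‖ ≠ r → circleMap 0 r θ - z ≠ 0 := fun z θ hz h => by
    rw [← sub_eq_zero.1 h] at hz
    simp [abs_of_pos hr] at hz
  refine DifferentiableOn.const_smul (R := ℝ) (differentiableOn_intervalIntegral_param hU
    (K := fun z θ => circleMap 0 r θ / (circleMap 0 r θ - z) * g (circleMap 0 r θ)) ?_ ?_) _
  · refine ContinuousOn.mul (ContinuousOn.div ?_ ?_ ?_) ?_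
    · exact ((continuous_circleMap 0 r).comp continuous_snd).continuousOn
    · exact (((continuous_circleMap 0 r).comp continuous_snd).sub continuous_fst).continuousOn
    · rintro ⟨z, θ⟩ ⟨hz, -⟩; exact hne z θ hz
    · exact (hc.comp continuous_snd).continuousOn
  · intro θ
    exact ((differentiableOn_const _).fun_div (by fun_prop) fun z hz => hne z θ hz).mul
      (differentiableOn_const _)

theorem differentiableOn_cauchyInt₂ {g : ℂ → ℂ} {r : ℝ} (hr : 0 < r)
    (hg : ∀ ζ, ‖ζ‖ = r → ContinuousAt g ζ) :
    DifferentiableOn ℂ (fun p : ℂ × ℂ => cauchyInt₂ r g p.1 p.2) {p | ‖p.1‖ ≠ r ∧ ‖p.2‖ ≠ r} := by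
  have hU : IsOpen {p : ℂ × ℂ | ‖p.1‖ ≠ r ∧ ‖p.2‖ ≠ r} :=
    (isOpen_ne_fun continuous_fst.norm continuous_const).inter
      (isOpen_ne_fun continuous_snd.norm continuous_const)
  have hc : Continuous fun θ : ℝ => g (circleMap 0 r θ) :=
    continuous_iff_continuousAt.2 fun θ =>
      (hg _ (by simp [abs_of_pos hr])).comp (continuous_circleMap 0 r).continuousAt
  have hne : ∀ (z : ℂ) (θ : ℝ), ‖z‖ ≠ r → circleMap 0 r θ - z ≠ 0 := fun z θ hz h => by
    rw [← sub_eq_zero.1 h] at hz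
    simp [abs_of_pos hr] at hz
  refine DifferentiableOn.const_smul (R := ℝ) (differentiableOn_intervalIntegral_param₂ hU
    (K := fun p θ => circleMap 0 r θ / ((circleMap 0 r θ - p.1) * (circleMap 0 r θ - p.2)) *
      g (circleMap 0 r θ)) ?_ ?_) _
  · refine ContinuousOn.mul (ContinuousOn.div ?_ (ContinuousOn.mul ?_ ?_) ?_) ?_
    · exact ((continuous_circleMap 0 r).comp continuous_snd).continuousOn
    · exact (((continuous_circleMap 0 r).comp continuous_snd).sub
        continuous_fst.fst).continuousOn
    · exact (((continuous_circleMap 0 r).comp continuous_snd).sub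
        continuous_fst.snd).continuousOn
    · rintro ⟨p, θ⟩ ⟨hp, -⟩; exact mul_ne_zero (hne _ θ hp.1) (hne _ θ hp.2)
    · exact (hc.comp continuous_snd).continuousOn
  · intro θ
    have hd : DifferentiableOn ℂ (fun p : ℂ × ℂ => circleMap 0 r θ /
        ((circleMap 0 r θ - p.1) * (circleMap 0 r θ - p.2))) {p | ‖p.1‖ ≠ r ∧ ‖p.2‖ ≠ r} := by
      intro p hp
      simp only [div_eq_mul_inv]
      refine DifferentiableAt.differentiableWithinAt
        ((differentiableAt_const _).mul (DifferentiableAt.fun_inv (by fun_prop) ?_))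
      exact mul_ne_zero (hne _ θ hp.1) (hne _ θ hp.2)
    exact hd.mul (differentiableOn_const _)

/-- The restriction of a polarization to the complexified circle. -/
def bdry (F : ℂ × ℂ → ℂ) (ζ : ℂ) : ℂ := F (ζ, ζ⁻¹)

theorem differentiableOn_bdry {F : ℂ × ℂ → ℂ} {σ : ℝ} (hF : DifferentiableOn ℂ F (Dom σ)) :
    DifferentiableOn ℂ (bdry F) (openAnnulus σ) :=
  hF.comp (f := fun ζ : ℂ => (ζ, ζ⁻¹)) (differentiableOn_id.prodMk
    (differentiableOn_id.inv fun _ h => ne_zero_of_mem_openAnnulus h))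
    fun _ h => mem_Dom_inv_right h

/-- The polarized Poisson extension, computed with contours on the boundary of the annulus `s`. -/
def projC (s : ℝ) (F : ℂ × ℂ → ℂ) (p : ℂ × ℂ) : ℂ :=
  cauchyInt (rho s)⁻¹ (bdry F) p.2⁻¹ - cauchyInt (rho s) (bdry F) p.1

/-- The quotient of `projC s F - F` by `z w - 1`. -/
def quotC (s : ℝ) (F : ℂ × ℂ → ℂ) (p : ℂ × ℂ) : ℂ :=
  -(p.1⁻¹ * dslope (fun w => F (p.1, w)) p.1⁻¹ p.2) -
    p.2⁻¹ * cauchyInt₂ (rho s)⁻¹ (bdry F) p.1 p.2⁻¹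

section contour
variable {s σ : ℝ} {F G : ℂ × ℂ → ℂ}

theorem mem_openAnnulus_of_between (hs : s < σ) {ζ : ℂ} (h1 : rho s ≤ ‖ζ‖)
    (h2 : ‖ζ‖ ≤ (rho s)⁻¹) : ζ ∈ openAnnulus σ :=
  ⟨(rho_strictAnti hs).trans_le h1, h2.trans_lt
    ((inv_lt_inv₀ (rho_pos s) (rho_pos σ)).2 (rho_strictAnti hs))⟩

theorem rho_le_rho_inv (h0 : 0 < s) : rho s ≤ (rho s)⁻¹ :=
  (rho_le_one h0.le).trans (one_le_rho_inv h0.le)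

theorem differentiableAt_bdry (hs : s < σ) (hF : DifferentiableOn ℂ F (Dom σ))
    {ζ : ℂ} (h1 : rho s ≤ ‖ζ‖) (h2 : ‖ζ‖ ≤ (rho s)⁻¹) : DifferentiableAt ℂ (bdry F) ζ :=
  (differentiableOn_bdry hF).differentiableAt
    ((isOpen_openAnnulus σ).mem_nhds (mem_openAnnulus_of_between hs h1 h2))

theorem continuousAt_bdry_outer (h0 : 0 < s) (hs : s < σ) (hF : DifferentiableOn ℂ F (Dom σ)) :
    ∀ ζ : ℂ, ‖ζ‖ = (rho s)⁻¹ → ContinuousAt (bdry F) ζ := fun _ h =>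
  (differentiableAt_bdry hs hF (h ▸ rho_le_rho_inv h0) h.le).continuousAt

theorem continuousAt_bdry_inner (h0 : 0 < s) (hs : s < σ) (hF : DifferentiableOn ℂ F (Dom σ)) :
    ∀ ζ : ℂ, ‖ζ‖ = rho s → ContinuousAt (bdry F) ζ := fun _ h =>
  (differentiableAt_bdry hs hF h.ge (h ▸ rho_le_rho_inv h0)).continuousAt

theorem differentiableOn_projC (h0 : 0 < s) (hs : s < σ) (hF : DifferentiableOn ℂ F (Dom σ)) :
    DifferentiableOn ℂ (projC s F) (Dom s) := by
  have h1 := differentiableOn_cauchyInt (inv_pos.2 (rho_pos s)) (continuousAt_bdry_outer h0 hs hF)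
  have h2 := differentiableOn_cauchyInt (rho_pos s) (continuousAt_bdry_inner h0 hs hF)
  refine DifferentiableOn.sub (h1.comp (f := fun p : ℂ × ℂ => p.2⁻¹) ?_ ?_)
    (h2.comp (f := fun p : ℂ × ℂ => p.1) (by fun_prop) ?_)
  · exact differentiableOn_snd.inv fun p hp => ne_zero_of_mem_openAnnulus (mem_Dom.1 hp).2.1
  · intro p hp
    exact (inv_mem_openAnnulus (mem_Dom.1 hp).2.1).2.ne
  · intro p hp
    exact (mem_Dom.1 hp).1.1.ne'

theorem differentiableOn_quotC (h0 : 0 < s) (hs : s < σ) (hF : DifferentiableOn ℂ F (Dom σ)) :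
    DifferentiableOn ℂ (quotC s F) (Dom s) := by
  have h1 := differentiableOn_cauchyInt₂ (inv_pos.2 (rho_pos s))
    (continuousAt_bdry_outer h0 hs hF)
  have hi1 : DifferentiableOn ℂ (fun p : ℂ × ℂ => p.1⁻¹) (Dom s) :=
    differentiableOn_fst.inv fun p hp => ne_zero_of_mem_openAnnulus (mem_Dom.1 hp).1
  have hi2 : DifferentiableOn ℂ (fun p : ℂ × ℂ => p.2⁻¹) (Dom s) :=
    differentiableOn_snd.inv fun p hp => ne_zero_of_mem_openAnnulus (mem_Dom.1 hp).2.1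
  have hF' := hF.mono (Dom_mono hs.le)
  refine DifferentiableOn.sub (DifferentiableOn.neg (hi1.mul ?_)) (hi2.mul
    (h1.comp (f := fun p : ℂ × ℂ => (p.1, p.2⁻¹)) (differentiableOn_fst.prodMk hi2) ?_))
  · exact differentiableOn_dslope_param (isOpen_Dom s) hF' (c := fun z => z⁻¹)
      (fun p hp => differentiableAt_inv (ne_zero_of_mem_openAnnulus (mem_Dom.1 hp).1))
      (fun p hp => mem_Dom_inv_right (mem_Dom.1 hp).1)
  · intro p hp
    exact ⟨(mem_Dom.1 hp).1.2.ne, (inv_mem_openAnnulus (mem_Dom.1 hp).2.1).2.ne⟩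

/-- By the Laurent splitting of `F(z, 1/z)`, the left side is the increment of the outer Cauchy
integral from `z` to `1/w`, minus the increment of `F(z, ·)` from `1/z` to `w`. Each is a divided
difference times a multiple of `z w - 1`. -/
theorem projC_sub_self (h0 : 0 < s) (hs : s < σ) (hF : DifferentiableOn ℂ F (Dom σ)) {p : ℂ × ℂ}
    (hp : p ∈ Dom s) : projC s F p - F p = (p.1 * p.2 - 1) * quotC s F p := by
  obtain ⟨h1, h2, -⟩ := mem_Dom.1 hp
  have hz := ne_zero_of_mem_openAnnulus h1
  have hw := ne_zero_of_mem_openAnnulus h2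
  have hL := cauchyInt_sub_cauchyInt_eq (isOpen_openAnnulus σ) (rho_pos s) (differentiableOn_bdry hF)
    (fun z a b => mem_openAnnulus_of_between hs a b) h1.1 h1.2
  have hI := cauchyInt_sub_cauchyInt (inv_pos.2 (rho_pos s)) h1.2.ne
    (inv_mem_openAnnulus h2).2.ne (continuousAt_bdry_outer h0 hs hF)
  have hd : (p.2 - p.1⁻¹) * dslope (fun w => F (p.1, w)) p.1⁻¹ p.2 = F p - bdry F p.1 := by
    have := sub_smul_dslope (fun w => F (p.1, w)) p.1⁻¹ p.2
    simpa [bdry] using this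
  have e1 : (p.1 * p.2 - 1) * (p.1⁻¹ * dslope (fun w => F (p.1, w)) p.1⁻¹ p.2) =
      F p - bdry F p.1 := by
    rw [← hd]; field_simp
  have e2 : (p.1 * p.2 - 1) * (p.2⁻¹ * cauchyInt₂ (rho s)⁻¹ (bdry F) p.1 p.2⁻¹) =
      -(cauchyInt (rho s)⁻¹ (bdry F) p.2⁻¹ - cauchyInt (rho s)⁻¹ (bdry F) p.1) := by
    rw [hI]; field_simp; ring
  rw [projC, quotC]
  linear_combination hL + e1 + e2

theorem bdry_sub : bdry (F - G) = bdry F - bdry G := rfl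

theorem projC_sub (h0 : 0 < s) (hs : s < σ) (hF : DifferentiableOn ℂ F (Dom σ))
    (hG : DifferentiableOn ℂ G (Dom σ)) {p : ℂ × ℂ} (hp : p ∈ Dom s) :
    projC s (F - G) p = projC s F p - projC s G p := by
  obtain ⟨h1, h2, -⟩ := mem_Dom.1 hp
  rw [projC, projC, projC, bdry_sub, cauchyInt_sub (inv_pos.2 (rho_pos s))
    (inv_mem_openAnnulus h2).2.ne (continuousAt_bdry_outer h0 hs hF)
    (continuousAt_bdry_outer h0 hs hG), cauchyInt_sub (rho_pos s) h1.1.ne'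
    (continuousAt_bdry_inner h0 hs hF) (continuousAt_bdry_inner h0 hs hG)]
  ring

theorem dslope_fun_sub {f g : ℂ → ℂ} {c w : ℂ} (hf : DifferentiableAt ℂ f c)
    (hg : DifferentiableAt ℂ g c) :
    dslope (fun w => f w - g w) c w = dslope f c w - dslope g c w := by
  rcases eq_or_ne w c with rfl | h
  · simp only [dslope_same]; exact deriv_fun_sub hf hg
  · simp only [dslope_of_ne _ h, slope_def_module, smul_eq_mul]; ring

theorem quotC_sub (h0 : 0 < s) (hs : s < σ) (hF : DifferentiableOn ℂ F (Dom σ))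
    (hG : DifferentiableOn ℂ G (Dom σ)) {p : ℂ × ℂ} (hp : p ∈ Dom s) :
    quotC s (F - G) p = quotC s F p - quotC s G p := by
  obtain ⟨h1, h2, -⟩ := mem_Dom.1 hp
  have hm := mem_Dom_inv_right (openAnnulus_mono hs.le h1)
  have := dslope_fun_sub (w := p.2) (DifferentiableOn.slice2 hF (isOpen_Dom σ) hm)
    (DifferentiableOn.slice2 hG (isOpen_Dom σ) hm)
  rw [quotC, quotC, quotC, bdry_sub, cauchyInt₂_sub (inv_pos.2 (rho_pos s)) h1.2.ne
    (inv_mem_openAnnulus h2).2.ne (continuousAt_bdry_outer h0 hs hF)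
    (continuousAt_bdry_outer h0 hs hG)]
  simp only [Pi.sub_apply]
  simp only at this
  rw [this]; ring

/-- The contours move through the region of holomorphy without crossing a pole of the kernel. -/
theorem projC_eq_of_le {s' : ℝ} (h0 : 0 < s) (hss : s ≤ s') (hs : s' < σ)
    (hF : DifferentiableOn ℂ F (Dom σ)) {p : ℂ × ℂ} (hp : p ∈ Dom s) :
    projC s' F p = projC s F p := by
  obtain ⟨h1, h2, -⟩ := mem_Dom.1 hp
  have hd : ∀ z : ℂ, rho s' ≤ ‖z‖ → ‖z‖ ≤ (rho s')⁻¹ → DifferentiableAt ℂ (bdry F) z :=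
    fun z a b => differentiableAt_bdry hs hF a b
  rw [projC, projC, cauchyInt_eq_of_annulus (inv_pos.2 (rho_pos s)) (rho_inv_mono hss)
    (fun z a b => hd z (((rho_anti hss).trans (rho_le_rho_inv h0)).trans a) b)
    (Or.inl (inv_mem_openAnnulus h2).2), cauchyInt_eq_of_annulus (rho_pos s') (rho_anti hss)
    (fun z a b => hd z a (b.trans ((rho_le_rho_inv h0).trans (rho_inv_mono hss))))
    (Or.inr h1.1)]

theorem quotC_eq_of_le {s' : ℝ} (h0 : 0 < s) (hss : s ≤ s') (hs : s' < σ)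
    (hF : DifferentiableOn ℂ F (Dom σ)) {p : ℂ × ℂ} (hp : p ∈ Dom s) :
    quotC s' F p = quotC s F p := by
  obtain ⟨h1, h2, -⟩ := mem_Dom.1 hp
  have hd : ∀ z : ℂ, rho s' ≤ ‖z‖ → ‖z‖ ≤ (rho s')⁻¹ → DifferentiableAt ℂ (bdry F) z :=
    fun z a b => differentiableAt_bdry hs hF a b
  rw [quotC, quotC, cauchyInt₂_eq_of_annulus (inv_pos.2 (rho_pos s)) (rho_inv_mono hss)
    (fun z a b => hd z (((rho_anti hss).trans (rho_le_rho_inv h0)).trans a) b) h1.2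
    (inv_mem_openAnnulus h2).2]

end contour

open Classical in
/-- An admissible contour parameter for `F` at the point `p`. -/
def contour (F : ℂ × ℂ → ℂ) (p : ℂ × ℂ) : ℝ :=
  if h : ∃ s, (0 < s ∧ p ∈ Dom s) ∧ ∃ σ, s < σ ∧ DifferentiableOn ℂ F (Dom σ) then h.choose else 0

/-- The polarized Poisson extension. -/
def proj (F : ℂ × ℂ → ℂ) (p : ℂ × ℂ) : ℂ := projC (contour F p) F p

/-- The quotient of `proj F - F` by `z w - 1`. -/
def quot (F : ℂ × ℂ → ℂ) (p : ℂ × ℂ) : ℂ := quotC (contour F p) F p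

section canonical
variable {s σ : ℝ} {F G : ℂ × ℂ → ℂ}

/-- The parameter `contour` is picked by choice; deformation of contours shows that the choice has
no effect. -/
theorem proj_eq_projC_and_quot_eq_quotC (h0 : 0 < s) (hs : s < σ)
    (hF : DifferentiableOn ℂ F (Dom σ)) {p : ℂ × ℂ} (hp : p ∈ Dom s) :
    proj F p = projC s F p ∧ quot F p = quotC s F p := by
  have h : ∃ s, (0 < s ∧ p ∈ Dom s) ∧ ∃ σ, s < σ ∧ DifferentiableOn ℂ F (Dom σ) :=
    ⟨s, ⟨h0, hp⟩, σ, hs, hF⟩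
  have hc : contour F p = h.choose := dif_pos h
  obtain ⟨⟨a, b⟩, σ', c, d⟩ := h.choose_spec
  rw [proj, quot, hc]
  set s' := h.choose
  rcases le_total s s' with h1 | h1
  · exact ⟨projC_eq_of_le h0 h1 c d hp, quotC_eq_of_le h0 h1 c d hp⟩
  · exact ⟨(projC_eq_of_le a h1 hs hF b).symm, (quotC_eq_of_le a h1 hs hF b).symm⟩

theorem differentiableOn_proj (hF : DifferentiableOn ℂ F (Dom σ)) :
    DifferentiableOn ℂ (proj F) (Dom σ) := by
  intro p hp
  obtain ⟨s, h0, hs, hps⟩ := exists_lt_mem_Dom hp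
  have := (differentiableOn_projC h0 hs hF).congr fun q hq =>
    (proj_eq_projC_and_quot_eq_quotC h0 hs hF hq).1
  exact (this.differentiableAt ((isOpen_Dom s).mem_nhds hps)).differentiableWithinAt

theorem differentiableOn_quot (hF : DifferentiableOn ℂ F (Dom σ)) :
    DifferentiableOn ℂ (quot F) (Dom σ) := by
  intro p hp
  obtain ⟨s, h0, hs, hps⟩ := exists_lt_mem_Dom hp
  have := (differentiableOn_quotC h0 hs hF).congr fun q hq =>
    (proj_eq_projC_and_quot_eq_quotC h0 hs hF hq).2
  exact (this.differentiableAt ((isOpen_Dom s).mem_nhds hps)).differentiableWithinAt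

theorem proj_sub_self (hF : DifferentiableOn ℂ F (Dom σ)) {p : ℂ × ℂ} (hp : p ∈ Dom σ) :
    proj F p - F p = (p.1 * p.2 - 1) * quot F p := by
  obtain ⟨s, h0, hs, hps⟩ := exists_lt_mem_Dom hp
  obtain ⟨h1, h2⟩ := proj_eq_projC_and_quot_eq_quotC h0 hs hF hps
  rw [h1, h2, projC_sub_self h0 hs hF hps]

theorem proj_sub (hF : DifferentiableOn ℂ F (Dom σ)) (hG : DifferentiableOn ℂ G (Dom σ))
    {p : ℂ × ℂ} (hp : p ∈ Dom σ) : proj (F - G) p = proj F p - proj G p := by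
  obtain ⟨s, h0, hs, hps⟩ := exists_lt_mem_Dom hp
  rw [(proj_eq_projC_and_quot_eq_quotC h0 hs hF hps).1,
    (proj_eq_projC_and_quot_eq_quotC h0 hs hG hps).1,
    (proj_eq_projC_and_quot_eq_quotC h0 hs (hF.sub hG) hps).1, projC_sub h0 hs hF hG hps]

theorem quot_sub (hF : DifferentiableOn ℂ F (Dom σ)) (hG : DifferentiableOn ℂ G (Dom σ))
    {p : ℂ × ℂ} (hp : p ∈ Dom σ) : quot (F - G) p = quot F p - quot G p := by
  obtain ⟨s, h0, hs, hps⟩ := exists_lt_mem_Dom hp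
  rw [(proj_eq_projC_and_quot_eq_quotC h0 hs hF hps).2,
    (proj_eq_projC_and_quot_eq_quotC h0 hs hG hps).2,
    (proj_eq_projC_and_quot_eq_quotC h0 hs (hF.sub hG) hps).2, quotC_sub h0 hs hF hG hps]

/-! ### Cauchy-type estimates with loss of domain. -/

variable {δ B : ℝ}

theorem norm_bdry_le (hs : s < σ) (hB : ∀ p ∈ Dom σ, ‖F p‖ ≤ B) {ζ : ℂ}
    (h1 : rho s ≤ ‖ζ‖) (h2 : ‖ζ‖ ≤ (rho s)⁻¹) : ‖bdry F ζ‖ ≤ B :=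
  hB _ (mem_Dom_inv_right (mem_openAnnulus_of_between hs h1 h2))

theorem norm_proj_le (hδ : 0 < δ) (hδσ : δ < σ) (hσ : σ ≤ 1) (hF : DifferentiableOn ℂ F (Dom σ))
    (hB0 : 0 ≤ B) (hB : ∀ p ∈ Dom σ, ‖F p‖ ≤ B) {p : ℂ × ℂ} (hp : p ∈ Dom (σ - δ)) :
    ‖proj F p‖ ≤ 32 * B / δ := by
  -- The contours belong to the parameter halfway between the two domains. The distance to the
  -- evaluation points is at least `δ/2` on the outer circle but only `δ/8` on the inner one. The
  -- constant `32` is generous, so as to be common to all estimates of this kind.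
  set s := σ - δ / 2 with hs_def
  have h0 : 0 < s := by linarith
  have hs : s < σ := by linarith
  have hsd : s - δ / 2 = σ - δ := by rw [hs_def]; ring
  have hps : p ∈ Dom s := Dom_mono (by linarith) hp
  obtain ⟨h1, h2, -⟩ := mem_Dom.1 hp
  have r1 := rho_add_le (σ := s) (δ := δ / 2) (by linarith) (by linarith) (by linarith)
  have r2 := rho_inv_add_le (σ := s) (δ := δ / 2) (by linarith) (by linarith)
  rw [hsd] at r1 r2
  rw [(proj_eq_projC_and_quot_eq_quotC h0 hs hF hps).1, projC]
  have b1 : ‖cauchyInt (rho s)⁻¹ (bdry F) p.2⁻¹‖ ≤ (rho s)⁻¹ * B / (δ / 2) := by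
    refine norm_cauchyInt_le (inv_pos.2 (rho_pos s)) (by linarith) hB0
      (continuousAt_bdry_outer h0 hs hF) (fun ζ hζ => norm_bdry_le hs hB
        (hζ ▸ rho_le_rho_inv h0) hζ.le) ?_
    have := (inv_mem_openAnnulus h2).2
    rw [abs_of_nonneg (by linarith)]; linarith
  have b2 : ‖cauchyInt (rho s) (bdry F) p.1‖ ≤ rho s * B / (δ / 8) := by
    refine norm_cauchyInt_le (rho_pos s) (by linarith) hB0
      (continuousAt_bdry_inner h0 hs hF) (fun ζ hζ => norm_bdry_le hs hB
        hζ.ge (hζ ▸ rho_le_rho_inv h0)) ?_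
    have := h1.1
    rw [abs_of_nonpos (by linarith)]; linarith
  have c1 : (rho s)⁻¹ ≤ 3 := by linarith [rho_inv_le h0.le]
  have c2 := rho_le_one h0.le
  calc _ ≤ (rho s)⁻¹ * B / (δ / 2) + rho s * B / (δ / 8) :=
        (norm_sub_le _ _).trans (add_le_add b1 b2)
    _ ≤ 3 * B / (δ / 2) + 1 * B / (δ / 8) := by gcongr
    _ = 14 * B / δ := by field_simp; ring
    _ ≤ 32 * B / δ := by gcongr; norm_num

/-- Within `δ/4` of the base point the Schwarz lemma applies on a full disc; farther away the
denominator is at least `δ/4`. -/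
theorem norm_slice_dslope_le (hδ : 0 < δ) (hδσ : δ < σ) (hσ : σ ≤ 1)
    (hF : DifferentiableOn ℂ F (Dom σ)) (hB : ∀ p ∈ Dom σ, ‖F p‖ ≤ B) {z w c : ℂ}
    (hc : (z, c) ∈ Dom (σ - δ)) (hw : (z, w) ∈ Dom σ) :
    ‖dslope (fun w => F (z, w)) c w‖ ≤ 8 * B / δ := by
  have hball : ∀ w ∈ Metric.ball c (δ / 4), (z, w) ∈ Dom σ := by
    intro w hw
    refine ball_subset_Dom hδ.le hδσ.le hσ hc ?_
    rw [← ball_prod_same]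
    exact ⟨Metric.mem_ball_self (by linarith), hw⟩
  have hcB := hB _ (Dom_mono (by linarith) hc)
  by_cases hcw : w ∈ Metric.ball c (δ / 4)
  · have := Complex.norm_dslope_le_div_of_mapsTo_ball (f := fun w => F (z, w)) (c := c)
      (R₁ := δ / 4) (R₂ := 2 * B) (z := w) ?_ ?_ hcw
    · calc _ ≤ 2 * B / (δ / 4) := this
        _ = 8 * B / δ := by field_simp; ring
    · intro y hy
      exact (DifferentiableOn.slice2 hF (isOpen_Dom σ) (hball y hy)).differentiableWithinAt
    · intro y hy
      rw [mem_closedBall_iff_norm]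
      calc _ ≤ ‖F (z, y)‖ + ‖F (z, c)‖ := norm_sub_le _ _
        _ ≤ B + B := add_le_add (hB _ (hball y hy)) hcB
        _ = 2 * B := by ring
  · have hd : δ / 4 ≤ ‖w - c‖ := by simpa [dist_eq_norm] using hcw
    have hne : w ≠ c := fun h => by rw [h, sub_self, norm_zero] at hd; linarith
    rw [dslope_of_ne _ hne, slope_def_module, norm_smul, norm_inv]
    have : ‖F (z, w) - F (z, c)‖ ≤ 2 * B := by
      calc _ ≤ ‖F (z, w)‖ + ‖F (z, c)‖ := norm_sub_le _ _
        _ ≤ B + B := add_le_add (hB _ hw) hcB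
        _ = 2 * B := by ring
    calc ‖w - c‖⁻¹ * ‖F (z, w) - F (z, c)‖ ≤ (δ / 4)⁻¹ * (2 * B) := by gcongr
      _ = 8 * B / δ := by field_simp; ring

theorem norm_quot_le (hδ : 0 < δ) (hδσ : δ < σ) (hσ : σ ≤ 1) (hF : DifferentiableOn ℂ F (Dom σ))
    (hB0 : 0 ≤ B) (hB : ∀ p ∈ Dom σ, ‖F p‖ ≤ B) {p : ℂ × ℂ} (hp : p ∈ Dom (σ - δ)) :
    ‖quot F p‖ ≤ 32 * B / δ := by
  set s := σ - δ / 2 with hs_def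
  have h0 : 0 < s := by linarith
  have hs : s < σ := by linarith
  have hsd : s - δ / 2 = σ - δ := by rw [hs_def]; ring
  have hps : p ∈ Dom s := Dom_mono (by linarith) hp
  obtain ⟨h1, h2, -⟩ := mem_Dom.1 hp
  have r2 := rho_inv_add_le (σ := s) (δ := δ / 2) (by linarith) (by linarith)
  rw [hsd] at r2
  rw [(proj_eq_projC_and_quot_eq_quotC h0 hs hF hps).2, quotC]
  have c1 : (rho (σ - δ))⁻¹ ≤ 3 := by
    linarith [rho_inv_le (σ := σ - δ) (by linarith)]
  have n1 : ‖p.1⁻¹‖ ≤ 3 := (inv_mem_openAnnulus h1).2.le.trans c1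
  have n2 : ‖p.2⁻¹‖ ≤ 3 := (inv_mem_openAnnulus h2).2.le.trans c1
  have b1 := norm_slice_dslope_le hδ hδσ hσ hF hB (mem_Dom_inv_right h1)
    (w := p.2) (Dom_mono (by linarith) hp)
  have b2 : ‖cauchyInt₂ (rho s)⁻¹ (bdry F) p.1 p.2⁻¹‖ ≤ B / (δ / 2) := by
    refine norm_cauchyInt₂_le (by linarith) hB0
      (continuousAt_bdry_outer h0 hs hF) (fun ζ hζ => norm_bdry_le hs hB
        (hζ ▸ rho_le_rho_inv h0) hζ.le) ?_ ?_
    · linarith [h1.2]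
    · linarith [(inv_mem_openAnnulus h2).2]
  calc _ ≤ ‖p.1⁻¹‖ * ‖dslope (fun w => F (p.1, w)) p.1⁻¹ p.2‖ +
        ‖p.2⁻¹‖ * ‖cauchyInt₂ (rho s)⁻¹ (bdry F) p.1 p.2⁻¹‖ := by
        refine (norm_sub_le _ _).trans ?_
        rw [norm_neg, norm_mul, norm_mul]
    _ ≤ 3 * (8 * B / δ) + 3 * (B / (δ / 2)) := by gcongr
    _ = 30 * B / δ := by field_simp; ring
    _ ≤ 32 * B / δ := by gcongr; norm_num

theorem norm_pd2_le (hδ : 0 < δ) (hδσ : δ < σ) (hσ : σ ≤ 1) (hF : DifferentiableOn ℂ F (Dom σ))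
    (hB : ∀ p ∈ Dom σ, ‖F p‖ ≤ B) {p : ℂ × ℂ} (hp : p ∈ Dom (σ - δ)) :
    ‖pd2 F p‖ ≤ 32 * B / δ := by
  have hB0 : 0 ≤ B := (norm_nonneg _).trans (hB p (Dom_mono (by linarith) hp))
  have := norm_slice_dslope_le hδ hδσ hσ hF hB hp (Dom_mono (by linarith) hp)
  rw [dslope_same] at this
  calc _ ≤ 8 * B / δ := this
    _ ≤ 32 * B / δ := by gcongr; norm_num

theorem swap_mem_Dom {p : ℂ × ℂ} : p.swap ∈ Dom σ ↔ p ∈ Dom σ := by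
  have : ∀ q : ℂ × ℂ, ‖q.2 - conj q.1‖ = ‖q.1 - conj q.2‖ := fun q => by
    rw [← RCLike.norm_conj, map_sub, Complex.conj_conj, norm_sub_rev]
  rw [mem_Dom, mem_Dom, Prod.fst_swap, Prod.snd_swap, this]
  tauto

theorem norm_pd1_le (hδ : 0 < δ) (hδσ : δ < σ) (hσ : σ ≤ 1) (hF : DifferentiableOn ℂ F (Dom σ))
    (hB : ∀ p ∈ Dom σ, ‖F p‖ ≤ B) {p : ℂ × ℂ} (hp : p ∈ Dom (σ - δ)) :
    ‖pd1 F p‖ ≤ 32 * B / δ := by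
  have h := differentiableOn_comp_swap hF
  have e : Prod.swap ⁻¹' Dom σ = Dom σ := by ext q; exact swap_mem_Dom
  rw [e] at h
  exact norm_pd2_le hδ hδσ hσ h (fun q hq => hB _ (swap_mem_Dom.2 hq)) (p := p.swap)
    (swap_mem_Dom.2 hp)

end canonical

end BerezinOP
end

noncomputable section
namespace BerezinOP

/-! ### Bounded holomorphic functions on the polarized domains -/

/-- `F` is holomorphic on `Dom σ` and bounded there by `B`. -/
structure Bd (σ : ℝ) (F : ℂ × ℂ → ℂ) (B : ℝ) : Prop where
  diff : DifferentiableOn ℂ F (Dom σ)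
  le : ∀ p ∈ Dom σ, ‖F p‖ ≤ B

namespace Bd
variable {σ s δ A B B' : ℝ} {F G : ℂ × ℂ → ℂ}

theorem mono (h : Bd σ F B) (hs : s ≤ σ) : Bd s F B :=
  ⟨h.diff.mono (Dom_mono hs), fun p hp => h.le p (Dom_mono hs hp)⟩

theorem weaken (h : Bd σ F B) (hB : B ≤ B') : Bd σ F B' := ⟨h.diff, fun p hp => (h.le p hp).trans hB⟩

theorem mul (hF : Bd σ F A) (hG : Bd σ G B) (hA : 0 ≤ A) : Bd σ (F * G) (A * B) :=
  ⟨hF.diff.mul hG.diff, fun p hp => by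
    rw [Pi.mul_apply, norm_mul]
    exact mul_le_mul (hF.le p hp) (hG.le p hp) (norm_nonneg _) hA⟩

theorem const_mul (c : ℂ) (hF : Bd σ F A) : Bd σ (fun p => c * F p) (‖c‖ * A) :=
  ⟨hF.diff.const_mul c, fun p hp => by
    rw [norm_mul]; exact mul_le_mul_of_nonneg_left (hF.le p hp) (norm_nonneg _)⟩

theorem add (hF : Bd σ F A) (hG : Bd σ G B) : Bd σ (F + G) (A + B) :=
  ⟨hF.diff.add hG.diff, fun p hp => (norm_add_le _ _).trans (add_le_add (hF.le p hp) (hG.le p hp))⟩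

theorem sub (hF : Bd σ F A) (hG : Bd σ G B) : Bd σ (F - G) (A + B) :=
  ⟨hF.diff.sub hG.diff, fun p hp => (norm_sub_le _ _).trans (add_le_add (hF.le p hp) (hG.le p hp))⟩

theorem zero (h : 0 ≤ B) : Bd σ 0 B := ⟨differentiableOn_const _, fun p _ => by simpa using h⟩

theorem pd1 (h : Bd σ F B) (hδ : 0 < δ) (hδσ : δ < σ) (hσ : σ ≤ 1) :
    Bd (σ - δ) (pd1 F) (32 * B / δ) :=
  ⟨(differentiableOn_pd1 (isOpen_Dom σ) h.diff).mono (Dom_mono (by linarith)),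
    fun _ hp => norm_pd1_le hδ hδσ hσ h.diff h.le hp⟩

theorem pd2 (h : Bd σ F B) (hδ : 0 < δ) (hδσ : δ < σ) (hσ : σ ≤ 1) :
    Bd (σ - δ) (pd2 F) (32 * B / δ) :=
  ⟨(differentiableOn_pd2 (isOpen_Dom σ) h.diff).mono (Dom_mono (by linarith)),
    fun _ hp => norm_pd2_le hδ hδσ hσ h.diff h.le hp⟩

theorem quot (h : Bd σ F B) (hB : 0 ≤ B) (hδ : 0 < δ) (hδσ : δ < σ) (hσ : σ ≤ 1) :
    Bd (σ - δ) (quot F) (32 * B / δ) :=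
  ⟨(differentiableOn_quot h.diff).mono (Dom_mono (by linarith)),
    fun _ hp => norm_quot_le hδ hδσ hσ h.diff hB h.le hp⟩

theorem proj (h : Bd σ F B) (hB : 0 ≤ B) (hδ : 0 < δ) (hδσ : δ < σ) (hσ : σ ≤ 1) :
    Bd (σ - δ) (proj F) (32 * B / δ) :=
  ⟨(differentiableOn_proj h.diff).mono (Dom_mono (by linarith)),
    fun _ hp => norm_proj_le hδ hδσ hσ h.diff hB h.le hp⟩

end Bd

/-! ### Pointwise estimates -/

/-- On the convex half-plane `Re ≥ μ` the derivative `1/z` is at most `1/μ`. -/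
theorem norm_log_sub_log_le {μ : ℝ} (hμ : 0 < μ) {a b : ℂ} (ha : μ ≤ a.re) (hb : μ ≤ b.re) :
    ‖Complex.log a - Complex.log b‖ ≤ μ⁻¹ * ‖a - b‖ := by
  refine Convex.norm_image_sub_le_of_norm_deriv_le (s := {z : ℂ | μ ≤ z.re}) ?_ ?_
    (convex_halfSpace_re_ge μ) hb ha
  · intro z hz
    exact (Complex.hasStrictDerivAt_log (Or.inl (hμ.trans_le hz))).hasDerivAt.differentiableAt
  · intro z hz
    rw [(Complex.hasStrictDerivAt_log (Or.inl (hμ.trans_le hz))).hasDerivAt.deriv, norm_inv]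
    exact inv_anti₀ hμ (le_trans hz (Complex.re_le_norm z))

theorem norm_log_le {μ : ℝ} (hμ : 0 < μ) (hμ1 : μ ≤ 1) {a : ℂ} (ha : μ ≤ a.re) :
    ‖Complex.log a‖ ≤ μ⁻¹ * (‖a‖ + 1) := by
  have := norm_log_sub_log_le hμ ha (b := 1) (by simpa using hμ1)
  rw [Complex.log_one, sub_zero] at this
  refine this.trans (mul_le_mul_of_nonneg_left ?_ (inv_pos.2 hμ).le)
  simpa using norm_sub_le a 1

/-- The entire function `(e^s - 1)/s`. -/
def expQuot (s : ℂ) : ℂ := dslope Complex.exp 0 s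

theorem differentiable_expQuot : Differentiable ℂ expQuot := by
  rw [← differentiableOn_univ]
  exact (Complex.differentiableOn_dslope univ_mem).2 Complex.differentiable_exp.differentiableOn

theorem mul_expQuot (s : ℂ) : s * expQuot s = Complex.exp s - 1 := by
  have := sub_smul_dslope Complex.exp 0 s
  simpa [expQuot] using this

/-- The analytic function `a e^b (e^s - 1)/s` is bounded and Lipschitz on bounded sets. -/
theorem exists_bound_expProduct (C : ℝ) : ∃ K, 0 < K ∧
    (∀ a b s : ℂ, ‖a‖ ≤ C → ‖b‖ ≤ C → ‖s‖ ≤ C → ‖a * Complex.exp b * expQuot s‖ ≤ K) ∧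
    ∀ a b s a' b' s' : ℂ, ‖a‖ ≤ C → ‖b‖ ≤ C → ‖s‖ ≤ C → ‖a'‖ ≤ C → ‖b'‖ ≤ C → ‖s'‖ ≤ C →
    ∀ e, ‖a - a'‖ ≤ e → ‖b - b'‖ ≤ e → ‖s - s'‖ ≤ e →
      ‖a * Complex.exp b * expQuot s - a' * Complex.exp b' * expQuot s'‖ ≤ K * e := by
  set f : ℂ × ℂ × ℂ → ℂ := fun q => q.1 * Complex.exp q.2.1 * expQuot q.2.2
  have hf : ContDiff ℂ 1 f :=
    (contDiff_fst.mul (Complex.contDiff_exp.comp contDiff_snd.fst)).mul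
      ((differentiable_expQuot.contDiff).comp contDiff_snd.snd)
  have hcpt : IsCompact (Metric.closedBall (0 : ℂ × ℂ × ℂ) C) := isCompact_closedBall _ _
  obtain ⟨K1, hK1⟩ := hcpt.exists_bound_of_continuousOn hf.continuous.continuousOn
  obtain ⟨K2, hK2⟩ := hcpt.exists_bound_of_continuousOn
    (hf.continuous_fderiv one_ne_zero).continuousOn
  have hmem : ∀ {a b s : ℂ}, ‖a‖ ≤ C → ‖b‖ ≤ C → ‖s‖ ≤ C →
      ((a, b, s) : ℂ × ℂ × ℂ) ∈ Metric.closedBall (0 : ℂ × ℂ × ℂ) C := by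
    intro a b s ha hb hs
    rw [mem_closedBall_zero_iff]
    exact norm_prod_le_iff.2 ⟨ha, norm_prod_le_iff.2 ⟨hb, hs⟩⟩
  refine ⟨max 1 (max K1 K2), by positivity, fun a b s ha hb hs => ?_, ?_⟩
  · exact (hK1 _ (hmem ha hb hs)).trans ((le_max_left _ _).trans (le_max_right _ _))
  · intro a b s a' b' s' ha hb hs ha' hb' hs' e h1 h2 h3
    have he : 0 ≤ e := (norm_nonneg _).trans h1
    have := (convex_closedBall (0 : ℂ × ℂ × ℂ) C).norm_image_sub_le_of_norm_fderiv_le (𝕜 := ℂ)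
      (fun x _ => (hf.differentiable one_ne_zero).differentiableAt) hK2 (hmem ha' hb' hs')
      (hmem ha hb hs)
    have hn : ‖((a, b, s) : ℂ × ℂ × ℂ) - (a', b', s')‖ ≤ e :=
      norm_prod_le_iff.2 ⟨h1, norm_prod_le_iff.2 ⟨h2, h3⟩⟩
    refine this.trans (mul_le_mul ((le_max_right _ _).trans (le_max_right _ _)) hn
      (norm_nonneg _) (by positivity))

/-! ### The polarized operator -/

/-- Coefficients of the polarized operators. -/
structure PolCoef where
  (c₁ c₂ c₃ c₄ a₁ a₂ κ L₀ L₁ c₅ : ℂ × ℂ → ℂ)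

namespace PolCoef

/-- The polarization of the operator `S`. -/
def opS (C : PolCoef) (ϑ : ℂ) (F : ℂ × ℂ → ℂ) : ℂ × ℂ → ℂ :=
  C.c₁ * pd1 F + C.c₂ * pd2 F + C.c₃ * F + C.c₄ * quot F +
    fun p => ϑ / 4 * (C.a₁ * pd1 (C.a₂ * pd2 (C.κ * quot F))) p

/-- The polarization of `L + ϑ S`. -/
def lam (C : PolCoef) (ϑ : ℂ) (F : ℂ × ℂ → ℂ) (p : ℂ × ℂ) : ℂ :=
  C.L₀ p + ϑ * C.L₁ p + ϑ * C.opS ϑ F p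

/-- The polarization of `log (L + ϑ S)`. -/
def logLam (C : PolCoef) (ϑ : ℂ) (F : ℂ × ℂ → ℂ) (p : ℂ × ℂ) : ℂ := Complex.log (C.lam ϑ F p)

/-- The polarization of the operator `T`. -/
def opT (C : PolCoef) (ϑ : ℂ) (F : ℂ × ℂ → ℂ) (p : ℂ × ℂ) : ℂ :=
  C.c₅ p * (quot (C.logLam ϑ F) p * Complex.exp (proj (C.logLam ϑ F) p) *
    expQuot (C.logLam ϑ F p - proj (C.logLam ϑ F) p))

/-- Uniform bounds on the coefficients. -/
structure Good (C : PolCoef) (σ A m : ℝ) : Prop where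
  c₁ : Bd σ C.c₁ A
  c₂ : Bd σ C.c₂ A
  c₃ : Bd σ C.c₃ A
  c₄ : Bd σ C.c₄ A
  a₁ : Bd σ C.a₁ A
  a₂ : Bd σ C.a₂ A
  κ : Bd σ C.κ A
  L₀ : Bd σ C.L₀ A
  L₁ : Bd σ C.L₁ A
  c₅ : Bd σ C.c₅ A
  re_L₀ : ∀ p ∈ Dom σ, m ≤ (C.L₀ p).re
  σ_pos : 0 < σ
  σ_le : σ ≤ 1
  m_pos : 0 < m
  m_le : m ≤ 1
  A_ge : 1 ≤ A

end PolCoef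

theorem pd1_congr {F G : ℂ × ℂ → ℂ} {D : Set (ℂ × ℂ)} (hD : IsOpen D) (h : EqOn F G D) :
    EqOn (pd1 F) (pd1 G) D := by
  intro p hp
  refine Filter.EventuallyEq.deriv_eq ?_
  have : ∀ᶠ z in 𝓝 p.1, (z, p.2) ∈ D :=
    (continuous_id.prodMk continuous_const).continuousAt.eventually_mem (hD.mem_nhds hp)
  filter_upwards [this] with z hz using h hz

theorem pd2_congr {F G : ℂ × ℂ → ℂ} {D : Set (ℂ × ℂ)} (hD : IsOpen D) (h : EqOn F G D) :
    EqOn (pd2 F) (pd2 G) D := by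
  intro p hp
  refine Filter.EventuallyEq.deriv_eq ?_
  have : ∀ᶠ w in 𝓝 p.2, (p.1, w) ∈ D :=
    (continuous_const.prodMk continuous_id).continuousAt.eventually_mem (hD.mem_nhds hp)
  filter_upwards [this] with z hz using h hz

theorem pd1_sub {F G : ℂ × ℂ → ℂ} {D : Set (ℂ × ℂ)} (hD : IsOpen D)
    (hF : DifferentiableOn ℂ F D) (hG : DifferentiableOn ℂ G D) :
    EqOn (pd1 (F - G)) (pd1 F - pd1 G) D := fun _ hp =>
  deriv_fun_sub (DifferentiableOn.slice1 hF hD hp) (DifferentiableOn.slice1 hG hD hp)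

theorem pd2_sub {F G : ℂ × ℂ → ℂ} {D : Set (ℂ × ℂ)} (hD : IsOpen D)
    (hF : DifferentiableOn ℂ F D) (hG : DifferentiableOn ℂ G D) :
    EqOn (pd2 (F - G)) (pd2 F - pd2 G) D := fun _ hp =>
  deriv_fun_sub (DifferentiableOn.slice2 hF hD hp) (DifferentiableOn.slice2 hG hD hp)

namespace PolCoef.Good
variable {C : PolCoef} {σ₁ A m : ℝ} (hC : C.Good σ₁ A m)
include hC

/-- Linearity of `S`: it allows `bd_opS` to be applied to a difference of two functions. -/
theorem opS_sub {σ : ℝ} (hσ : σ ≤ σ₁) (ϑ : ℂ) {F G : ℂ × ℂ → ℂ}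
    (hF : DifferentiableOn ℂ F (Dom σ)) (hG : DifferentiableOn ℂ G (Dom σ)) :
    EqOn (C.opS ϑ (F - G)) (C.opS ϑ F - C.opS ϑ G) (Dom σ) := by
  have hD := isOpen_Dom σ
  have hκ := (hC.κ.mono hσ).diff
  have ha := (hC.a₂.mono hσ).diff
  have qF := hκ.mul (differentiableOn_quot hF)
  have qG := hκ.mul (differentiableOn_quot hG)
  have e1 : EqOn (C.κ * quot (F - G)) (C.κ * quot F - C.κ * quot G) (Dom σ) := fun p hp => by
    simp only [Pi.mul_apply, Pi.sub_apply, quot_sub hF hG hp]; ring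
  have e2 : EqOn (C.a₂ * pd2 (C.κ * quot (F - G)))
      (C.a₂ * pd2 (C.κ * quot F) - C.a₂ * pd2 (C.κ * quot G)) (Dom σ) := fun p hp => by
    simp only [Pi.mul_apply, Pi.sub_apply, pd2_congr hD e1 hp, pd2_sub hD qF qG hp]; ring
  intro p hp
  have e3 := pd1_congr hD e2 hp
  rw [pd1_sub hD (ha.mul (differentiableOn_pd2 hD qF)) (ha.mul (differentiableOn_pd2 hD qG)) hp]
    at e3
  simp only [PolCoef.opS, Pi.mul_apply, Pi.add_apply, Pi.sub_apply, e3, pd1_sub hD hF hG hp,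
    pd2_sub hD hF hG hp, quot_sub hF hG hp]
  ring

theorem opS_zero {σ : ℝ} (hσ : σ ≤ σ₁) (ϑ : ℂ) : EqOn (C.opS ϑ 0) 0 (Dom σ) := by
  intro p hp
  have := hC.opS_sub hσ ϑ (F := 0) (G := 0) (differentiableOn_const _) (differentiableOn_const _) hp
  simpa using this

theorem differentiableOn_opS {σ : ℝ} (hσ : σ ≤ σ₁) (ϑ : ℂ) {F : ℂ × ℂ → ℂ}
    (hF : DifferentiableOn ℂ F (Dom σ)) : DifferentiableOn ℂ (C.opS ϑ F) (Dom σ) := by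
  have hD := isOpen_Dom σ
  have q := differentiableOn_quot hF
  refine ((((((hC.c₁.mono hσ).diff).mul (differentiableOn_pd1 hD hF)).add
    (((hC.c₂.mono hσ).diff).mul (differentiableOn_pd2 hD hF))).add
    (((hC.c₃.mono hσ).diff).mul hF)).add (((hC.c₄.mono hσ).diff).mul q)).add
    (DifferentiableOn.const_mul ?_ _)
  exact ((hC.a₁.mono hσ).diff).mul (differentiableOn_pd1 hD (((hC.a₂.mono hσ).diff).mul
    (differentiableOn_pd2 hD (((hC.κ.mono hσ).diff).mul q))))

/-- The first-order terms and the divided difference cost `1/δ`. The last term composes three such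
operations, each given a third of the loss (whence `96 = 3 * 32`), and `‖ϑ‖ ≤ δ²` brings its `δ⁻³`
back to `1/δ`. -/
theorem bd_opS {σ δ B : ℝ} (hσ : σ ≤ σ₁) (hδ : 0 < δ) (hδσ : δ < σ) {ϑ : ℂ} (hϑ : ‖ϑ‖ ≤ δ ^ 2)
    {F : ℂ × ℂ → ℂ} (hF : Bd σ F B) (hB : 0 ≤ B) :
    Bd (σ - δ) (C.opS ϑ F) (96 ^ 3 * A ^ 3 * B / δ) := by
  have h1 : σ ≤ 1 := hσ.trans hC.σ_le
  have hA := hC.A_ge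
  have hA0 : 0 ≤ A := by linarith
  have hd3 : 0 < δ / 3 := by linarith
  have e1 : σ - δ / 3 - δ / 3 = σ - 2 * δ / 3 := by ring
  have e2 : σ - 2 * δ / 3 - δ / 3 = σ - δ := by ring
  have p1 := (hF.pd1 hδ hδσ h1)
  have p2 := (hF.pd2 hδ hδσ h1)
  have q := hF.quot hB hd3 (by linarith) h1
  have hB1 : 0 ≤ 32 * B / (δ / 3) := by positivity
  have k2 := ((hC.κ.mono (by linarith)).mul q hA0).pd2 hd3 (by linarith) (by linarith)
  rw [e1] at k2
  have k3 := ((hC.a₂.mono (by linarith)).mul k2 hA0).pd1 hd3 (by linarith) (by linarith)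
  rw [e2] at k3
  have k4 := ((hC.a₁.mono (by linarith)).mul k3 hA0).const_mul (ϑ / 4)
  have tot := (((((hC.c₁.mono (by linarith)).mul p1 hA0).add
    ((hC.c₂.mono (by linarith)).mul p2 hA0)).add
    ((hC.c₃.mono (by linarith)).mul (hF.mono (by linarith)) hA0)).add
    ((hC.c₄.mono (by linarith)).mul (q.mono (by linarith)) hA0)).add k4
  refine tot.weaken ?_
  have hn : ‖ϑ / 4‖ ≤ δ ^ 2 / 4 := by rw [norm_div]; simpa using by linarith
  have hBd : B ≤ B / δ := by
    rw [le_div_iff₀ hδ]; nlinarith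
  have hAA : A ≤ A ^ 3 := by nlinarith [mul_nonneg hA0 hA0]
  have hBδ : 0 ≤ B / δ := by positivity
  calc _ ≤ A * (32 * B / δ) + A * (32 * B / δ) + A * (B / δ) + A * (32 * B / (δ / 3)) +
        δ ^ 2 / 4 * (A * (32 * (A * (32 * (A * (32 * B / (δ / 3))) / (δ / 3))) / (δ / 3))) := by
        gcongr
    _ = (161 * A + 96 ^ 3 / 4 * A ^ 3) * (B / δ) := by field_simp; ring
    _ ≤ (96 ^ 3 * A ^ 3) * (B / δ) := by gcongr; nlinarith
    _ = _ := by ring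

theorem differentiableOn_lam {σ : ℝ} (hσ : σ ≤ σ₁) (ϑ : ℂ) {F : ℂ × ℂ → ℂ}
    (hF : DifferentiableOn ℂ F (Dom σ)) : DifferentiableOn ℂ (C.lam ϑ F) (Dom σ) :=
  (((hC.L₀.mono hσ).diff).add (((hC.L₁.mono hσ).diff).const_mul ϑ)).add
    ((hC.differentiableOn_opS hσ ϑ hF).const_mul ϑ)

omit hC in
theorem differentiableOn_logLam {σ μ : ℝ} {ϑ : ℂ} {F : ℂ × ℂ → ℂ} (hμ : 0 < μ)
    (hL : DifferentiableOn ℂ (C.lam ϑ F) (Dom σ)) (hre : ∀ p ∈ Dom σ, μ ≤ (C.lam ϑ F p).re) :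
    DifferentiableOn ℂ (C.logLam ϑ F) (Dom σ) :=
  hL.clog fun p hp => Or.inl (hμ.trans_le (hre p hp))

/-- The polarized operator is a contraction up to a loss of two derivatives, on a ball on which it
is well defined. -/
theorem exists_lipschitz_opT : ∃ M₀ K ε : ℝ, 0 < M₀ ∧ 0 < K ∧ 0 < ε ∧ ∀ ϑ : ℂ, ‖ϑ‖ ≤ ε →
    Bd (σ₁ / 2) (C.opT ϑ 0) M₀ ∧ (∀ p ∈ Dom σ₁, 0 < (C.lam ϑ 0 p).re) ∧
    ∀ σ δ : ℝ, σ ≤ σ₁ / 2 → 0 < δ → δ < σ → ‖ϑ‖ ≤ ε * δ ^ 2 →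
      ∀ F : ℂ × ℂ → ℂ, Bd σ F (2 * M₀) →
        DifferentiableOn ℂ (C.opT ϑ F) (Dom (σ - δ)) ∧
        (∀ p ∈ Dom (σ - δ / 2), 0 < (C.lam ϑ F p).re) ∧
        ∀ G : ℂ × ℂ → ℂ, Bd σ G (2 * M₀) → ∀ d : ℝ, Bd σ (F - G) d → 0 ≤ d →
          Bd (σ - δ) (C.opT ϑ F - C.opT ϑ G) (K * (‖ϑ‖ / δ ^ 2) * d) := by
  have hσ0 := hC.σ_pos
  have hσ1 := hC.σ_le
  have hm := hC.m_pos
  have hm1 := hC.m_le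
  have hA := hC.A_ge
  have hA0 : 0 < A := by linarith
  -- `B₁` bounds the logarithm at `F = 0`. Then `C₂` bounds the three arguments of the analytic
  -- function for every `F` in the ball, with room `1` for the deviation from `F = 0`.
  set B₁ : ℝ := (m / 2)⁻¹ * (A + m / 4 + 1) with hB₁
  have hB₁0 : 0 < B₁ := by positivity
  set C₂ : ℝ := 32 * B₁ / (σ₁ / 2) + B₁ + 1 with hC₂
  obtain ⟨KΦ, hKΦ, hΦ1, hΦ2⟩ := exists_bound_expProduct C₂
  set M₀ : ℝ := A * KΦ with hM₀
  have hM₀0 : 0 < M₀ := by positivity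
  set KS : ℝ := 96 ^ 3 * A ^ 3 with hKS
  have hKS0 : 0 < KS := by positivity
  set K : ℝ := A * (KΦ * (512 * KS / m)) with hK
  -- The four entries ensure, in order: `‖ϑ‖ ≤ (δ/2)²`, as `bd_opS` requires; `‖ϑ L₁‖ ≤ m/4`; `‖ϑ
  -- S[F]‖ ≤ m/4`, so that the real part stays above `m/2`; and a deviation of at most `1/4` from
  -- the values at `F = 0`.
  set ε : ℝ := min (1 / 4) (min (m / (4 * A)) (min (m / (16 * KS * M₀)) (m / (2048 * KS * M₀))))
    with hε
  have hε0 : 0 < ε := by positivity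
  refine ⟨M₀, K, ε, hM₀0, by positivity, hε0, fun ϑ hϑ => ?_⟩
  have hε1 : ε ≤ 1 / 4 := min_le_left _ _
  have hε2 : ε ≤ m / (4 * A) := (min_le_right _ _).trans (min_le_left _ _)
  have hε3 : ε ≤ m / (16 * KS * M₀) :=
    (min_le_right _ _).trans ((min_le_right _ _).trans (min_le_left _ _))
  have hε4 : ε ≤ m / (2048 * KS * M₀) :=
    (min_le_right _ _).trans ((min_le_right _ _).trans (min_le_right _ _))
  have hϑA : ‖ϑ‖ * A ≤ m / 4 := by
    calc ‖ϑ‖ * A ≤ m / (4 * A) * A := by gcongr; exact hϑ.trans hε2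
      _ = m / 4 := by field_simp
  have hlam0 : ∀ p ∈ Dom σ₁, C.lam ϑ 0 p = C.L₀ p + ϑ * C.L₁ p := fun p hp => by
    rw [PolCoef.lam, hC.opS_zero le_rfl ϑ hp]; simp
  have hL1 : ∀ p ∈ Dom σ₁, ‖ϑ * C.L₁ p‖ ≤ m / 4 := fun p hp => by
    rw [norm_mul]
    exact (mul_le_mul_of_nonneg_left (hC.L₁.le p hp) (norm_nonneg _)).trans hϑA
  have hre0 : ∀ p ∈ Dom σ₁, 3 * m / 4 ≤ (C.lam ϑ 0 p).re := fun p hp => by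
    rw [hlam0 p hp, Complex.add_re]
    have h1 := hC.re_L₀ p hp
    have h2 := (abs_le.1 ((Complex.abs_re_le_norm (ϑ * C.L₁ p)).trans (hL1 p hp))).1
    linarith
  have hX0d : DifferentiableOn ℂ (C.logLam ϑ 0) (Dom σ₁) :=
    differentiableOn_logLam (by positivity : 0 < 3 * m / 4)
      (hC.differentiableOn_lam le_rfl ϑ (differentiableOn_const _)) hre0
  have hX0 : Bd σ₁ (C.logLam ϑ 0) B₁ := by
    refine ⟨hX0d, fun p hp => ?_⟩
    refine (norm_log_le (μ := m / 2) (by positivity) (by linarith)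
      (by linarith [hre0 p hp])).trans ?_
    rw [hB₁]
    gcongr
    rw [hlam0 p hp]
    exact (norm_add_le _ _).trans (add_le_add (hC.L₀.le p hp) (hL1 p hp))
  have hhalf : σ₁ - σ₁ / 2 = σ₁ / 2 := by ring
  have hP0 := hX0.proj hB₁0.le (half_pos hσ0) (by linarith) hσ1
  have hQ0 := hX0.quot hB₁0.le (half_pos hσ0) (by linarith) hσ1
  rw [hhalf] at hP0 hQ0
  have hq0 : 0 ≤ 32 * B₁ / (σ₁ / 2) := by positivity
  refine ⟨⟨?_, fun p hp => ?_⟩, fun p hp => by linarith [hre0 p hp], ?_⟩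
  · have hX0' := hX0.mono (by linarith : σ₁ / 2 ≤ σ₁)
    exact (hC.c₅.mono (by linarith)).diff.mul ((hQ0.diff.mul hP0.diff.cexp).mul
      (differentiable_expQuot.comp_differentiableOn (hX0'.diff.sub hP0.diff)))
  · rw [PolCoef.opT, norm_mul, hM₀]
    have hp1 := Dom_mono (by linarith : σ₁ / 2 ≤ σ₁) hp
    refine mul_le_mul (hC.c₅.le p hp1) (hΦ1 _ _ _ ?_ ?_ ?_) (norm_nonneg _) hA0.le
    · linarith [hQ0.le p hp]
    · linarith [hP0.le p hp]
    · linarith [norm_sub_le (C.logLam ϑ 0 p) (proj (C.logLam ϑ 0) p), hX0.le p hp1, hP0.le p hp]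
  intro σ δ hσ hδ hδσ hϑδ
  have hσσ : σ ≤ σ₁ := by linarith
  have hδ2 : 0 < δ / 2 := by linarith
  have hδ1 : δ ≤ 1 := by linarith
  have hϑδ' : ‖ϑ‖ ≤ (δ / 2) ^ 2 := by
    calc ‖ϑ‖ ≤ ε * δ ^ 2 := hϑδ
      _ ≤ 1 / 4 * δ ^ 2 := by gcongr
      _ = (δ / 2) ^ 2 := by ring
  have hϑδ1 : ‖ϑ‖ / δ ≤ ε * δ := by
    rw [div_le_iff₀ hδ]; calc _ ≤ _ := hϑδ
      _ = _ := by ring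
  have hϑδ2 : ‖ϑ‖ / δ ^ 2 ≤ ε := by rw [div_le_iff₀ (by positivity)]; exact hϑδ
  have hsub2 : σ - δ / 2 - δ / 2 = σ - δ := by ring
  -- facts about a single function
  have hre : ∀ F : ℂ × ℂ → ℂ, Bd σ F (2 * M₀) → ∀ p ∈ Dom (σ - δ / 2),
      m / 2 ≤ (C.lam ϑ F p).re := by
    intro F hF p hp
    have hS := (hC.bd_opS hσσ hδ2 (by linarith) hϑδ' hF (by positivity)).le p hp
    have hn : ‖ϑ * C.opS ϑ F p‖ ≤ m / 4 := by
      rw [norm_mul]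
      calc ‖ϑ‖ * ‖C.opS ϑ F p‖ ≤ ‖ϑ‖ * (KS * (2 * M₀) / (δ / 2)) := by gcongr
        _ = 4 * KS * M₀ * (‖ϑ‖ / δ) := by field_simp; ring
        _ ≤ 4 * KS * M₀ * (m / (16 * KS * M₀) * 1) := by
          gcongr
          exact hϑδ1.trans (mul_le_mul hε3 hδ1 hδ.le (by positivity))
        _ = m / 4 := by field_simp; norm_num
    have hp1 := Dom_mono (by linarith : σ - δ / 2 ≤ σ₁) hp
    have h1 := hC.re_L₀ p hp1
    have h2 := (abs_le.1 ((Complex.abs_re_le_norm (ϑ * C.L₁ p)).trans (hL1 p hp1))).1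
    have h3 := (abs_le.1 ((Complex.abs_re_le_norm _).trans hn)).1
    rw [PolCoef.lam, Complex.add_re, Complex.add_re]
    linarith
  have hXd : ∀ F : ℂ × ℂ → ℂ, Bd σ F (2 * M₀) →
      DifferentiableOn ℂ (C.logLam ϑ F) (Dom (σ - δ / 2)) := fun F hF =>
    differentiableOn_logLam (half_pos hm) ((hC.differentiableOn_lam hσσ ϑ hF.diff).mono
      (Dom_mono (by linarith))) (hre F hF)
  have hXX : ∀ F G : ℂ × ℂ → ℂ, Bd σ F (2 * M₀) → Bd σ G (2 * M₀) → ∀ d : ℝ, Bd σ (F - G) d →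
      0 ≤ d → Bd (σ - δ / 2) (C.logLam ϑ F - C.logLam ϑ G) (4 * KS / m * (‖ϑ‖ / δ) * d) := by
    intro F G hF hG d hd hd0
    refine ⟨(hXd F hF).sub (hXd G hG), fun p hp => ?_⟩
    refine (norm_log_sub_log_le (half_pos hm) (hre F hF p hp) (hre G hG p hp)).trans ?_
    have hS := (hC.bd_opS hσσ hδ2 (by linarith) hϑδ' hd hd0).le p hp
    have hpσ := Dom_mono (by linarith : σ - δ / 2 ≤ σ) hp
    rw [hC.opS_sub hσσ ϑ hF.diff hG.diff hpσ] at hS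
    have e : C.lam ϑ F p - C.lam ϑ G p = ϑ * (C.opS ϑ F - C.opS ϑ G) p := by
      simp only [PolCoef.lam, Pi.sub_apply]; ring
    rw [e, norm_mul]
    calc (m / 2)⁻¹ * (‖ϑ‖ * ‖(C.opS ϑ F - C.opS ϑ G) p‖)
        ≤ (m / 2)⁻¹ * (‖ϑ‖ * (KS * d / (δ / 2))) := by gcongr
      _ = 4 * KS / m * (‖ϑ‖ / δ) * d := by field_simp; ring
  -- differences of projections and quotients
  have hdiff : ∀ F G : ℂ × ℂ → ℂ, Bd σ F (2 * M₀) → Bd σ G (2 * M₀) → ∀ d : ℝ, Bd σ (F - G) d →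
      0 ≤ d → ∀ p ∈ Dom (σ - δ),
      ‖quot (C.logLam ϑ F) p - quot (C.logLam ϑ G) p‖ ≤ 256 * KS / m * (‖ϑ‖ / δ ^ 2) * d ∧
      ‖proj (C.logLam ϑ F) p - proj (C.logLam ϑ G) p‖ ≤ 256 * KS / m * (‖ϑ‖ / δ ^ 2) * d ∧
      ‖C.logLam ϑ F p - C.logLam ϑ G p‖ ≤ 256 * KS / m * (‖ϑ‖ / δ ^ 2) * d := by
    intro F G hF hG d hd hd0 p hp
    have h := hXX F G hF hG d hd hd0
    have hb : 0 ≤ 4 * KS / m * (‖ϑ‖ / δ) * d := by positivity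
    have h1 := (h.quot hb hδ2 (by linarith) (by linarith)).le
    have h2 := (h.proj hb hδ2 (by linarith) (by linarith)).le
    rw [hsub2] at h1 h2
    have hp2 := Dom_mono (by linarith : σ - δ ≤ σ - δ / 2) hp
    have e : 32 * (4 * KS / m * (‖ϑ‖ / δ) * d) / (δ / 2) = 256 * KS / m * (‖ϑ‖ / δ ^ 2) * d := by
      field_simp; ring
    rw [e] at h1 h2
    have h1' := h1 p hp
    have h2' := h2 p hp
    rw [quot_sub (hXd F hF) (hXd G hG) hp2] at h1'
    rw [proj_sub (hXd F hF) (hXd G hG) hp2] at h2'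
    refine ⟨h1', h2', (h.le p hp2).trans ?_⟩
    rw [← e]
    rw [le_div_iff₀ hδ2]
    nlinarith
  -- uniform bounds
  have hbd : ∀ F : ℂ × ℂ → ℂ, Bd σ F (2 * M₀) → ∀ p ∈ Dom (σ - δ),
      ‖quot (C.logLam ϑ F) p‖ ≤ C₂ ∧ ‖proj (C.logLam ϑ F) p‖ ≤ C₂ ∧
      ‖C.logLam ϑ F p - proj (C.logLam ϑ F) p‖ ≤ C₂ := by
    intro F hF p hp
    -- Everything is compared with `F = 0`, whose bounds hold on `Dom (σ₁ / 2)` for all `ϑ` at once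
    -- and do not degenerate as `δ` tends to zero.
    have hF0 : Bd σ (F - 0) (2 * M₀) := by simpa using hF
    obtain ⟨h1, h2, h3⟩ := hdiff F 0 hF (Bd.zero (by positivity)) _ hF0 (by positivity) p hp
    have hq : 256 * KS / m * (‖ϑ‖ / δ ^ 2) * (2 * M₀) ≤ 1 / 4 := by
      calc 256 * KS / m * (‖ϑ‖ / δ ^ 2) * (2 * M₀)
          ≤ 256 * KS / m * (m / (2048 * KS * M₀)) * (2 * M₀) := by
            have := hϑδ2.trans hε4
            have h0 : 0 ≤ 256 * KS / m := by positivity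
            have h1 : 0 ≤ 2 * M₀ := by positivity
            exact mul_le_mul_of_nonneg_right (mul_le_mul_of_nonneg_left this h0) h1
        _ = 1 / 4 := by field_simp; norm_num
    have hp0 := Dom_mono (by linarith : σ - δ ≤ σ₁ / 2) hp
    have hp1 := Dom_mono (by linarith : σ - δ ≤ σ₁) hp
    have g1 := hQ0.le p hp0
    have g2 := hP0.le p hp0
    have g3 := hX0.le p hp1
    have t : ∀ a b : ℂ, ‖a‖ ≤ ‖a - b‖ + ‖b‖ := fun a b => by simpa using norm_add_le (a - b) b
    have t1 := t (quot (C.logLam ϑ F) p) (quot (C.logLam ϑ 0) p)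
    have t2 := t (proj (C.logLam ϑ F) p) (proj (C.logLam ϑ 0) p)
    have t3 := t (C.logLam ϑ F p) (C.logLam ϑ 0 p)
    have t4 := norm_sub_le (C.logLam ϑ F p) (proj (C.logLam ϑ F) p)
    refine ⟨by linarith, by linarith, by linarith⟩
  have hTd : ∀ F : ℂ × ℂ → ℂ, Bd σ F (2 * M₀) →
      DifferentiableOn ℂ (C.opT ϑ F) (Dom (σ - δ)) := by
    intro F hF
    have hX := hXd F hF
    have : DifferentiableOn ℂ (C.opT ϑ F) (Dom (σ - δ / 2)) :=
      (hC.c₅.mono (by linarith)).diff.mul (((differentiableOn_quot hX).mul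
        (differentiableOn_proj hX).cexp).mul
        (differentiable_expQuot.comp_differentiableOn (hX.sub (differentiableOn_proj hX))))
    exact this.mono (Dom_mono (by linarith))
  intro F hF
  refine ⟨hTd F hF, fun p hp => (half_pos hm).trans_le (hre F hF p hp), ?_⟩
  intro G hG d hd hd0
  refine ⟨(hTd F hF).sub (hTd G hG), fun p hp => ?_⟩
  obtain ⟨h1, h2, h3⟩ := hdiff F G hF hG d hd hd0 p hp
  obtain ⟨f1, f2, f3⟩ := hbd F hF p hp
  obtain ⟨g1, g2, g3⟩ := hbd G hG p hp
  have hp1 := Dom_mono (by linarith : σ - δ ≤ σ₁) hp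
  set e := 256 * KS / m * (‖ϑ‖ / δ ^ 2) * d with he
  have he0 : 0 ≤ e := by positivity
  -- The factor `2` is for the third argument, a difference of two quantities each of which moves by
  -- at most `e`.
  have key := hΦ2 _ _ _ _ _ _ f1 f2 f3 g1 g2 g3 (2 * e) (by linarith) (by linarith) (by
    have : C.logLam ϑ F p - proj (C.logLam ϑ F) p - (C.logLam ϑ G p - proj (C.logLam ϑ G) p) =
      (C.logLam ϑ F p - C.logLam ϑ G p) - (proj (C.logLam ϑ F) p - proj (C.logLam ϑ G) p) := by ring
    rw [this]
    exact (norm_sub_le _ _).trans (by linarith))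
  have e4 : (C.opT ϑ F - C.opT ϑ G) p = C.c₅ p * (quot (C.logLam ϑ F) p *
      Complex.exp (proj (C.logLam ϑ F) p) * expQuot (C.logLam ϑ F p - proj (C.logLam ϑ F) p) -
      quot (C.logLam ϑ G) p * Complex.exp (proj (C.logLam ϑ G) p) *
      expQuot (C.logLam ϑ G p - proj (C.logLam ϑ G) p)) := by
    simp only [Pi.sub_apply, PolCoef.opT]; ring
  rw [e4, norm_mul]
  calc _ ≤ A * (KΦ * (2 * e)) := mul_le_mul (hC.c₅.le p hp1) key (norm_nonneg _) hA0.le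
    _ = K * (‖ϑ‖ / δ ^ 2) * d := by rw [hK, he]; ring

end PolCoef.Good

end BerezinOP
end

noncomputable section
namespace BerezinOP

/-! ### Polarization of real-analytic functions -/

/-- The complexified real part `(z + w)/2`. -/
def polRe : ℂ × ℂ →L[ℂ] ℂ :=
  (1 / 2 : ℂ) • (ContinuousLinearMap.fst ℂ ℂ ℂ + ContinuousLinearMap.snd ℂ ℂ ℂ)

/-- The complexified imaginary part `(z - w)/2i`. -/
def polIm : ℂ × ℂ →L[ℂ] ℂ :=
  (1 / (2 * Complex.I) : ℂ) • (ContinuousLinearMap.fst ℂ ℂ ℂ - ContinuousLinearMap.snd ℂ ℂ ℂ)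

theorem norm_polRe_le : ‖polRe‖ ≤ 1 := by
  refine ContinuousLinearMap.opNorm_le_bound _ zero_le_one fun v => ?_
  have h1 := norm_fst_le v
  have h2 := norm_snd_le v
  have : polRe v = (1 / 2 : ℂ) * (v.1 + v.2) := rfl
  rw [this, norm_mul]
  have h3 := norm_add_le v.1 v.2
  have : ‖(1 / 2 : ℂ)‖ = 1 / 2 := by norm_num
  rw [this]; linarith

theorem norm_polIm_le : ‖polIm‖ ≤ 1 := by
  refine ContinuousLinearMap.opNorm_le_bound _ zero_le_one fun v => ?_
  have h1 := norm_fst_le v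
  have h2 := norm_snd_le v
  have : polIm v = (1 / (2 * Complex.I) : ℂ) * (v.1 - v.2) := rfl
  rw [this, norm_mul]
  have h3 := norm_sub_le v.1 v.2
  have : ‖(1 / (2 * Complex.I) : ℂ)‖ = 1 / 2 := by simp
  rw [this]; linarith

theorem polRe_diag (h : ℂ) : polRe (h, conj h) = (h.re : ℂ) := by
  have : polRe (h, conj h) = (1 / 2 : ℂ) * (h + conj h) := rfl
  rw [this, Complex.add_conj]; push_cast; ring

theorem polIm_diag (h : ℂ) : polIm (h, conj h) = (h.im : ℂ) := by
  have : polIm (h, conj h) = (1 / (2 * Complex.I) : ℂ) * (h - conj h) := rfl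
  rw [this, Complex.sub_conj]; push_cast
  field_simp

/-- The complexification of a formal multilinear series on the real plane. -/
def complexify (P : FormalMultilinearSeries ℝ ℂ ℂ) : FormalMultilinearSeries ℂ (ℂ × ℂ) ℂ := fun n =>
  ∑ s : Finset (Fin n), (P n (s.piecewise (fun _ => 1) (fun _ => Complex.I))) •
    (ContinuousMultilinearMap.mkPiAlgebra ℂ (Fin n) ℂ).compContinuousLinearMap
      (s.piecewise (fun _ => polRe) (fun _ => polIm))

/-- There are `2^n` subsets and each contributes at most `‖P n‖`, so complexification at worst
halves the radius of convergence. -/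
theorem norm_complexify_le (P : FormalMultilinearSeries ℝ ℂ ℂ) (n : ℕ) :
    ‖complexify P n‖ ≤ 2 ^ n * ‖P n‖ := by
  refine (norm_sum_le _ _).trans ?_
  have : ∀ s ∈ (Finset.univ : Finset (Finset (Fin n))),
      ‖(P n (s.piecewise (fun _ => 1) (fun _ => Complex.I))) •
      (ContinuousMultilinearMap.mkPiAlgebra ℂ (Fin n) ℂ).compContinuousLinearMap
      (s.piecewise (fun _ => polRe) (fun _ => polIm))‖ ≤ ‖P n‖ := by
    intro s _
    rw [norm_smul]
    have h1 : ‖P n (s.piecewise (fun _ => 1) (fun _ => Complex.I))‖ ≤ ‖P n‖ := by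
      refine ((P n).le_opNorm _).trans ?_
      have : ∏ i, ‖(s.piecewise (fun _ => (1 : ℂ)) (fun _ => Complex.I) : Fin n → ℂ) i‖ = 1 := by
        refine Finset.prod_eq_one fun i _ => ?_
        by_cases h : i ∈ s <;> simp [h]
      rw [this, mul_one]
    have h2 : ‖(ContinuousMultilinearMap.mkPiAlgebra ℂ (Fin n) ℂ).compContinuousLinearMap
      (s.piecewise (fun _ => polRe) (fun _ => polIm))‖ ≤ 1 := by
      refine (ContinuousMultilinearMap.norm_compContinuousLinearMap_le _ _).trans ?_
      rw [ContinuousMultilinearMap.norm_mkPiAlgebra, one_mul]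
      refine Finset.prod_le_one (fun i _ => norm_nonneg _) fun i _ => ?_
      by_cases h : i ∈ s
      · simpa [h] using norm_polRe_le
      · simpa [h] using norm_polIm_le
    calc _ ≤ ‖P n‖ * 1 := mul_le_mul h1 h2 (norm_nonneg _) (norm_nonneg _)
      _ = ‖P n‖ := mul_one _
  refine (Finset.sum_le_sum this).trans ?_
  simp

/-- Multilinear expansion of `h = (Re h) 1 + (Im h) i`; on the diagonal the complexified coordinates
take exactly these real values. -/
theorem complexify_diag (P : FormalMultilinearSeries ℝ ℂ ℂ) (n : ℕ) (h : ℂ) :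
    complexify P n (fun _ => (h, conj h)) = P n (fun _ => h) := by
  have e : (fun _ : Fin n => h) = (fun _ => h.re • (1 : ℂ)) + fun _ => h.im • Complex.I := by
    funext i
    simp only [Pi.add_apply, Complex.real_smul, mul_one]
    exact (Complex.re_add_im h).symm
  have := (P n).toMultilinearMap.map_add_univ (fun _ => h.re • (1 : ℂ)) (fun _ => h.im • Complex.I)
  rw [← e] at this
  rw [show P n (fun _ => h) = (P n).toMultilinearMap (fun _ => h) from rfl, this, complexify,
    sum_apply]
  refine Finset.sum_congr rfl fun s _ => ?_
  have e2 : (s.piecewise (fun _ => h.re • (1 : ℂ)) (fun _ => h.im • Complex.I) : Fin n → ℂ) =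
      fun i => (s.piecewise (fun _ => h.re) (fun _ => h.im) : Fin n → ℝ) i •
        (s.piecewise (fun _ => 1) (fun _ => Complex.I) : Fin n → ℂ) i := by
    funext i
    by_cases hi : i ∈ s <;> simp [hi]
  rw [e2, MultilinearMap.map_smul_univ]
  simp only [smul_apply, smul_eq_mul,
    ContinuousMultilinearMap.compContinuousLinearMap_apply,
    ContinuousMultilinearMap.mkPiAlgebra_apply, Complex.real_smul, Complex.ofReal_prod]
  rw [mul_comm]
  congr 1
  refine Finset.prod_congr rfl fun i _ => ?_
  by_cases hi : i ∈ s
  · simp [hi, polRe_diag]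
  · simp [hi, polIm_diag]

theorem exists_local_polarization {f : ℂ → ℂ} {p : ℂ} (hf : AnalyticAt ℝ f p) :
    ∃ r > 0, ∃ F : ℂ × ℂ → ℂ, DifferentiableOn ℂ F (Metric.ball (p, conj p) r) ∧
      ∀ z ∈ Metric.ball p r, F (z, conj z) = f z := by
  obtain ⟨P, R, hP⟩ := hf
  obtain ⟨r, hr0, hr⟩ := ENNReal.lt_iff_exists_nnreal_btwn.1 hP.r_pos
  have hr0' : 0 < r := by exact_mod_cast hr0
  obtain ⟨C, hC0, hC⟩ := P.norm_mul_pow_le_of_lt_radius (hr.trans_le hP.r_le)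
  have hQ : ((r / 2 : NNReal) : ℝ≥0∞) ≤ (complexify P).radius := by
    refine FormalMultilinearSeries.le_radius_of_bound _ C fun n => ?_
    calc ‖complexify P n‖ * ((r / 2 : NNReal) : ℝ) ^ n ≤
        2 ^ n * ‖P n‖ * ((r / 2 : NNReal) : ℝ) ^ n := by
          gcongr; exact norm_complexify_le P n
      _ = ‖P n‖ * (r : ℝ) ^ n := by
          push_cast; rw [div_pow]; field_simp
      _ ≤ C := hC n
  have hQ0 : 0 < ((r / 2 : NNReal) : ℝ≥0∞) := by
    rw [ENNReal.coe_pos]; positivity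
  have hsum := (complexify P).hasFPowerSeriesOnBall (hQ0.trans_le hQ)
  refine ⟨((r / 2 : NNReal) : ℝ), by positivity, fun q => (complexify P).sum (q - (p, conj p)),
    ?_, ?_⟩
  · refine DifferentiableOn.comp (t := Metric.eball 0 (complexify P).radius) hsum.differentiableOn
      (by fun_prop) ?_
    intro q hq
    rw [Metric.mem_eball, edist_zero_right]
    rw [Metric.mem_ball, dist_eq_norm] at hq
    refine lt_of_lt_of_le ?_ hQ
    rw [enorm_eq_nnnorm, ENNReal.coe_lt_coe]
    exact_mod_cast hq
  · intro z hz
    rw [Metric.mem_ball, dist_eq_norm] at hz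
    have hz2 : z - p ∈ Metric.eball (0 : ℂ) R := by
      rw [Metric.mem_eball, edist_zero_right]
      refine lt_trans ?_ hr
      rw [enorm_eq_nnnorm, ENNReal.coe_lt_coe]
      have : ‖z - p‖ < (r : ℝ) := by
        refine hz.trans ?_
        push_cast
        linarith [show (0 : ℝ) < r from hr0']
      exact_mod_cast this
    have h1 := (hP.hasSum hz2).tsum_eq
    rw [add_sub_cancel] at h1
    rw [← h1]
    simp only [FormalMultilinearSeries.sum]
    refine tsum_congr fun n => ?_
    have : ((z, conj z) : ℂ × ℂ) - (p, conj p) = (z - p, conj (z - p)) := by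
      rw [map_sub]; rfl
    rw [this, complexify_diag]

theorem frequently_real_of_eventually {P : ℂ → Prop} (h : ∀ᶠ t : ℝ in 𝓝 0, P t) :
    ∃ᶠ z in 𝓝[≠] (0 : ℂ), P z := by
  have ht : Tendsto (fun t : ℝ => (t : ℂ)) (𝓝[≠] 0) (𝓝[≠] 0) := by
    refine tendsto_nhdsWithin_iff.2 ⟨?_, ?_⟩
    · exact (Complex.continuous_ofReal.tendsto' 0 0 rfl).mono_left nhdsWithin_le_nhds
    · filter_upwards [self_mem_nhdsWithin] with t ht
      simpa using ht
  exact ht.frequently (h.filter_mono nhdsWithin_le_nhds).frequently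

theorem eqOn_zero_of_real {g : ℂ → ℂ} {U : Set ℂ} (hU : IsOpen U) (hc : IsPreconnected U)
    (h0 : (0 : ℂ) ∈ U) (hg : DifferentiableOn ℂ g U) (hr : ∀ᶠ t : ℝ in 𝓝 0, g t = 0) :
    EqOn g 0 U :=
  (hg.analyticOnNhd hU).eqOn_zero_of_preconnected_of_frequently_eq_zero hc h0
    (frequently_real_of_eventually hr)

/-- A holomorphic function on a convex set vanishing on the totally real diagonal vanishes. -/
theorem eqOn_zero_of_diag {H : ℂ × ℂ → ℂ} {B : Set (ℂ × ℂ)} (hB : IsOpen B) (hc : Convex ℝ B)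
    (hH : DifferentiableOn ℂ H B) (hd : ∀ z, (z, conj z) ∈ B → H (z, conj z) = 0) {c : ℂ}
    (hcB : (c, conj c) ∈ B) : EqOn H 0 B := by
  obtain ⟨r, hr, hball⟩ := Metric.isOpen_iff.1 hB _ hcB
  -- Complexified real coordinates about `c`: real `s`, `t` parametrize the diagonal, so the
  -- one-variable identity theorem extends the vanishing first to complex `s`, then to complex `t`.
  set L : ℂ → ℂ → ℂ × ℂ := fun s t => (c + s + Complex.I * t, conj c + s - Complex.I * t) with hL
  have hLB : ∀ s ∈ Metric.ball (0 : ℂ) (r / 2), ∀ t ∈ Metric.ball (0 : ℂ) (r / 2), L s t ∈ B := by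
    intro s hs t ht
    apply hball
    rw [mem_ball_zero_iff] at hs ht
    have hI : ‖Complex.I * t‖ = ‖t‖ := by simp
    rw [← ball_prod_same]
    constructor
    · rw [mem_ball_iff_norm]
      simp only [hL]
      rw [show c + s + Complex.I * t - c = s + Complex.I * t by ring]
      exact (norm_add_le _ _).trans_lt (by linarith)
    · rw [mem_ball_iff_norm]
      simp only [hL]
      rw [show conj c + s - Complex.I * t - conj c = s - Complex.I * t by ring]
      exact (norm_sub_le _ _).trans_lt (by linarith)
  have hLd : ∀ s t : ℝ, L s t = (c + s + Complex.I * t, conj (c + s + Complex.I * t)) := by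
    intro s t
    simp only [hL, map_add, map_mul, Complex.conj_ofReal, Complex.conj_I]
    rw [Prod.mk.injEq]; exact ⟨rfl, by ring⟩
  have h0 : (0 : ℂ) ∈ Metric.ball (0 : ℂ) (r / 2) := Metric.mem_ball_self (by linarith)
  have hpre := (convex_ball (0 : ℂ) (r / 2)).isPreconnected
  have hreal : ∀ᶠ t : ℝ in 𝓝 0, (t : ℂ) ∈ Metric.ball (0 : ℂ) (r / 2) :=
    Complex.continuous_ofReal.continuousAt.eventually_mem
      (Metric.isOpen_ball.mem_nhds (by simpa using h0))
  have step1 : ∀ t : ℝ, (t : ℂ) ∈ Metric.ball (0 : ℂ) (r / 2) →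
      EqOn (fun s => H (L s t)) 0 (Metric.ball (0 : ℂ) (r / 2)) := by
    intro t ht
    refine eqOn_zero_of_real Metric.isOpen_ball hpre h0 ?_ ?_
    · exact hH.comp (f := fun s => L s t) (by simp only [hL]; fun_prop) fun s hs => hLB s hs t ht
    · filter_upwards [hreal] with s hs
      have := hLB s hs t ht
      rw [hLd] at this ⊢
      exact hd _ this
  have step2 : ∀ s ∈ Metric.ball (0 : ℂ) (r / 2),
      EqOn (fun t => H (L s t)) 0 (Metric.ball (0 : ℂ) (r / 2)) := by
    intro s hs
    refine eqOn_zero_of_real Metric.isOpen_ball hpre h0 ?_ ?_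
    · exact hH.comp (f := fun t => L s t) (by simp only [hL]; fun_prop) fun t ht => hLB s hs t ht
    · filter_upwards [hreal] with t ht using step1 t ht hs
  have hloc : ∀ q ∈ Metric.ball ((c, conj c) : ℂ × ℂ) (r / 2), H q = 0 := by
    rintro ⟨a, b⟩ hq
    rw [← ball_prod_same] at hq
    obtain ⟨ha, hb⟩ := hq
    rw [mem_ball_iff_norm] at ha hb
    simp only at ha hb
    have hs : ((a - c) + (b - conj c)) / 2 ∈ Metric.ball (0 : ℂ) (r / 2) := by
      rw [mem_ball_zero_iff, norm_div, Complex.norm_ofNat]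
      linarith [norm_add_le (a - c) (b - conj c)]
    have ht : ((a - c) - (b - conj c)) / (2 * Complex.I) ∈ Metric.ball (0 : ℂ) (r / 2) := by
      rw [mem_ball_zero_iff, norm_div]
      have : ‖(2 * Complex.I : ℂ)‖ = 2 := by simp
      rw [this]
      linarith [norm_sub_le (a - c) (b - conj c)]
    have := step2 _ hs ht
    have e : L (((a - c) + (b - conj c)) / 2) (((a - c) - (b - conj c)) / (2 * Complex.I)) =
        (a, b) := by
      simp only [hL]
      rw [Prod.mk.injEq]
      constructor <;> field_simp <;> ring
    simp only [e] at this
    exact this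
  intro q hq
  -- Passage from the small ball to all of `B` along a complex line; its parameter set is convex,
  -- hence connected.
  set ℓ : ℂ → ℂ × ℂ := fun t => (c, conj c) + t • (q - (c, conj c)) with hℓ
  have hℓc : Continuous ℓ := by simp only [hℓ]; fun_prop
  have hU : IsOpen (ℓ ⁻¹' B) := hB.preimage hℓc
  have hUc : Convex ℝ (ℓ ⁻¹' B) := by
    intro x hx y hy a b ha hb hab
    have : ℓ (a • x + b • y) = a • ℓ x + b • ℓ y := by
      have hb' : (b : ℂ) = 1 - a := by
        have : (a : ℂ) + b = 1 := by exact_mod_cast hab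
        linear_combination this
      ext
      · simp only [hℓ, Prod.fst_add, Prod.smul_fst, Complex.real_smul, smul_eq_mul, Prod.fst_sub]
        rw [hb']; ring
      · simp only [hℓ, Prod.snd_add, Prod.smul_snd, Complex.real_smul, smul_eq_mul, Prod.snd_sub]
        rw [hb']; ring
    simp only [mem_preimage, this]
    exact hc hx hy ha hb hab
  have hz : EqOn (fun t => H (ℓ t)) 0 (ℓ ⁻¹' B) := by
    refine eqOn_zero_of_real hU hUc.isPreconnected (by simpa [hℓ] using hcB) ?_ ?_
    · exact hH.comp (f := ℓ) (by simp only [hℓ]; fun_prop) fun t ht => ht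
    · have : ∀ᶠ t : ℝ in 𝓝 0, ℓ t ∈ Metric.ball ((c, conj c) : ℂ × ℂ) (r / 2) := by
        refine (hℓc.comp Complex.continuous_ofReal).continuousAt.eventually_mem
          (Metric.isOpen_ball.mem_nhds ?_)
        simpa [hℓ] using (by linarith : 0 < r / 2)
      filter_upwards [this] with t ht using hloc _ ht
  have e1 : ℓ 1 = q := by simp [hℓ]
  have := hz (x := 1) (by simpa [e1] using hq)
  simpa [e1] using this

theorem conj_swap_mem_ball {c : ℂ} {r : ℝ} {q : ℂ × ℂ}
    (h : q ∈ Metric.ball ((c, conj c) : ℂ × ℂ) r) :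
    (conj q.2, conj q.1) ∈ Metric.ball ((c, conj c) : ℂ × ℂ) r := by
  rw [← ball_prod_same] at h ⊢
  obtain ⟨h1, h2⟩ := h
  rw [mem_ball_iff_norm] at h1 h2
  refine ⟨?_, ?_⟩
  · rw [mem_ball_iff_norm, ← RCLike.norm_conj]; simpa using h2
  · rw [mem_ball_iff_norm, ← map_sub, RCLike.norm_conj]; exact h1

/-- Local polarizations are glued. An overlap of two balls centred on the diagonal is convex and
invariant under `(z, w) ↦ (conj w, conj z)`; the midpoint of a point and its image lies on the
diagonal, so `eqOn_zero_of_diag` applies to the difference. -/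
theorem exists_polarization {f : ℂ → ℂ} {S : Set ℂ} (hf : ∀ z ∈ S, AnalyticAt ℝ f z) :
    ∃ N : Set (ℂ × ℂ), IsOpen N ∧ (∀ z ∈ S, (z, conj z) ∈ N) ∧ ∃ F : ℂ × ℂ → ℂ,
      DifferentiableOn ℂ F N ∧ ∀ z, (z, conj z) ∈ N → F (z, conj z) = f z := by
  choose! r hr F hF hFf using fun z hz => exists_local_polarization (hf z hz)
  have consist : ∀ z ∈ S, ∀ z' ∈ S, ∀ q, q ∈ Metric.ball ((z, conj z) : ℂ × ℂ) (r z) →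
      q ∈ Metric.ball ((z', conj z') : ℂ × ℂ) (r z') → F z q = F z' q := by
    intro z hz z' hz' q hq hq'
    have hconv := (convex_ball ((z, conj z) : ℂ × ℂ) (r z)).inter
      (convex_ball ((z', conj z') : ℂ × ℂ) (r z'))
    have hmid := hconv.midpoint_mem (x := q) (y := (conj q.2, conj q.1)) ⟨hq, hq'⟩
      ⟨conj_swap_mem_ball hq, conj_swap_mem_ball hq'⟩
    have e : midpoint ℝ q (conj q.2, conj q.1) =
        (midpoint ℝ q.1 (conj q.2), conj (midpoint ℝ q.1 (conj q.2))) := by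
      ext
      · simp [midpoint_eq_smul_add]
      · simp [midpoint_eq_smul_add, add_comm, map_ofNat]
    rw [e] at hmid
    have hz0 := eqOn_zero_of_diag (H := F z - F z') (Metric.isOpen_ball.inter Metric.isOpen_ball)
      hconv (((hF z hz).mono inter_subset_left).sub ((hF z' hz').mono inter_subset_right))
      (fun y hy => by
        have h1 := hFf z hz y (by rw [← ball_prod_same] at hy; exact hy.1.1)
        have h2 := hFf z' hz' y (by
          have := hy.2
          rw [← ball_prod_same] at this; exact this.1)
        simp [h1, h2]) hmid ⟨hq, hq'⟩
    exact sub_eq_zero.1 hz0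
  set N : Set (ℂ × ℂ) := ⋃ z ∈ S, Metric.ball ((z, conj z) : ℂ × ℂ) (r z) with hN
  have hmem : ∀ q ∈ N, ∃ z ∈ S, q ∈ Metric.ball ((z, conj z) : ℂ × ℂ) (r z) := fun q hq => by
    simpa [hN] using hq
  choose! Z hZS hZ using hmem
  have hsub : ∀ z ∈ S, Metric.ball ((z, conj z) : ℂ × ℂ) (r z) ⊆ N := fun z hz =>
    subset_biUnion_of_mem (u := fun z => Metric.ball ((z, conj z) : ℂ × ℂ) (r z)) hz
  refine ⟨N, isOpen_biUnion fun z _ => Metric.isOpen_ball,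
    fun z hz => hsub z hz (Metric.mem_ball_self (hr z hz)), fun q => F (Z q) q, ?_, ?_⟩
  · intro q hq
    have hd := (hF _ (hZS q hq)).differentiableAt (Metric.isOpen_ball.mem_nhds (hZ q hq))
    refine (hd.congr_of_eventuallyEq ?_).differentiableWithinAt
    filter_upwards [Metric.isOpen_ball.mem_nhds (hZ q hq)] with y hy
    have hyN := hsub _ (hZS q hq) hy
    exact consist _ (hZS y hyN) _ (hZS q hq) y (hZ y hyN) hy
  · intro z hz
    refine hFf _ (hZS _ hz) z ?_
    have := hZ _ hz
    rw [← ball_prod_same] at this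
    exact this.1

end BerezinOP
end

noncomputable section
namespace BerezinOP

/-! ### Inverses of injective holomorphic functions -/

theorem nhds_le_map_of_injOn {φ : ℂ → ℂ} {U : Set ℂ} (hU : IsOpen U) (hd : DifferentiableOn ℂ φ U)
    (hi : InjOn φ U) {z : ℂ} (hz : z ∈ U) : 𝓝 (φ z) ≤ map φ (𝓝 z) := by
  refine (AnalyticAt.eventually_constant_or_nhds_le_map_nhds
    (hd.analyticAt (hU.mem_nhds hz))).resolve_left fun h => ?_
  obtain ⟨w, ⟨hw1, hw2⟩, hw3⟩ := ((h.and (hU.mem_nhds hz)).filter_mono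
    (nhdsWithin_le_nhds (s := {z}ᶜ)) |>.and self_mem_nhdsWithin).exists
  exact hw3 (hi hw2 hz hw1)

theorem isOpen_image_of_injOn {φ : ℂ → ℂ} {U : Set ℂ} (hU : IsOpen U) (hd : DifferentiableOn ℂ φ U)
    (hi : InjOn φ U) : IsOpen (φ '' U) := by
  rw [isOpen_iff_mem_nhds]
  rintro _ ⟨z, hz, rfl⟩
  exact nhds_le_map_of_injOn hU hd hi hz (image_mem_map (hU.mem_nhds hz))

theorem invFunOn_image_apply {φ : ℂ → ℂ} {U : Set ℂ} (hi : InjOn φ U) {z : ℂ} (hz : z ∈ U) :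
    Function.invFunOn φ U (φ z) = z :=
  hi.leftInvOn_invFunOn hz

theorem continuousAt_invFunOn {φ : ℂ → ℂ} {U : Set ℂ} (hU : IsOpen U)
    (hd : DifferentiableOn ℂ φ U) (hi : InjOn φ U) {z : ℂ} (hz : z ∈ U) :
    ContinuousAt (Function.invFunOn φ U) (φ z) := by
  rw [ContinuousAt, invFunOn_image_apply hi hz]
  intro N hN
  have h1 : φ '' (N ∩ U) ∈ 𝓝 (φ z) := nhds_le_map_of_injOn hU hd hi hz
    (image_mem_map (inter_mem hN (hU.mem_nhds hz)))
  refine mem_map.2 (mem_of_superset h1 ?_)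
  rintro _ ⟨w, hw, rfl⟩
  simpa [invFunOn_image_apply hi hw.2] using hw.1

theorem eventually_apply_invFunOn {φ : ℂ → ℂ} {U : Set ℂ} (hU : IsOpen U)
    (hd : DifferentiableOn ℂ φ U) (hi : InjOn φ U) {z : ℂ} (hz : z ∈ U) :
    ∀ᶠ ζ in 𝓝 (φ z), φ (Function.invFunOn φ U ζ) = ζ :=
  mem_of_superset ((isOpen_image_of_injOn hU hd hi).mem_nhds (mem_image_of_mem φ hz))
    fun _ h => Function.invFunOn_eq h

/-- That `φ'` has no zeros is not known beforehand. Injectivity makes its zeros isolated; off them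
the local inverse is differentiable, and the exceptional points are removable because the inverse is
continuous. -/
theorem differentiableOn_invFunOn {φ : ℂ → ℂ} {U : Set ℂ} (hU : IsOpen U)
    (hd : DifferentiableOn ℂ φ U) (hi : InjOn φ U) :
    DifferentiableOn ℂ (Function.invFunOn φ U) (φ '' U) := by
  rintro _ ⟨z, hz, rfl⟩
  have hc := continuousAt_invFunOn hU hd hi hz
  refine (Complex.analyticAt_of_differentiable_on_punctured_nhds_of_continuousAt ?_
    hc).differentiableAt.differentiableWithinAt
  have hda : AnalyticAt ℂ (deriv φ) z := (hd.analyticAt (hU.mem_nhds hz)).deriv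
  rcases hda.eventually_eq_zero_or_eventually_ne_zero with h | h
  · exfalso
    obtain ⟨r, hr, hb⟩ := Metric.eventually_nhds_iff_ball.1 (h.and (hU.mem_nhds hz))
    have hconst : ∀ w ∈ Metric.ball z r, φ w = φ z := fun w hw =>
      (convex_ball z r).is_const_of_fderivWithin_eq_zero (𝕜 := ℂ)
        (fun y hy => (hd.differentiableAt (hU.mem_nhds (hb y hy).2)).differentiableWithinAt)
        (fun y hy => by
          rw [fderivWithin_of_isOpen Metric.isOpen_ball hy]
          ext
          simpa using (hb y hy).1) hw (Metric.mem_ball_self hr)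
    have hw : z + ((r / 2 : ℝ) : ℂ) ∈ Metric.ball z r := by
      simp [abs_of_pos hr]
      linarith
    have := hi (hb _ hw).2 hz (hconst _ hw)
    simp at this
    exact hr.ne' this
  · have ht : Tendsto (Function.invFunOn φ U) (𝓝[≠] (φ z)) (𝓝[≠] z) := by
      refine tendsto_nhdsWithin_of_tendsto_nhds_of_eventually_within _ ?_ ?_
      · have := hc.tendsto
        rw [invFunOn_image_apply hi hz] at this
        exact this.mono_left nhdsWithin_le_nhds
      · filter_upwards [self_mem_nhdsWithin, (eventually_apply_invFunOn hU hd hi hz).filter_mono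
          nhdsWithin_le_nhds] with ζ h1 h2 h3
        rw [mem_singleton_iff.1 h3] at h2
        exact h1 h2.symm
    filter_upwards [ht.eventually h, ((isOpen_image_of_injOn hU hd hi).eventually_mem
      (mem_image_of_mem φ hz)).filter_mono nhdsWithin_le_nhds]
      with ζ h1 h2
    obtain ⟨w, hw, rfl⟩ := h2
    rw [invFunOn_image_apply hi hw] at h1
    refine (HasDerivAt.of_local_left_inverse (f' := deriv φ w) (continuousAt_invFunOn hU hd hi hw)
      ?_ h1 (eventually_apply_invFunOn hU hd hi hw)).differentiableAt
    rw [invFunOn_image_apply hi hw]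
    exact (hd.differentiableAt (hU.mem_nhds hw)).hasDerivAt

theorem deriv_invFunOn_mul_deriv {φ : ℂ → ℂ} {U : Set ℂ} (hU : IsOpen U)
    (hd : DifferentiableOn ℂ φ U) (hi : InjOn φ U) {z : ℂ} (hz : z ∈ U) :
    deriv (Function.invFunOn φ U) (φ z) * deriv φ z = 1 := by
  have h1 := ((differentiableOn_invFunOn hU hd hi).differentiableAt
    ((isOpen_image_of_injOn hU hd hi).mem_nhds (mem_image_of_mem φ hz))).hasDerivAt
  have h2 := (hd.differentiableAt (hU.mem_nhds hz)).hasDerivAt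
  refine (h1.comp z h2).unique ?_
  refine (hasDerivAt_id z).congr_of_eventuallyEq ?_
  filter_upwards [hU.mem_nhds hz] with w hw
  simp [invFunOn_image_apply hi hw]

/-! ### The exterior map -/

namespace IsExteriorMap

variable {Ω U : Set ℂ} {φ : ℂ → ℂ} (hφ : IsExteriorMap Ω U φ)
include hφ

theorem subset : Ω ⊆ U := subset_closure.trans hφ.closure_subset

theorem mem_iff {z : ℂ} (hz : z ∈ U) : z ∈ Ω ↔ 1 < ‖φ z‖ := by
  constructor
  · intro h
    have : φ z ∈ {ζ | 1 < ‖ζ‖} := hφ.image ▸ mem_image_of_mem φ h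
    exact this
  · intro h
    obtain ⟨w, hw, he⟩ : φ z ∈ φ '' Ω := by rw [hφ.image]; exact h
    rwa [← hφ.inj (hφ.subset hw) hz he]

theorem isOpen_domain : IsOpen Ω := by
  have : Ω = U ∩ φ ⁻¹' {ζ | 1 < ‖ζ‖} := by
    ext z
    exact ⟨fun h => ⟨hφ.subset h, (hφ.mem_iff (hφ.subset h)).1 h⟩, fun h => (hφ.mem_iff h.1).2 h.2⟩
  rw [this]
  exact hφ.holo.continuousOn.isOpen_inter_preimage hφ.isOpen (isOpen_lt continuous_const continuous_norm)

theorem frontier_subset : frontier Ω ⊆ U := frontier_subset_closure.trans hφ.closure_subset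

theorem one_le_norm {z : ℂ} (hz : z ∈ closure Ω) : 1 ≤ ‖φ z‖ := by
  have hc : ContinuousWithinAt φ Ω z :=
    (hφ.holo.continuousOn.continuousAt (hφ.isOpen.mem_nhds (hφ.closure_subset hz))).continuousWithinAt
  have := hc.mem_closure hz (t := {ζ | 1 ≤ ‖ζ‖}) fun w hw => ((hφ.mem_iff (hφ.subset hw)).1 hw).le
  rwa [(isClosed_le continuous_const continuous_norm).closure_eq] at this

theorem norm_eq_one {z : ℂ} (hz : z ∈ frontier Ω) : ‖φ z‖ = 1 := by
  refine le_antisymm (not_lt.1 fun h => ?_) (hφ.one_le_norm (frontier_subset_closure hz))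
  have := (hφ.mem_iff (hφ.frontier_subset hz)).2 h
  rw [hφ.isOpen_domain.frontier_eq] at hz
  exact hz.2 this

theorem mem_frontier_of_norm {z : ℂ} (hz : z ∈ closure Ω) (h : ‖φ z‖ ≤ 1) : z ∈ frontier Ω := by
  rw [hφ.isOpen_domain.frontier_eq]
  exact ⟨hz, fun h' => absurd ((hφ.mem_iff (hφ.subset h')).1 h') (not_lt.2 h)⟩

/-- Boundedness comes from the linear growth of `φ` at infinity. -/
theorem isCompact_sublevel (R : ℝ) : IsCompact {z ∈ closure Ω | ‖φ z‖ ≤ R} := by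
  have hcl : IsClosed {z ∈ closure Ω | ‖φ z‖ ≤ R} :=
    (hφ.holo.continuousOn.mono hφ.closure_subset).norm.preimage_isClosed_of_isClosed
      isClosed_closure isClosed_Iic
  refine Metric.isCompact_of_isClosed_isBounded hcl ?_
  obtain ⟨c, hc, ht⟩ := hφ.infty
  have h1 : ∀ᶠ z in Bornology.cobounded ℂ, c / 2 < ‖φ z / z‖ := by
    refine ht.norm.eventually_const_lt ?_
    simp [abs_of_pos hc]
    linarith
  have h2 : ∀ᶠ z in Bornology.cobounded ℂ, 2 * |R| / c + 1 < ‖z‖ :=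
    tendsto_norm_cobounded_atTop.eventually_gt_atTop _
  have h3 : {z ∈ closure Ω | ‖φ z‖ ≤ R}ᶜ ∈ Bornology.cobounded ℂ := by
    filter_upwards [h1, h2] with z h1 h2 h
    have hp : 0 < ‖z‖ := by
      have : 0 ≤ 2 * |R| / c := by positivity
      linarith
    rw [norm_div, lt_div_iff₀ hp] at h1
    have : c / 2 * (2 * |R| / c + 1) < c / 2 * ‖z‖ := by gcongr
    have e : c / 2 * (2 * |R| / c + 1) = |R| + c / 2 := by field_simp
    have := le_abs_self R
    have := h.2
    linarith
  simpa using Bornology.isCobounded_def.2 h3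

/-- The points `t ζ` with `1 < t ≤ 2` are images of points of `Ω`. The image of a compact sublevel
set is closed, so it contains the limit at `t = 1`. -/
theorem exists_frontier_of_norm_eq_one {ζ : ℂ} (hζ : ‖ζ‖ = 1) : ∃ z ∈ frontier Ω, φ z = ζ := by
  have hK := (hφ.isCompact_sublevel 2).image_of_continuousOn
    (hφ.holo.continuousOn.mono ((sep_subset _ _).trans hφ.closure_subset))
  have hmem : ζ ∈ φ '' {z ∈ closure Ω | ‖φ z‖ ≤ 2} := by
    have hsub : (fun t : ℝ => (t : ℂ) * ζ) '' Ioc 1 2 ⊆ φ '' {z ∈ closure Ω | ‖φ z‖ ≤ 2} := by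
      rintro _ ⟨t, ht, rfl⟩
      have hn : ‖(t : ℂ) * ζ‖ = t := by
        rw [norm_mul, hζ, mul_one, Complex.norm_real, Real.norm_of_nonneg (by linarith [ht.1])]
      obtain ⟨w, hw, he⟩ : (t : ℂ) * ζ ∈ φ '' Ω := by
        rw [hφ.image]
        exact (by rw [hn]; exact ht.1 : 1 < ‖(t : ℂ) * ζ‖)
      exact ⟨w, ⟨subset_closure hw, by rw [he, hn]; exact ht.2⟩, he⟩
    have h1 : (1 : ℝ) ∈ closure (Ioc (1 : ℝ) 2) := by
      rw [closure_Ioc (by norm_num)]; norm_num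
    have h2 : Continuous fun t : ℝ => (t : ℂ) * ζ := by fun_prop
    have := hK.isClosed.closure_subset_iff.2 hsub
      (image_closure_subset_closure_image h2 (mem_image_of_mem _ h1))
    simpa using this
  obtain ⟨z, hz, rfl⟩ := hmem
  exact ⟨z, hφ.mem_frontier_of_norm hz.1 hζ.le, rfl⟩

/-! ### Uniqueness of the Poisson extension -/

/-- Phragmén–Lindelöf argument: the barrier `ε log|φ|` vanishes on the boundary and reaches `B` once
`|φ| ≥ exp(B/ε)`, which confines a positive maximum of the difference to the interior of a compact
sublevel set. -/
theorem harmonic_nonpos {u : ℂ → ℝ} (hu : InnerProductSpace.HarmonicOnNhd u (closure Ω)) {B : ℝ}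
    (hB : ∀ z ∈ Ω, u z ≤ B) (h0 : ∀ z ∈ frontier Ω, u z = 0) {z : ℂ} (hz : z ∈ Ω) : u z ≤ 0 := by
  have han : ∀ w ∈ closure Ω, AnalyticAt ℂ φ w := fun w hw =>
    hφ.holo.analyticAt (hφ.isOpen.mem_nhds (hφ.closure_subset hw))
  have hne : ∀ w ∈ closure Ω, φ w ≠ 0 := fun w hw h => by
    have := hφ.one_le_norm hw
    rw [h, norm_zero] at this
    linarith
  have key : ∀ ε > 0, u z ≤ ε * Real.log ‖φ z‖ := by
    intro ε hε
    set h : ℂ → ℝ := u + (-ε) • fun w => Real.log ‖φ w‖ with hh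
    have hharm : InnerProductSpace.HarmonicOnNhd h (closure Ω) :=
      hu.add fun w hw => ((han w hw).harmonicAt_log_norm (hne w hw)).const_smul
    have hval : ∀ w, h w = u w - ε * Real.log ‖φ w‖ := fun w => by simp [hh]; ring
    by_contra! hcon
    have hpos : 0 < h z := by rw [hval]; linarith
    set R : ℝ := max ‖φ z‖ (Real.exp (B / ε)) with hR
    set K := {w ∈ closure Ω | ‖φ w‖ ≤ R}
    have hK : IsCompact K := hφ.isCompact_sublevel R
    have hzK : z ∈ K := ⟨subset_closure hz, le_max_left _ _⟩
    have hcont : ContinuousOn h K := hharm.continuousOn.mono (sep_subset _ _)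
    obtain ⟨w₀, hw₀K, hw₀⟩ := hK.exists_isMaxOn ⟨z, hzK⟩ hcont
    -- Among all maximum points one with the largest real part is taken. By the strong maximum
    -- principle `h` is constant near it, which produces a maximum point farther to the right; no
    -- connectedness is needed.
    set K' := K ∩ h ⁻¹' {h w₀} with hK'
    have hK'c : IsCompact K' := by
      refine hK.of_isClosed_subset ?_ inter_subset_left
      exact hcont.preimage_isClosed_of_isClosed hK.isClosed isClosed_singleton
    obtain ⟨w, hwK', hw⟩ := hK'c.exists_isMaxOn ⟨w₀, hw₀K, rfl⟩ Complex.continuous_re.continuousOn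
    have hwmax : ∀ y ∈ K, h y ≤ h w := fun y hy => by
      have e : h w = h w₀ := hwK'.2
      rw [e]; exact hw₀ hy
    have hwpos : 0 < h w := hpos.trans_le (hwmax z hzK)
    have hwΩ : w ∈ Ω := by
      by_contra hn
      have hf : w ∈ frontier Ω := by
        rw [hφ.isOpen_domain.frontier_eq]; exact ⟨hwK'.1.1, hn⟩
      rw [hval, h0 w hf, hφ.norm_eq_one hf] at hwpos
      simp at hwpos
    have hwR : ‖φ w‖ < R := by
      refine lt_of_le_of_ne hwK'.1.2 fun e => ?_
      have h1 : B / ε ≤ Real.log R := by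
        rw [Real.le_log_iff_exp_le ((Real.exp_pos _).trans_le (le_max_right _ _))]
        exact le_max_right _ _
      rw [div_le_iff₀ hε] at h1
      rw [hval, e] at hwpos
      linarith [hB w hwΩ]
    have hnhds : K ∈ 𝓝 w := by
      have h1 : ∀ᶠ y in 𝓝 w, ‖φ y‖ < R :=
        ((han w hwK'.1.1).continuousAt.norm).eventually_lt_const hwR
      filter_upwards [h1, hφ.isOpen_domain.mem_nhds hwΩ] with y h1 h2
      exact ⟨subset_closure h2, h1.le⟩
    obtain ⟨r, hr, hb⟩ := Metric.mem_nhds_iff.1 hnhds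
    obtain ⟨F, hF, hFe⟩ := InnerProductSpace.HarmonicOnNhd.exists_analyticOnNhd_ball_re_eq
      (hharm.mono ((hb.trans (sep_subset _ _))) : InnerProductSpace.HarmonicOnNhd h (Metric.ball w r))
    have hloc : IsLocalMax (norm ∘ fun y => Complex.exp (F y)) w := by
      filter_upwards [Metric.ball_mem_nhds w hr] with y hy
      have e1 : (F y).re = h y := hFe hy
      have e2 : (F w).re = h w := hFe (Metric.mem_ball_self hr)
      simp only [Function.comp, Complex.norm_exp, e1, e2, Real.exp_le_exp]
      exact hwmax y (hb hy)
    have hev := Complex.norm_eventually_eq_of_isLocalMax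
      (f := fun y => Complex.exp (F y)) (by
        filter_upwards [Metric.ball_mem_nhds w hr] with y hy
        exact (hF y hy).differentiableAt.cexp) hloc
    obtain ⟨r', hr', hb'⟩ := Metric.eventually_nhds_iff_ball.1 (hev.and (Metric.ball_mem_nhds w hr))
    have hy : w + ((r' / 2 : ℝ) : ℂ) ∈ Metric.ball w r' := by
      simp [abs_of_pos hr']
      linarith
    have hy2 := (hb' _ hy).1
    have e1 := hFe (hb' _ hy).2
    have e2 := hFe (Metric.mem_ball_self hr)
    simp only [Complex.norm_exp, Real.exp_eq_exp] at hy2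
    have hyK' : w + ((r' / 2 : ℝ) : ℂ) ∈ K' := by
      refine ⟨hb (hb' _ hy).2, ?_⟩
      have e3 : h w = h w₀ := hwK'.2
      simp only at e1 e2
      simp only [mem_preimage, mem_singleton_iff]
      rw [← e1, hy2, e2, e3]
    have := hw hyK'
    simp at this
    linarith
  have hlog : 0 ≤ Real.log ‖φ z‖ := Real.log_nonneg (hφ.one_le_norm (subset_closure hz))
  refine le_of_forall_pos_le_add fun ε hε => ?_
  have := key (ε / (Real.log ‖φ z‖ + 1)) (by positivity)
  rw [div_mul_eq_mul_div, ] at this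
  have : ε * Real.log ‖φ z‖ / (Real.log ‖φ z‖ + 1) ≤ ε := by
    rw [div_le_iff₀ (by positivity)]
    nlinarith
  linarith

/-- Vanishing on `Ω` passes across the boundary because harmonic functions are real-analytic and
every ball about a boundary point meets `Ω`. -/
theorem harmonic_eventuallyEq_zero {u : ℂ → ℝ}
    (hu : InnerProductSpace.HarmonicOnNhd u (closure Ω)) {B : ℝ}
    (hB : ∀ z ∈ Ω, |u z| ≤ B) (h0 : ∀ z ∈ frontier Ω, u z = 0) : u =ᶠ[𝓝ˢ (closure Ω)] 0 := by
  have hzero : ∀ z ∈ Ω, u z = 0 := fun z hz => by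
    refine le_antisymm (hφ.harmonic_nonpos hu (fun w hw => (le_abs_self _).trans (hB w hw)) h0 hz) ?_
    have := hφ.harmonic_nonpos (u := -u) hu.neg (fun w hw => (neg_le_abs _).trans (hB w hw))
      (fun w hw => by simp [h0 w hw]) hz
    simpa using this
  refine eventually_nhdsSet_iff_forall.2 fun z hz => ?_
  obtain ⟨r, hr, hb⟩ := Metric.eventually_nhds_iff_ball.1 (hu z hz).eventually
  obtain ⟨w, hw1, hw2⟩ := mem_closure_iff_nhds.1 hz _ (Metric.ball_mem_nhds z hr)
  have := AnalyticOnNhd.eqOn_of_preconnected_of_eventuallyEq (𝕜 := ℝ) (f := u) (g := 0)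
    (U := Metric.ball z r) (z₀ := w) (fun y hy => HarmonicAt.analyticAt (hb y hy)) analyticOnNhd_const
    (convex_ball z r).isPreconnected hw1 (by
      filter_upwards [hφ.isOpen_domain.mem_nhds hw2] with y hy using hzero y hy)
  filter_upwards [Metric.ball_mem_nhds z hr] with y hy using this hy

theorem poissonExtension_unique {f u v : ℂ → ℂ} (hu : IsPoissonExtension Ω f u)
    (hv : IsPoissonExtension Ω f v) : u =ᶠ[𝓝ˢ (closure Ω)] v := by
  obtain ⟨Bu, hBu⟩ := hu.2.1.exists_norm_le
  obtain ⟨Bv, hBv⟩ := hv.2.1.exists_norm_le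
  have hd := hu.1.sub hv.1
  have hbd : ∀ z ∈ Ω, ‖(u - v) z‖ ≤ Bu + Bv := fun z hz =>
    (norm_sub_le _ _).trans (add_le_add (hBu _ (mem_image_of_mem u hz)) (hBv _ (mem_image_of_mem v hz)))
  have hfr : ∀ z ∈ frontier Ω, (u - v) z = 0 := fun z hz => by
    simp [hu.2.2 hz, hv.2.2 hz]
  have h1 := hφ.harmonic_eventuallyEq_zero (hd.comp_CLM Complex.reCLM)
    (fun z hz => (Complex.abs_re_le_norm _).trans (hbd z hz)) (fun z hz => by simp [hfr z hz])
  have h2 := hφ.harmonic_eventuallyEq_zero (hd.comp_CLM Complex.imCLM)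
    (fun z hz => (Complex.abs_im_le_norm _).trans (hbd z hz)) (fun z hz => by simp [hfr z hz])
  filter_upwards [h1, h2] with z h1 h2
  refine sub_eq_zero.1 (Complex.ext ?_ ?_)
  · simpa using h1
  · simpa using h2

theorem poisson_eventuallyEq_of_isPoissonExtension {f u : ℂ → ℂ} (hu : IsPoissonExtension Ω f u) :
    poisson Ω f =ᶠ[𝓝ˢ (closure Ω)] u := by
  have h : ∃ u, IsPoissonExtension Ω f u := ⟨u, hu⟩
  rw [poisson, dif_pos h]
  exact hφ.poissonExtension_unique h.choose_spec hu

end IsExteriorMap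

/-! ### Pullbacks of polarized functions -/

/-- The function near `Γ` with polarization `F`. -/
def pull (φ : ℂ → ℂ) (F : ℂ × ℂ → ℂ) (z : ℂ) : ℂ := F (φ z, conj (φ z))

/-- The unit circle, embedded in the antidiagonal. -/
def unitDiag : Set (ℂ × ℂ) := {p | ‖p.1‖ = 1 ∧ p.2 = conj p.1}

theorem mul_eq_one_of_mem_unitDiag {p : ℂ × ℂ} (hp : p ∈ unitDiag) : p.1 * p.2 = 1 := by
  rw [hp.2, Complex.mul_conj, Complex.normSq_eq_norm_sq, hp.1]; simp

theorem isCompact_unitDiag : IsCompact unitDiag := by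
  have : unitDiag = (fun z : ℂ => (z, conj z)) '' Metric.sphere 0 1 := by
    ext ⟨a, b⟩
    constructor
    · rintro ⟨h1, h2⟩
      exact ⟨a, by simpa using h1, by simp only at h2; simp [h2]⟩
    · rintro ⟨z, hz, h⟩
      obtain ⟨rfl, rfl⟩ := Prod.mk.inj h
      exact ⟨by simpa using hz, rfl⟩
  rw [this]
  exact (isCompact_sphere 0 1).image (by fun_prop)

theorem unitDiag_subset_Dom {σ : ℝ} (hσ : 0 < σ) : unitDiag ⊆ Dom σ := fun p hp => by
  have h1 := rho_lt_one hσ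
  have h2 : 1 < (rho σ)⁻¹ := (one_lt_inv₀ (rho_pos σ)).2 h1
  rw [Dom, mem_ofPred_eq, hp.2]
  simp [fatAnnulus, hp.1, h1, h2, hσ]

theorem Dom_mem_nhdsSet {σ : ℝ} (hσ : 0 < σ) : Dom σ ∈ 𝓝ˢ unitDiag :=
  (isOpen_Dom σ).mem_nhdsSet.2 (unitDiag_subset_Dom hσ)

/-- The domains `Dom σ` shrink to the unit circle. -/
theorem exists_Dom_subset {N : Set (ℂ × ℂ)} (hN : N ∈ 𝓝ˢ unitDiag) :
    ∃ σ₁ : ℝ, 0 < σ₁ ∧ σ₁ ≤ 1 ∧ Dom σ₁ ⊆ N := by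
  obtain ⟨V, hVo, hV, hVN⟩ := mem_nhdsSet_iff_exists.1 hN
  obtain ⟨δ, hδ, hth⟩ := isCompact_unitDiag.exists_thickening_subset_open hVo hV
  refine ⟨min 1 (δ / 6), by positivity, min_le_left _ _, fun p hp => hVN (hth ?_)⟩
  set σ := min 1 (δ / 6)
  have hσ : 0 < σ := by positivity
  have hσ1 : σ ≤ δ / 6 := min_le_right _ _
  obtain ⟨⟨h1, h2⟩, -, h3⟩ := hp
  simp only at h1 h2 h3
  have hne : p.1 ≠ 0 := norm_pos_iff.1 ((rho_pos σ).trans h1)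
  have hr1 := one_sub_le_rho σ
  have hr2 := rho_inv_le hσ.le
  have hnp := norm_pos_iff.2 hne
  set ζ : ℂ := p.1 / (‖p.1‖ : ℂ) with hζ
  have hζ1 : ‖ζ‖ = 1 := by
    rw [hζ, norm_div, Complex.norm_real, norm_norm, div_self hnp.ne']
  have hd : ‖p.1 - ζ‖ ≤ 2 * σ := by
    have e : p.1 - ζ = ((‖p.1‖ - 1 : ℝ) : ℂ) * ζ := by
      rw [hζ]; push_cast
      have : (‖p.1‖ : ℂ) ≠ 0 := by exact_mod_cast hnp.ne'
      field_simp
    rw [e, norm_mul, hζ1, mul_one, Complex.norm_real, Real.norm_eq_abs, abs_le]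
    constructor <;> linarith
  rw [Metric.mem_thickening_iff]
  refine ⟨(ζ, conj ζ), ⟨hζ1, rfl⟩, ?_⟩
  rw [Prod.dist_eq, max_lt_iff, dist_eq_norm, dist_eq_norm]
  refine ⟨by simp only; linarith, ?_⟩
  have e : p.2 - conj ζ = conj (p.1 - ζ) - conj (p.1 - conj p.2) := by simp
  simp only
  rw [e]
  refine (norm_sub_le _ _).trans_lt ?_
  rw [Complex.norm_conj, Complex.norm_conj]
  linarith

namespace IsExteriorMap

variable {Ω U : Set ℂ} {φ : ℂ → ℂ} (hφ : IsExteriorMap Ω U φ)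
include hφ

theorem continuousAt {z : ℂ} (hz : z ∈ frontier Ω) : ContinuousAt φ z :=
  hφ.holo.continuousOn.continuousAt (hφ.isOpen.mem_nhds (hφ.frontier_subset hz))

theorem pair_mem_unitDiag {z : ℂ} (hz : z ∈ frontier Ω) : (φ z, conj (φ z)) ∈ unitDiag :=
  ⟨hφ.norm_eq_one hz, rfl⟩

theorem tendsto_pair : Tendsto (fun z => (φ z, conj (φ z))) (𝓝ˢ (frontier Ω)) (𝓝ˢ unitDiag) := by
  intro N hN
  refine mem_nhdsSet_iff_forall.2 fun z hz => ?_
  have h : ContinuousAt (fun z => (φ z, conj (φ z))) z :=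
    (hφ.continuousAt hz).prodMk (Complex.continuous_conj.continuousAt.comp (hφ.continuousAt hz))
  exact h.tendsto (nhds_le_nhdsSet (hφ.pair_mem_unitDiag hz) hN)

theorem eventually_mem_Dom {σ : ℝ} (hσ : 0 < σ) :
    ∀ᶠ z in 𝓝ˢ (frontier Ω), (φ z, conj (φ z)) ∈ Dom σ :=
  hφ.tendsto_pair.eventually (Dom_mem_nhdsSet hσ)

theorem frontier_eventually_mem : ∀ᶠ z in 𝓝ˢ (frontier Ω), z ∈ U :=
  hφ.isOpen.mem_nhdsSet.2 hφ.frontier_subset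

/-- One Cauchy integral is antiholomorphic in the point and the other holomorphic, hence both are
harmonic. They are bounded because `|φ| ≥ 1` keeps away from the poles, and the boundary values
follow from `projC_sub_self`, as `z w = 1` on the circle. -/
theorem isPoissonExtension_projC {s σ : ℝ} {F : ℂ × ℂ → ℂ} {f : ℂ → ℂ} (h0 : 0 < s) (hs : s < σ)
    (hF : DifferentiableOn ℂ F (Dom σ)) (hf : ∀ z ∈ frontier Ω, f z = pull φ F z) :
    IsPoissonExtension Ω f (pull φ (projC s F)) := by
  have hr0 := rho_pos s
  have hr1 := rho_lt_one h0
  have hR1 : 1 < (rho s)⁻¹ := (one_lt_inv₀ hr0).2 hr1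
  have ho := differentiableOn_cauchyInt (inv_pos.2 hr0) (continuousAt_bdry_outer h0 hs hF)
  have hi := differentiableOn_cauchyInt hr0 (continuousAt_bdry_inner h0 hs hF)
  have hopen : ∀ r : ℝ, IsOpen {z : ℂ | ‖z‖ ≠ r} := fun r =>
    isOpen_ne_fun continuous_norm continuous_const
  have hne : ∀ w ∈ closure Ω, φ w ≠ 0 := fun w hw h => by
    have := hφ.one_le_norm hw
    rw [h, norm_zero] at this
    linarith
  have hinv : ∀ w ∈ closure Ω, ‖(φ w)⁻¹‖ ≤ 1 := fun w hw => by
    rw [norm_inv]; exact inv_le_one_of_one_le₀ (hφ.one_le_norm hw)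
  refine ⟨fun z hz => ?_, ?_, fun z hz => ?_⟩
  · have han : DifferentiableOn ℂ φ U := hφ.holo
    have hN : ∀ᶠ w in 𝓝 z, w ∈ U ∧ φ w ≠ 0 ∧ ‖φ w‖ ≠ rho s ∧ ‖(φ w)⁻¹‖ ≠ (rho s)⁻¹ := by
      have hc : ContinuousAt φ z := han.continuousOn.continuousAt
        (hφ.isOpen.mem_nhds (hφ.closure_subset hz))
      have := hφ.one_le_norm hz
      refine (hφ.isOpen.eventually_mem (hφ.closure_subset hz)).and
        ((hc.eventually_ne (hne z hz)).and ?_)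
      refine (hc.norm.eventually_ne (by linarith)).and ?_
      exact (hc.inv₀ (hne z hz)).norm.eventually_ne ((hinv z hz).trans_lt hR1).ne
    obtain ⟨N, hNz, hNo, hzN⟩ := eventually_nhds_iff.1 hN
    have hA1 : DifferentiableOn ℂ (fun w => cauchyInt (rho s) (bdry F) (φ w)) N := fun w hw => by
      obtain ⟨h1, h2, h3, h4⟩ := hNz w hw
      exact ((hi.differentiableAt ((hopen _).mem_nhds h3)).comp w
        (han.differentiableAt (hφ.isOpen.mem_nhds h1))).differentiableWithinAt
    have hA2 : DifferentiableOn ℂ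
        (fun w => conj (cauchyInt (rho s)⁻¹ (bdry F) (conj (φ w)⁻¹))) N := fun w hw => by
      obtain ⟨h1, h2, h3, h4⟩ := hNz w hw
      have hG : DifferentiableAt ℂ (conj ∘ (cauchyInt (rho s)⁻¹ (bdry F)) ∘ conj) (φ w)⁻¹ := by
        have := (ho.differentiableAt ((hopen _).mem_nhds
          (by simpa using h4 : conj (φ w)⁻¹ ∈ {z : ℂ | ‖z‖ ≠ (rho s)⁻¹}))).conj_conj
        simpa using this
      exact (hG.comp w ((han.differentiableAt (hφ.isOpen.mem_nhds h1)).fun_inv h2)).differentiableWithinAt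
    have hH1 := (hA1.analyticAt (hNo.mem_nhds hzN)).harmonicAt
    have hH2 := (hA2.analyticAt (hNo.mem_nhds hzN)).harmonicAt_conj
    have := hH2.sub hH1
    refine (InnerProductSpace.harmonicAt_congr_nhds (Eventually.of_forall fun w => ?_)).1 this
    simp [pull, projC]
  · obtain ⟨B₁, hB₁⟩ := (isCompact_sphere (0 : ℂ) (rho s)⁻¹).exists_bound_of_continuousOn
      (f := bdry F) (fun ζ hζ => (continuousAt_bdry_outer h0 hs hF ζ (by simpa using hζ)).continuousWithinAt)
    obtain ⟨B₂, hB₂⟩ := (isCompact_sphere (0 : ℂ) (rho s)).exists_bound_of_continuousOn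
      (f := bdry F) (fun ζ hζ => (continuousAt_bdry_inner h0 hs hF ζ (by simpa using hζ)).continuousWithinAt)
    rw [isBounded_iff_forall_norm_le]
    refine ⟨(rho s)⁻¹ * |B₁| / ((rho s)⁻¹ - 1) + rho s * |B₂| / (1 - rho s), ?_⟩
    rintro _ ⟨z, hz, rfl⟩
    have hz' := subset_closure hz
    refine (norm_sub_le _ _).trans (add_le_add ?_ ?_)
    · refine norm_cauchyInt_le (inv_pos.2 hr0) (by linarith) (abs_nonneg _)
        (continuousAt_bdry_outer h0 hs hF) (fun ζ hζ => (hB₁ ζ (by simpa using hζ)).trans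
          (le_abs_self _)) ?_
      refine le_trans ?_ (le_abs_self _)
      have := hinv z hz'
      simp only [norm_inv, Complex.norm_conj] at this ⊢
      linarith
    · refine norm_cauchyInt_le hr0 (by linarith) (abs_nonneg _)
        (continuousAt_bdry_inner h0 hs hF) (fun ζ hζ => (hB₂ ζ (by simpa using hζ)).trans
          (le_abs_self _)) ?_
      rw [abs_sub_comm]
      refine le_trans ?_ (le_abs_self _)
      have := hφ.one_le_norm hz'
      simp only
      linarith
  · have hp := hφ.pair_mem_unitDiag hz
    have h1 := projC_sub_self h0 hs hF (unitDiag_subset_Dom h0 hp)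
    rw [mul_eq_one_of_mem_unitDiag hp, sub_self, zero_mul, sub_eq_zero] at h1
    rw [hf z hz]
    exact h1

/-- `poisson` is defined by choice; uniqueness of the extension identifies its germ along the curve.
-/
theorem poisson_eventuallyEq {σ : ℝ} {F : ℂ × ℂ → ℂ} {f : ℂ → ℂ} (hσ : 0 < σ)
    (hF : DifferentiableOn ℂ F (Dom σ)) (hf : ∀ z ∈ frontier Ω, f z = pull φ F z) :
    poisson Ω f =ᶠ[𝓝ˢ (frontier Ω)] pull φ (proj F) := by
  have h := (hφ.poisson_eventuallyEq_of_isPoissonExtension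
    (hφ.isPoissonExtension_projC (half_pos hσ) (half_lt_self hσ) hF hf)).filter_mono
    (nhdsSet_mono frontier_subset_closure)
  filter_upwards [h, hφ.eventually_mem_Dom (half_pos hσ)] with z h1 h2
  rw [h1]
  exact ((proj_eq_projC_and_quot_eq_quotC (half_pos hσ) (half_lt_self hσ) hF h2).1).symm

end IsExteriorMap

end BerezinOP
end

noncomputable section
namespace BerezinOP

/-! ### Wirtinger derivatives of germs -/

theorem dz_congr {f g : ℂ → ℂ} {S : Set ℂ} (h : f =ᶠ[𝓝ˢ S] g) : dz f =ᶠ[𝓝ˢ S] dz g := by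
  filter_upwards [h.eventually_nhdsSet] with z hz
  rw [dz, dz, EventuallyEq.fderiv_eq hz]

theorem dzbar_congr {f g : ℂ → ℂ} {S : Set ℂ} (h : f =ᶠ[𝓝ˢ S] g) : dzbar f =ᶠ[𝓝ˢ S] dzbar g := by
  filter_upwards [h.eventually_nhdsSet] with z hz
  rw [dzbar, dzbar, EventuallyEq.fderiv_eq hz]

theorem conj_dz_toC (V : ℂ → ℝ) (z : ℂ) : conj (dz (toC V) z) = dzbar (toC V) z := by
  have h : ∀ w, conj (fderiv ℝ (toC V) z w) = fderiv ℝ (toC V) z w := fun w => by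
    have e : (fun x => star (toC V x)) = toC V := by
      funext x; exact Complex.conj_ofReal _
    have := congrArg (fun L : ℂ →L[ℝ] ℂ => L w) (fderiv_star (𝕜 := ℝ) (f := toC V) (x := z))
    rw [e] at this
    exact this.symm
  simp [dz, dzbar, h, Complex.conj_ofNat]

/-- A squared modulus becomes a product of two factors, each of which has a polarization. -/
theorem gradSq_eq (V : ℂ → ℝ) (z : ℂ) : gradSq V z = dz (toC V) z * dzbar (toC V) z := by
  rw [← conj_dz_toC, Complex.mul_conj, Complex.normSq_eq_norm_sq, gradSq]

/-- Since `φ` is holomorphic, `∂` sees only the first slot and `∂̄` only the second. -/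
theorem dz_dzbar_pull {φ : ℂ → ℂ} {F : ℂ × ℂ → ℂ} {z : ℂ} (hφ : DifferentiableAt ℂ φ z)
    (hF : DifferentiableAt ℂ F (φ z, conj (φ z))) :
    dz (pull φ F) z = deriv φ z * pull φ (pd1 F) z ∧
      dzbar (pull φ F) z = conj (deriv φ z) * pull φ (pd2 F) z := by
  set F' := fderiv ℂ F (φ z, conj (φ z)) with hF'
  have hF0 : HasFDerivAt F F' (φ z, conj (φ z)) := hF.hasFDerivAt
  have h1 : pull φ (pd1 F) z = F' (1, 0) := by
    have := (show HasFDerivAt F F' ((fun x => (x, conj (φ z))) (φ z)) from hF0).comp_hasDerivAt (φ z)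
      ((hasDerivAt_id (φ z)).prodMk (hasDerivAt_const (φ z) (conj (φ z))))
    exact this.deriv
  have h2 : pull φ (pd2 F) z = F' (0, 1) := by
    have := (show HasFDerivAt F F' ((fun x => (φ z, x)) (conj (φ z))) from hF0).comp_hasDerivAt
      (conj (φ z)) ((hasDerivAt_const (conj (φ z)) (φ z)).prodMk (hasDerivAt_id (conj (φ z))))
    exact this.deriv
  have hφ' := hφ.hasDerivAt.hasFDerivAt.restrictScalars ℝ
  have hg := hφ'.prodMk ((Complex.conjCLE.toContinuousLinearMap.hasFDerivAt (x := φ z)).comp z hφ')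
  have hfd := ((show HasFDerivAt F F' ((fun x => (φ x, conj (φ x))) z) from hF0).restrictScalars
    ℝ).comp z hg
  have hfd' := hfd.fderiv
  have hlin : ∀ a b : ℂ, F' (a, b) = a * F' (1, 0) + b * F' (0, 1) := fun a b => by
    have : ((a, b) : ℂ × ℂ) = a • ((1, 0) : ℂ × ℂ) + b • ((0, 1) : ℂ × ℂ) := by simp
    rw [this, map_add, map_smul, map_smul, smul_eq_mul, smul_eq_mul]
  have hD : ∀ w, fderiv ℝ (pull φ F) z w =
      w * deriv φ z * F' (1, 0) + conj (w * deriv φ z) * F' (0, 1) := fun w => by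
    rw [← hlin]
    exact congrArg (fun L : ℂ →L[ℝ] ℂ => L w) hfd'
  rw [dz, dzbar, hD, hD, h1, h2]
  simp only [map_mul, Complex.conj_I, one_mul]
  constructor
  · linear_combination (-1 / 2 * deriv φ z * F' (1, 0) +
      1 / 2 * conj (deriv φ z) * F' (0, 1)) * Complex.I_sq
  · linear_combination (1 / 2 * deriv φ z * F' (1, 0) -
      1 / 2 * conj (deriv φ z) * F' (0, 1)) * Complex.I_sq

namespace IsExteriorMap

variable {Ω U : Set ℂ} {φ : ℂ → ℂ} (hφ : IsExteriorMap Ω U φ) {a₁ a₂ : ℂ × ℂ → ℂ}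
include hφ

theorem dz_eventuallyEq (ha₁ : pull φ a₁ =ᶠ[𝓝ˢ (frontier Ω)] deriv φ) {f : ℂ → ℂ}
    {F : ℂ × ℂ → ℂ} {σ : ℝ} (hσ : 0 < σ) (hF : DifferentiableOn ℂ F (Dom σ))
    (hf : f =ᶠ[𝓝ˢ (frontier Ω)] pull φ F) : dz f =ᶠ[𝓝ˢ (frontier Ω)] pull φ (a₁ * pd1 F) := by
  filter_upwards [dz_congr hf, ha₁, hφ.frontier_eventually_mem, hφ.eventually_mem_Dom hσ]
    with z h1 h2 h3 h4
  rw [h1, (dz_dzbar_pull (hφ.holo.differentiableAt (hφ.isOpen.mem_nhds h3))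
    (hF.differentiableAt ((isOpen_Dom σ).mem_nhds h4))).1, ← h2]
  rfl

theorem dzbar_eventuallyEq (ha₂ : pull φ a₂ =ᶠ[𝓝ˢ (frontier Ω)] fun z => conj (deriv φ z))
    {f : ℂ → ℂ} {F : ℂ × ℂ → ℂ} {σ : ℝ} (hσ : 0 < σ) (hF : DifferentiableOn ℂ F (Dom σ))
    (hf : f =ᶠ[𝓝ˢ (frontier Ω)] pull φ F) : dzbar f =ᶠ[𝓝ˢ (frontier Ω)] pull φ (a₂ * pd2 F) := by
  filter_upwards [dzbar_congr hf, ha₂, hφ.frontier_eventually_mem, hφ.eventually_mem_Dom hσ]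
    with z h1 h2 h3 h4
  rw [h1, (dz_dzbar_pull (hφ.holo.differentiableAt (hφ.isOpen.mem_nhds h3))
    (hF.differentiableAt ((isOpen_Dom σ).mem_nhds h4))).2, ← h2]
  rfl

theorem qLap_eventuallyEq (ha₁ : pull φ a₁ =ᶠ[𝓝ˢ (frontier Ω)] deriv φ)
    (ha₂ : pull φ a₂ =ᶠ[𝓝ˢ (frontier Ω)] fun z => conj (deriv φ z))
    {f : ℂ → ℂ} {F : ℂ × ℂ → ℂ} {σ : ℝ} (hσ : 0 < σ) (hda : DifferentiableOn ℂ a₂ (Dom σ))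
    (hF : DifferentiableOn ℂ F (Dom σ)) (hf : f =ᶠ[𝓝ˢ (frontier Ω)] pull φ F) :
    qLap f =ᶠ[𝓝ˢ (frontier Ω)] pull φ (a₁ * pd1 (a₂ * pd2 F)) :=
  hφ.dz_eventuallyEq ha₁ hσ (hda.mul (differentiableOn_pd2 (isOpen_Dom σ) hF))
    (hφ.dzbar_eventuallyEq ha₂ hσ hF hf)

end IsExteriorMap

/-! ### The coefficients of the polarized operators -/

/-- The polarized defining function `v = (z w - 1) k`. -/
def polV (k : ℂ × ℂ → ℂ) (p : ℂ × ℂ) : ℂ := (p.1 * p.2 - 1) * k p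

/-- The polarization of `log |φ| / V`. -/
def polLog (k : ℂ × ℂ → ℂ) (p : ℂ × ℂ) : ℂ := 1 / 2 * dslope Complex.log 1 (p.1 * p.2) * (k p)⁻¹

/-- The coefficients of the polarized operators in terms of the polarizations `a₁, a₂` of `φ'` and
its conjugate, and of `k`. -/
def coefs (a₁ a₂ k : ℂ × ℂ → ℂ) : PolCoef where
  c₁ := a₂ * pd2 (polV k) * a₁
  c₂ := a₁ * pd1 (polV k) * a₂
  c₃ := a₁ * pd1 (a₂ * pd2 (polV k))
  c₄ := (a₁ * pd1 (polV k)) * (a₂ * pd2 (polV k)) * fun p => (k p)⁻¹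
  a₁ := a₁
  a₂ := a₂
  κ := fun p => (k p)⁻¹
  L₀ := fun p => 2 * ((a₁ * pd1 (polV k)) * (a₂ * pd2 (polV k)) * polLog k) p
  L₁ := fun p => 1 / 2 * (a₁ * pd1 (a₂ * pd2 (polLog k))) p
  c₅ := fun p => -(k p)⁻¹ * (4 * ((a₁ * pd1 (polV k)) * (a₂ * pd2 (polV k))) p)⁻¹

/-- Polarized data for the operators near `Γ`. -/
structure IsModel (Ω : Set ℂ) (φ : ℂ → ℂ) (V : ℂ → ℝ) (a₁ a₂ k : ℂ × ℂ → ℂ) (σ : ℝ) : Prop where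
  pos : 0 < σ
  diff_a₁ : DifferentiableOn ℂ a₁ (Dom σ)
  diff_a₂ : DifferentiableOn ℂ a₂ (Dom σ)
  diff_k : DifferentiableOn ℂ k (Dom σ)
  k_ne : ∀ p ∈ Dom σ, k p ≠ 0
  k_pos : ∀ p ∈ unitDiag, ∃ r : ℝ, 0 < r ∧ k p = r
  d₁_ne : ∀ p ∈ Dom σ, a₁ p * pd1 (polV k) p ≠ 0
  d₂_ne : ∀ p ∈ Dom σ, a₂ p * pd2 (polV k) p ≠ 0
  slit : ∀ p ∈ Dom σ, p.1 * p.2 ∈ Complex.slitPlane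
  pull_a₁ : pull φ a₁ =ᶠ[𝓝ˢ (frontier Ω)] deriv φ
  pull_a₂ : pull φ a₂ =ᶠ[𝓝ˢ (frontier Ω)] fun z => conj (deriv φ z)
  pull_v : toC V =ᶠ[𝓝ˢ (frontier Ω)] pull φ (polV k)

theorem differentiableOn_mul_fst_snd (D : Set (ℂ × ℂ)) :
    DifferentiableOn ℂ (fun p : ℂ × ℂ => p.1 * p.2) D := by fun_prop

namespace IsModel

variable {Ω U : Set ℂ} {φ : ℂ → ℂ} {V : ℂ → ℝ} {a₁ a₂ k : ℂ × ℂ → ℂ} {σ₁ : ℝ}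

section smooth
variable (hM : IsModel Ω φ V a₁ a₂ k σ₁)
include hM

theorem diff_polV : DifferentiableOn ℂ (polV k) (Dom σ₁) :=
  ((differentiableOn_mul_fst_snd _).sub_const _).mul hM.diff_k

theorem diff_inv : DifferentiableOn ℂ (fun p => (k p)⁻¹) (Dom σ₁) := hM.diff_k.fun_inv hM.k_ne

theorem diff_dslope : DifferentiableOn ℂ (fun p : ℂ × ℂ => dslope Complex.log 1 (p.1 * p.2)) (Dom σ₁) := by
  have h : DifferentiableOn ℂ (dslope Complex.log 1) Complex.slitPlane :=
    (Complex.differentiableOn_dslope (Complex.isOpen_slitPlane.mem_nhds Complex.one_mem_slitPlane)).2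
      (differentiableOn_id.clog fun _ h => h)
  exact h.comp (differentiableOn_mul_fst_snd _) hM.slit

theorem diff_polLog : DifferentiableOn ℂ (polLog k) (Dom σ₁) :=
  (hM.diff_dslope.const_mul _).mul hM.diff_inv

theorem diff_d₁ {F : ℂ × ℂ → ℂ} (hF : DifferentiableOn ℂ F (Dom σ₁)) :
    DifferentiableOn ℂ (a₁ * pd1 F) (Dom σ₁) := hM.diff_a₁.mul (differentiableOn_pd1 (isOpen_Dom _) hF)

theorem diff_d₂ {F : ℂ × ℂ → ℂ} (hF : DifferentiableOn ℂ F (Dom σ₁)) :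
    DifferentiableOn ℂ (a₂ * pd2 F) (Dom σ₁) := hM.diff_a₂.mul (differentiableOn_pd2 (isOpen_Dom _) hF)

theorem diff_c₅ : DifferentiableOn ℂ (coefs a₁ a₂ k).c₅ (Dom σ₁) := by
  refine hM.diff_inv.neg.mul (DifferentiableOn.fun_inv (((hM.diff_d₁ hM.diff_polV).mul
    (hM.diff_d₂ hM.diff_polV)).const_mul _) fun p hp => ?_)
  exact mul_ne_zero (by norm_num) (mul_ne_zero (hM.d₁_ne p hp) (hM.d₂_ne p hp))

end smooth

theorem mono (hM : IsModel Ω φ V a₁ a₂ k σ₁) {σ : ℝ} (h0 : 0 < σ) (h : σ ≤ σ₁) :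
    IsModel Ω φ V a₁ a₂ k σ :=
  ⟨h0, hM.diff_a₁.mono (Dom_mono h), hM.diff_a₂.mono (Dom_mono h), hM.diff_k.mono (Dom_mono h),
    fun p hp => hM.k_ne p (Dom_mono h hp), hM.k_pos, fun p hp => hM.d₁_ne p (Dom_mono h hp),
    fun p hp => hM.d₂_ne p (Dom_mono h hp), fun p hp => hM.slit p (Dom_mono h hp),
    hM.pull_a₁, hM.pull_a₂, hM.pull_v⟩

section germs
variable (hM : IsModel Ω φ V a₁ a₂ k σ₁) (hφ : IsExteriorMap Ω U φ)
include hM hφ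

theorem dz_eventuallyEq {f : ℂ → ℂ} {F : ℂ × ℂ → ℂ} {σ : ℝ} (hσ : 0 < σ)
    (hF : DifferentiableOn ℂ F (Dom σ)) (hf : f =ᶠ[𝓝ˢ (frontier Ω)] pull φ F) :
    dz f =ᶠ[𝓝ˢ (frontier Ω)] pull φ (a₁ * pd1 F) :=
  hφ.dz_eventuallyEq hM.pull_a₁ hσ hF hf

theorem dzbar_eventuallyEq {f : ℂ → ℂ} {F : ℂ × ℂ → ℂ} {σ : ℝ} (hσ : 0 < σ)
    (hF : DifferentiableOn ℂ F (Dom σ)) (hf : f =ᶠ[𝓝ˢ (frontier Ω)] pull φ F) :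
    dzbar f =ᶠ[𝓝ˢ (frontier Ω)] pull φ (a₂ * pd2 F) :=
  hφ.dzbar_eventuallyEq hM.pull_a₂ hσ hF hf

theorem qLap_eventuallyEq {f : ℂ → ℂ} {F : ℂ × ℂ → ℂ} {σ : ℝ} (hσ : 0 < σ) (h : σ ≤ σ₁)
    (hF : DifferentiableOn ℂ F (Dom σ)) (hf : f =ᶠ[𝓝ˢ (frontier Ω)] pull φ F) :
    qLap f =ᶠ[𝓝ˢ (frontier Ω)] pull φ (a₁ * pd1 (a₂ * pd2 F)) :=
  hφ.qLap_eventuallyEq hM.pull_a₁ hM.pull_a₂ hσ (hM.diff_a₂.mono (Dom_mono h)) hF hf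

theorem gradSq_eventuallyEq : gradSq V =ᶠ[𝓝ˢ (frontier Ω)]
    pull φ ((a₁ * pd1 (polV k)) * (a₂ * pd2 (polV k))) := by
  filter_upwards [hM.dz_eventuallyEq hφ hM.pos hM.diff_polV hM.pull_v,
    hM.dzbar_eventuallyEq hφ hM.pos hM.diff_polV hM.pull_v] with z h1 h2
  rw [gradSq_eq, h1, h2]
  rfl

/-- Near the curve `V` is `(|φ|² - 1)` times a nonvanishing factor, so it is zero only on the curve.
The curve has empty interior, hence the continuous extension of the quotient from its complement is
determined. -/
theorem divExt_eventuallyEq {g : ℂ → ℂ} {H : ℂ × ℂ → ℂ} {σ : ℝ} (hσ : 0 < σ)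
    (hH : DifferentiableOn ℂ H (Dom σ)) (hg : g =ᶠ[𝓝ˢ (frontier Ω)] pull φ (polV k * H)) :
    divExt Ω V g =ᶠ[𝓝ˢ (frontier Ω)] pull φ H := by
  have hne : ∀ᶠ z in 𝓝ˢ (frontier Ω), z ∉ frontier Ω → (V z : ℂ) ≠ 0 := by
    filter_upwards [hM.pull_v, hφ.frontier_eventually_mem, hφ.eventually_mem_Dom hM.pos]
      with z h1 h2 h3 h4
    have e : (V z : ℂ) = pull φ (polV k) z := h1
    rw [e]
    refine mul_ne_zero ?_ (hM.k_ne _ h3)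
    rw [Complex.mul_conj, Complex.normSq_eq_norm_sq, sub_ne_zero]
    intro h5
    have h6 : ‖φ z‖ = 1 := by
      have : ‖φ z‖ ^ 2 = 1 := by exact_mod_cast h5
      nlinarith [norm_nonneg (φ z)]
    obtain ⟨w, hw, he⟩ := hφ.exists_frontier_of_norm_eq_one h6
    exact h4 (hφ.inj (hφ.frontier_subset hw) h2 he ▸ hw)
  have hq : ∀ᶠ z in 𝓝ˢ (frontier Ω), z ∉ frontier Ω → g z / (V z : ℂ) = pull φ H z := by
    filter_upwards [hne, hg, hM.pull_v] with z h1 h2 h3 h4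
    have e : pull φ (polV k * H) z = (V z : ℂ) * pull φ H z := by
      rw [show (V z : ℂ) = pull φ (polV k) z from h3]; rfl
    rw [h2, e, mul_div_cancel_left₀ _ (h1 h4)]
  filter_upwards [hq.eventually_nhdsSet, hφ.frontier_eventually_mem, hφ.eventually_mem_Dom hσ]
    with z h1 h2 h3
  have hc : ContinuousAt (pull φ H) z := by
    have hφc := hφ.holo.continuousOn.continuousAt (hφ.isOpen.mem_nhds h2)
    exact ContinuousAt.comp (g := H) (f := fun z => (φ z, conj (φ z)))
      (hH.continuousOn.continuousAt ((isOpen_Dom σ).mem_nhds h3))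
      (hφc.prodMk (Complex.continuous_conj.continuousAt.comp hφc))
  refine extendFrom_eq ?_ ?_
  · have : interior (frontier Ω) = ∅ := by
      rw [← frontier_compl]; exact interior_frontier hφ.isOpen_domain.isClosed_compl
    rw [closure_compl, this, compl_empty]
    exact mem_univ z
  · refine (hc.tendsto.mono_left nhdsWithin_le_nhds).congr' ?_
    filter_upwards [h1.filter_mono nhdsWithin_le_nhds, self_mem_nhdsWithin] with w h4 h5
    exact (h4 h5).symm

/-- On the diagonal `log|φ| = ½ log(z w)`, and `log` vanishes at `1`, so the factor `z w - 1` splits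
off. -/
theorem log_eventuallyEq : (fun w => (Real.log ‖φ w‖ : ℂ)) =ᶠ[𝓝ˢ (frontier Ω)]
    pull φ (polV k * polLog k) := by
  filter_upwards [hφ.eventually_mem_Dom hM.pos] with z hz
  have hn : φ z ≠ 0 := ne_zero_of_mem_openAnnulus (mem_Dom.1 hz).1
  have e1 : φ z * conj (φ z) = ((‖φ z‖ ^ 2 : ℝ) : ℂ) := by
    rw [Complex.mul_conj, Complex.normSq_eq_norm_sq]
  have e2 := sub_smul_dslope Complex.log 1 (φ z * conj (φ z))
  rw [Complex.log_one, sub_zero, smul_eq_mul] at e2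
  have e3 : Complex.log (φ z * conj (φ z)) = 2 * (Real.log ‖φ z‖ : ℂ) := by
    rw [e1, ← Complex.ofReal_log (by positivity), Real.log_pow]
    push_cast; rfl
  have hk := hM.k_ne _ hz
  have : pull φ (polV k * polLog k) z = 1 / 2 * ((φ z * conj (φ z) - 1) *
      dslope Complex.log 1 (φ z * conj (φ z))) * (k (φ z, conj (φ z)) * (k (φ z, conj (φ z)))⁻¹) := by
    simp only [pull, polV, polLog, Pi.mul_apply]; ring
  rw [this, e2, e3, mul_inv_cancel₀ hk]
  ring

theorem opS_eventuallyEq (ϑ : ℂ) {f : ℂ → ℂ} {F : ℂ × ℂ → ℂ} {σ : ℝ} (hσ : 0 < σ) (h : σ ≤ σ₁)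
    (hF : DifferentiableOn ℂ F (Dom σ)) (hf : f =ᶠ[𝓝ˢ (frontier Ω)] pull φ F) :
    opS Ω V ϑ f =ᶠ[𝓝ˢ (frontier Ω)] pull φ ((coefs a₁ a₂ k).opS ϑ F) := by
  have hP := hφ.poisson_eventuallyEq hσ hF hf.self_of_nhdsSet
  have hQ := (hM.mono hσ h).diff_inv.mul (differentiableOn_quot hF)
  have hd : divExt Ω V (poisson Ω f - f) =ᶠ[𝓝ˢ (frontier Ω)]
      pull φ ((fun p => (k p)⁻¹) * quot F) := by
    refine hM.divExt_eventuallyEq hφ hσ hQ ?_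
    filter_upwards [hP, hf, hφ.eventually_mem_Dom hσ] with z h1 h2 h3
    have h4 := proj_sub_self hF h3
    have hk := (hM.mono hσ h).k_ne _ h3
    rw [Pi.sub_apply, h1, h2]
    simp only [pull, polV, Pi.mul_apply] at h4 ⊢
    rw [h4]
    field_simp
  filter_upwards [hM.dz_eventuallyEq hφ hM.pos hM.diff_polV hM.pull_v,
    hM.dzbar_eventuallyEq hφ hM.pos hM.diff_polV hM.pull_v,
    hM.qLap_eventuallyEq hφ hM.pos le_rfl hM.diff_polV hM.pull_v,
    hM.gradSq_eventuallyEq hφ, hM.dz_eventuallyEq hφ hσ hF hf, hM.dzbar_eventuallyEq hφ hσ hF hf,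
    hd, hM.qLap_eventuallyEq hφ hσ h hQ hd, hf] with z h1 h2 h3 h4 h5 h6 h7 h8 h9
  rw [opS, h1, h2, h3, h4, h5, h6, h7, h8, h9]
  simp only [pull, PolCoef.opS, coefs, Pi.mul_apply, Pi.add_apply]
  ring

theorem funL_eventuallyEq (ϑ : ℂ) : funL Ω φ V ϑ =ᶠ[𝓝ˢ (frontier Ω)]
    pull φ (fun p => (coefs a₁ a₂ k).L₀ p + ϑ * (coefs a₁ a₂ k).L₁ p) := by
  have hd := hM.divExt_eventuallyEq hφ hM.pos hM.diff_polLog (hM.log_eventuallyEq hφ)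
  filter_upwards [hd, hM.qLap_eventuallyEq hφ hM.pos le_rfl hM.diff_polLog hd,
    hM.gradSq_eventuallyEq hφ] with z h1 h2 h3
  rw [funL, h1, h2, h3]
  simp only [pull, coefs, Pi.mul_apply]
  ring

/-- With `X = log(L + ϑ S)` one has `e^X - e^{PX} = e^{PX} (X - PX) expQuot(X - PX)` and `X - PX =
-(z w - 1) quot X`, which cancels the zero of `V`; the minus sign is the one in `c₅`. Positivity of
the real part makes the principal logarithm holomorphic. -/
theorem opT_eventuallyEq (ϑ : ℂ) {f : ℂ → ℂ} {F : ℂ × ℂ → ℂ} {σ s : ℝ} (hs : 0 < s) (hsσ : s ≤ σ)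
    (h : σ ≤ σ₁) (hF : DifferentiableOn ℂ F (Dom σ)) (hf : f =ᶠ[𝓝ˢ (frontier Ω)] pull φ F)
    (hl : DifferentiableOn ℂ ((coefs a₁ a₂ k).lam ϑ F) (Dom s))
    (hre : ∀ p ∈ Dom s, 0 < ((coefs a₁ a₂ k).lam ϑ F p).re) :
    opT Ω φ V ϑ f =ᶠ[𝓝ˢ (frontier Ω)] pull φ ((coefs a₁ a₂ k).opT ϑ F) := by
  set C := coefs a₁ a₂ k with hC
  have hX : DifferentiableOn ℂ (C.logLam ϑ F) (Dom s) := hl.clog fun p hp => Or.inl (hre p hp)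
  have hσ : 0 < σ := hs.trans_le hsσ
  have hΛ : (fun w => funL Ω φ V ϑ w + ϑ * opS Ω V ϑ f w) =ᶠ[𝓝ˢ (frontier Ω)] pull φ (C.lam ϑ F) := by
    filter_upwards [hM.funL_eventuallyEq hφ ϑ, hM.opS_eventuallyEq hφ ϑ hσ h hF hf] with z h1 h2
    rw [h1, h2]
    simp only [pull, PolCoef.lam, hC]
  have hlog : (fun ξ => Complex.log (funL Ω φ V ϑ ξ + ϑ * opS Ω V ϑ f ξ)) =ᶠ[𝓝ˢ (frontier Ω)]
      pull φ (C.logLam ϑ F) := by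
    filter_upwards [hΛ] with z h1
    rw [h1]; rfl
  have hP := hφ.poisson_eventuallyEq hs hX hlog.self_of_nhdsSet
  have hM' := hM.mono hs (hsσ.trans h)
  have hH : DifferentiableOn ℂ (fun p => -(k p)⁻¹ * (quot (C.logLam ϑ F) p *
      Complex.exp (proj (C.logLam ϑ F) p) * expQuot (C.logLam ϑ F p - proj (C.logLam ϑ F) p)))
      (Dom s) := by
    have h1 := differentiableOn_proj hX
    exact hM'.diff_inv.neg.mul (((differentiableOn_quot hX).mul h1.cexp).mul
      (differentiable_expQuot.comp_differentiableOn (hX.sub h1)))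
  have hd := hM.divExt_eventuallyEq hφ hs hH (g := fun w => funL Ω φ V ϑ w + ϑ * opS Ω V ϑ f w
      - Complex.exp (poisson Ω (fun ξ => Complex.log (funL Ω φ V ϑ ξ + ϑ * opS Ω V ϑ f ξ)) w)) (by
    filter_upwards [hΛ, hP, hφ.eventually_mem_Dom hs] with z h1 h2 h3
    rw [h1, h2]
    have h4 := proj_sub_self hX h3
    have hk := hM'.k_ne _ h3
    have hne : C.lam ϑ F (φ z, conj (φ z)) ≠ 0 := fun h0 => by
      have := hre _ h3
      rw [h0] at this
      simp at this
    have h5 : C.lam ϑ F (φ z, conj (φ z)) = Complex.exp (C.logLam ϑ F (φ z, conj (φ z))) :=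
      (Complex.exp_log hne).symm
    set X := C.logLam ϑ F (φ z, conj (φ z)) with hXdef
    set PX := proj (C.logLam ϑ F) (φ z, conj (φ z)) with hPX
    have h6 := mul_expQuot (X - PX)
    have h7 : Complex.exp X = Complex.exp PX * Complex.exp (X - PX) := by
      rw [← Complex.exp_add]; congr 1; ring
    simp only [pull, polV, Pi.mul_apply, ← hXdef, ← hPX]
    rw [h5, h7]
    field_simp
    linear_combination -h6 - expQuot (X - PX) * h4)
  filter_upwards [hd, hM.gradSq_eventuallyEq hφ] with z h1 h2
  rw [opT, h1, h2]
  simp only [pull, PolCoef.opT, Pi.mul_apply]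
  have hc : C.c₅ (φ z, conj (φ z)) = -(k (φ z, conj (φ z)))⁻¹ *
    (4 * ((a₁ * pd1 (polV k)) * (a₂ * pd2 (polV k))) (φ z, conj (φ z)))⁻¹ := rfl
  rw [hc]
  simp only [Pi.mul_apply]
  ring

end germs

end IsModel

end BerezinOP
end

noncomputable section
namespace BerezinOP

/-! ### Factoring polarized functions which vanish on the curve -/

theorem eventually_mem_of_continuousOn {X : Type*} [TopologicalSpace X] {F : ℂ × ℂ → X} {σ : ℝ}
    (hσ : 0 < σ) (hF : ContinuousOn F (Dom σ)) {O : Set X} (hO : IsOpen O)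
    (h : ∀ p ∈ unitDiag, F p ∈ O) : ∀ᶠ p in 𝓝ˢ unitDiag, F p ∈ O :=
  eventually_nhdsSet_iff_forall.2 fun p hp => (hF.continuousAt ((isOpen_Dom σ).mem_nhds
    (unitDiag_subset_Dom hσ hp))).eventually_mem (hO.mem_nhds (h p hp))

theorem isPreconnected_openAnnulus (σ : ℝ) : IsPreconnected (openAnnulus σ) := by
  have h : openAnnulus σ = Complex.exp '' {z | Real.log (rho σ) < z.re ∧ z.re < -Real.log (rho σ)} := by
    ext z
    have hr := rho_pos σ
    constructor
    · intro hz
      have hz0 := ne_zero_of_mem_openAnnulus hz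
      refine ⟨Complex.log z, ⟨?_, ?_⟩, Complex.exp_log hz0⟩
      · rw [Complex.log_re]; exact Real.log_lt_log hr hz.1
      · rw [Complex.log_re, ← Real.log_inv]
        exact Real.log_lt_log (norm_pos_iff.2 hz0) hz.2
    · rintro ⟨w, ⟨h1, h2⟩, rfl⟩
      rw [openAnnulus, mem_ofPred_eq, Complex.norm_exp]
      refine ⟨?_, ?_⟩
      · rwa [← Real.log_lt_iff_lt_exp hr]
      · rw [← Real.lt_log_iff_exp_lt (inv_pos.2 hr), Real.log_inv]; exact h2
  rw [h]
  refine IsPreconnected.image ?_ _ Complex.continuous_exp.continuousOn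
  exact ((convex_halfSpace_re_gt _).inter (convex_halfSpace_re_lt _)).isPreconnected

/-- Vanishing on an arc of the unit circle near `1` spreads over the connected annulus by the
identity theorem. -/
theorem bdry_eq_zero {F : ℂ × ℂ → ℂ} {σ : ℝ} (hσ : 0 < σ) (hF : DifferentiableOn ℂ F (Dom σ))
    (h0 : ∀ p ∈ unitDiag, F p = 0) : EqOn (bdry F) 0 (openAnnulus σ) := by
  have h1 : (1 : ℂ) ∈ openAnnulus σ := by
    simp only [openAnnulus, mem_ofPred_eq, norm_one]
    exact ⟨rho_lt_one hσ, (one_lt_inv₀ (rho_pos σ)).2 (rho_lt_one hσ)⟩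
  refine AnalyticOnNhd.eqOn_zero_of_preconnected_of_frequently_eq_zero (z₀ := 1)
    ((differentiableOn_bdry hF).analyticOnNhd (isOpen_openAnnulus σ))
    (isPreconnected_openAnnulus σ) h1 ?_
  have ht : Tendsto (fun t : ℝ => Complex.exp (t * Complex.I)) (𝓝[≠] 0) (𝓝[≠] 1) := by
    refine tendsto_nhdsWithin_of_tendsto_nhds_of_eventually_within _ ?_ ?_
    · have : Continuous fun t : ℝ => Complex.exp (t * Complex.I) := by fun_prop
      simpa using (this.tendsto 0).mono_left nhdsWithin_le_nhds
    · have h2 : ∀ᶠ t : ℝ in 𝓝[≠] 0, t ∈ Ioo (-1 : ℝ) 1 :=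
        (isOpen_Ioo.eventually_mem (by norm_num)).filter_mono nhdsWithin_le_nhds
      filter_upwards [h2, self_mem_nhdsWithin] with t h2 h3 h4
      have h5 := congrArg Complex.im (mem_singleton_iff.1 h4)
      rw [Complex.exp_ofReal_mul_I_im, Complex.one_im] at h5
      have hpi := Real.pi_gt_three
      exact h3 ((Real.sin_eq_zero_iff_of_lt_of_lt (by linarith [h2.1]) (by linarith [h2.2])).1 h5)
  refine ht.frequently (Eventually.frequently (Eventually.of_forall fun t => ?_))
  refine h0 _ ⟨Complex.norm_exp_ofReal_mul_I t, ?_⟩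
  simp [← Complex.exp_conj, ← Complex.exp_neg]

theorem cauchyInt_eq_zero {r : ℝ} {g : ℂ → ℂ} {z : ℂ} (hr : 0 < r)
    (hg : ∀ ζ, ‖ζ‖ = r → ContinuousAt g ζ) (h0 : ∀ ζ, ‖ζ‖ = r → g ζ = 0) (hz : ‖z‖ ≠ r) :
    cauchyInt r g z = 0 := by
  have := norm_cauchyInt_le hr (abs_pos.2 (sub_ne_zero.2 hz.symm)) le_rfl hg
    (fun ζ hζ => by rw [h0 ζ hζ, norm_zero]) le_rfl
  simpa using this

/-- Zero boundary data have zero Poisson extension, and then `proj_sub_self` is the desired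
factorization. -/
theorem exists_factor {F : ℂ × ℂ → ℂ} {σ : ℝ} (hσ : 0 < σ) (hF : DifferentiableOn ℂ F (Dom σ))
    (h0 : ∀ p ∈ unitDiag, F p = 0) : ∃ G : ℂ × ℂ → ℂ, DifferentiableOn ℂ G (Dom σ) ∧
      ∀ p ∈ Dom σ, F p = (p.1 * p.2 - 1) * G p := by
  refine ⟨-quot F, (differentiableOn_quot hF).neg, fun p hp => ?_⟩
  have h1 := proj_sub_self hF hp
  obtain ⟨s, hs0, hs, hps⟩ := exists_lt_mem_Dom hp
  have hb := bdry_eq_zero hσ hF h0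
  have h2 : proj F p = 0 := by
    rw [(proj_eq_projC_and_quot_eq_quotC hs0 hs hF hps).1, projC]
    have hr := rho_pos s
    have hle := rho_le_rho_inv hs0
    obtain ⟨ha1, ha2, -⟩ := mem_Dom.1 hps
    rw [cauchyInt_eq_zero (inv_pos.2 hr) (continuousAt_bdry_outer hs0 hs hF)
      (fun ζ hζ => hb (mem_openAnnulus_of_between hs (by rw [hζ]; exact hle) hζ.le))
      (inv_mem_openAnnulus ha2).2.ne,
      cauchyInt_eq_zero hr (continuousAt_bdry_inner hs0 hs hF)
      (fun ζ hζ => hb (mem_openAnnulus_of_between hs hζ.ge (by rw [hζ]; exact hle))) ha1.1.ne',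
      sub_zero]
  rw [h2] at h1
  simp only [Pi.neg_apply]
  linear_combination -h1

/-! ### The Laplacian in terms of Wirtinger derivatives -/

theorem qLap_eq_laplacian {f : ℂ → ℂ} {z : ℂ} (hf : ContDiffAt ℝ 2 f z) :
    qLap f z = 1 / 4 * Laplacian.laplacian f z := by
  have hd : DifferentiableAt ℝ (fderiv ℝ f) z :=
    (hf.fderiv_right (m := 1) (by norm_num)).differentiableAt (by norm_num)
  have hs := hf.isSymmSndFDerivAt (by simp)
  have h1 : ∀ e : ℂ, HasFDerivAt (fun w => fderiv ℝ f w e)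
      ((ContinuousLinearMap.apply ℝ ℂ e).comp (fderiv ℝ (fderiv ℝ f) z)) z := fun e =>
    (ContinuousLinearMap.apply ℝ ℂ e).hasFDerivAt.comp z hd.hasFDerivAt
  have h2 : HasFDerivAt (dzbar f) ((1 / 2 : ℂ) •
      ((ContinuousLinearMap.apply ℝ ℂ 1).comp (fderiv ℝ (fderiv ℝ f) z) + Complex.I •
        (ContinuousLinearMap.apply ℝ ℂ Complex.I).comp (fderiv ℝ (fderiv ℝ f) z))) z :=
    ((h1 1).add ((h1 Complex.I).const_mul Complex.I)).const_mul (1 / 2 : ℂ)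
  rw [qLap, dz, h2.fderiv, InnerProductSpace.laplacian_eq_iteratedFDeriv_complexPlane]
  simp only [iteratedFDeriv_two_apply, smul_apply,
    add_apply, ContinuousLinearMap.comp_apply, ContinuousLinearMap.apply_apply,
    smul_eq_mul, Matrix.cons_val_zero, Matrix.cons_val_one, Matrix.cons_val_fin_one]
  rw [hs.eq 1 Complex.I]
  linear_combination (-1 / 4 * (fderiv ℝ (fderiv ℝ f) z Complex.I) Complex.I) * Complex.I_sq

theorem qLap_toC {W : ℂ → ℝ} {z : ℂ} (hW : ContDiffAt ℝ 2 W z) :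
    qLap (toC W) z = ((1 / 4 * Laplacian.laplacian W z : ℝ) : ℂ) := by
  have hc : ContDiffAt ℝ 2 (Complex.ofRealCLM ∘ W) z := Complex.ofRealCLM.contDiff.contDiffAt.comp z hW
  have e : toC W = Complex.ofRealCLM ∘ W := rfl
  rw [e, qLap_eq_laplacian hc, hW.laplacian_CLM_comp_left]
  simp

/-! ### Polarization of the coefficients -/

namespace IsExteriorMap

variable {Ω U : Set ℂ} {φ : ℂ → ℂ} (hφ : IsExteriorMap Ω U φ)
include hφ

theorem exists_pair_eq {p : ℂ × ℂ} (hp : p ∈ unitDiag) :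
    ∃ z ∈ frontier Ω, p = (φ z, conj (φ z)) := by
  obtain ⟨z, hz, he⟩ := hφ.exists_frontier_of_norm_eq_one hp.1
  exact ⟨z, hz, Prod.ext he.symm (by rw [he]; exact hp.2)⟩

theorem mem_frontier_iff {z : ℂ} (hz : z ∈ U) : z ∈ frontier Ω ↔ ‖φ z‖ = 1 := by
  refine ⟨hφ.norm_eq_one, fun h => ?_⟩
  obtain ⟨w, hw, he⟩ := hφ.exists_frontier_of_norm_eq_one h
  exact hφ.inj (hφ.frontier_subset hw) hz he ▸ hw

theorem eventually_mem_image : ∀ᶠ p : ℂ × ℂ in 𝓝ˢ unitDiag, p.1 ∈ φ '' U ∧ conj p.2 ∈ φ '' U := by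
  have hE := isOpen_image_of_injOn hφ.isOpen hφ.holo hφ.inj
  have : IsOpen {p : ℂ × ℂ | p.1 ∈ φ '' U ∧ conj p.2 ∈ φ '' U} :=
    (hE.preimage continuous_fst).inter (hE.preimage (Complex.continuous_conj.comp continuous_snd))
  refine this.mem_nhdsSet.2 fun p hp => ?_
  obtain ⟨z, hz, rfl⟩ := hφ.exists_pair_eq hp
  have := mem_image_of_mem φ (hφ.frontier_subset hz)
  exact ⟨this, by simpa using this⟩

/-- A polarization in the original variable is composed with `(ψ(z), conj ψ(conj w))`, `ψ` the
inverse of `φ`; this map is holomorphic in both variables. -/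
theorem exists_polarization_germ {f : ℂ → ℂ} (hf : ∀ z ∈ frontier Ω, AnalyticAt ℝ f z) :
    ∃ σ : ℝ, 0 < σ ∧ ∃ F : ℂ × ℂ → ℂ, DifferentiableOn ℂ F (Dom σ) ∧
      f =ᶠ[𝓝ˢ (frontier Ω)] pull φ F := by
  obtain ⟨N, hN, hNm, F, hF, hFf⟩ := exists_polarization hf
  set ψ := Function.invFunOn φ U with hψ
  have hψd := differentiableOn_invFunOn hφ.isOpen hφ.holo hφ.inj
  have hE := isOpen_image_of_injOn hφ.isOpen hφ.holo hφ.inj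
  set g : ℂ × ℂ → ℂ × ℂ := fun p => (ψ p.1, conj (ψ (conj p.2))) with hg
  have hgd : ∀ p : ℂ × ℂ, p.1 ∈ φ '' U → conj p.2 ∈ φ '' U → DifferentiableAt ℂ g p := by
    intro p h1 h2
    have d1 := (hψd.differentiableAt (hE.mem_nhds h1)).comp p differentiableAt_fst
    have d2 : DifferentiableAt ℂ (conj ∘ ψ ∘ conj) p.2 := by
      have := (hψd.differentiableAt (hE.mem_nhds h2)).conj_conj
      simpa using this
    exact d1.prodMk (d2.comp p differentiableAt_snd)
  have hev : ∀ᶠ p in 𝓝ˢ unitDiag, (p.1 ∈ φ '' U ∧ conj p.2 ∈ φ '' U) ∧ g p ∈ N := by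
    refine hφ.eventually_mem_image.and (eventually_nhdsSet_iff_forall.2 fun p hp => ?_)
    obtain ⟨h1, h2⟩ := hφ.eventually_mem_image.self_of_nhdsSet p hp
    refine (hgd p h1 h2).continuousAt.eventually_mem (hN.mem_nhds ?_)
    obtain ⟨z, hz, rfl⟩ := hφ.exists_pair_eq hp
    simpa [hg, hψ, invFunOn_image_apply hφ.inj (hφ.frontier_subset hz)] using hNm z hz
  obtain ⟨σ, h0, -, hσ⟩ := exists_Dom_subset hev
  refine ⟨σ, h0, F ∘ g, fun p hp => ?_, ?_⟩
  · obtain ⟨⟨h1, h2⟩, h3⟩ := hσ hp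
    exact ((hF.differentiableAt (hN.mem_nhds h3)).comp p (hgd p h1 h2)).differentiableWithinAt
  · filter_upwards [hφ.eventually_mem_Dom h0, hφ.frontier_eventually_mem] with z h1 h2
    have h3 := (hσ h1).2
    have e : g (φ z, conj (φ z)) = (z, conj z) := by
      simp [hg, hψ, invFunOn_image_apply hφ.inj h2]
    rw [e] at h3
    rw [pull, Function.comp, e, hFf z h3]

/-- Written as the reciprocal of `ψ'` at the image point, `φ'` is a zero-free holomorphic function
of the image variable. -/
theorem exists_deriv_polarization : ∃ σ : ℝ, 0 < σ ∧ ∃ a₁ a₂ : ℂ × ℂ → ℂ,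
    DifferentiableOn ℂ a₁ (Dom σ) ∧ DifferentiableOn ℂ a₂ (Dom σ) ∧
    (∀ p ∈ Dom σ, a₁ p ≠ 0 ∧ a₂ p ≠ 0) ∧ pull φ a₁ =ᶠ[𝓝ˢ (frontier Ω)] deriv φ ∧
    pull φ a₂ =ᶠ[𝓝ˢ (frontier Ω)] fun z => conj (deriv φ z) := by
  set ψ := Function.invFunOn φ U with hψ
  have hE := isOpen_image_of_injOn hφ.isOpen hφ.holo hφ.inj
  have hψd : DifferentiableOn ℂ (deriv ψ) (φ '' U) :=
    (differentiableOn_invFunOn hφ.isOpen hφ.holo hφ.inj).deriv hE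
  have hmul : ∀ z ∈ U, deriv ψ (φ z) * deriv φ z = 1 := fun z hz =>
    deriv_invFunOn_mul_deriv hφ.isOpen hφ.holo hφ.inj hz
  have hne : ∀ ζ ∈ φ '' U, deriv ψ ζ ≠ 0 := by
    rintro _ ⟨z, hz, rfl⟩ h
    have := hmul z hz
    rw [h, zero_mul] at this
    exact zero_ne_one this
  obtain ⟨σ, h0, -, hσ⟩ := exists_Dom_subset hφ.eventually_mem_image
  refine ⟨σ, h0, fun p => (deriv ψ p.1)⁻¹, fun p => (conj (deriv ψ (conj p.2)))⁻¹,
    fun p hp => ?_, fun p hp => ?_, fun p hp => ?_, ?_, ?_⟩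
  · obtain ⟨h1, -⟩ := hσ hp
    exact (((hψd.differentiableAt (hE.mem_nhds h1)).comp p differentiableAt_fst).fun_inv
      (hne _ h1)).differentiableWithinAt
  · obtain ⟨-, h2⟩ := hσ hp
    have d2 : DifferentiableAt ℂ (conj ∘ deriv ψ ∘ conj) p.2 := by
      have := (hψd.differentiableAt (hE.mem_nhds h2)).conj_conj
      simpa using this
    exact ((d2.comp p differentiableAt_snd).fun_inv
      ((map_ne_zero _).2 (hne _ h2))).differentiableWithinAt
  · obtain ⟨h1, h2⟩ := hσ hp
    exact ⟨inv_ne_zero (hne _ h1), inv_ne_zero ((map_ne_zero _).2 (hne _ h2))⟩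
  · filter_upwards [hφ.frontier_eventually_mem] with z hz
    exact inv_eq_of_mul_eq_one_right (hmul z hz)
  · filter_upwards [hφ.frontier_eventually_mem] with z hz
    simp only [pull, Complex.conj_conj]
    rw [← map_inv₀, inv_eq_of_mul_eq_one_right (hmul z hz)]

end IsExteriorMap

end BerezinOP
end

noncomputable section
namespace BerezinOP

/-! ### Construction of the polarized data from `Q - Qb`, and bounds on the coefficients. -/

theorem pd1_mul {F G : ℂ × ℂ → ℂ} {D : Set (ℂ × ℂ)} (hD : IsOpen D)
    (hF : DifferentiableOn ℂ F D) (hG : DifferentiableOn ℂ G D) {p : ℂ × ℂ} (hp : p ∈ D) :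
    pd1 (fun p => F p * G p) p = pd1 F p * G p + F p * pd1 G p :=
  deriv_fun_mul (DifferentiableOn.slice1 hF hD hp) (DifferentiableOn.slice1 hG hD hp)

theorem pd2_mul {F G : ℂ × ℂ → ℂ} {D : Set (ℂ × ℂ)} (hD : IsOpen D)
    (hF : DifferentiableOn ℂ F D) (hG : DifferentiableOn ℂ G D) {p : ℂ × ℂ} (hp : p ∈ D) :
    pd2 (fun p => F p * G p) p = pd2 F p * G p + F p * pd2 G p :=
  deriv_fun_mul (DifferentiableOn.slice2 hF hD hp) (DifferentiableOn.slice2 hG hD hp)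

theorem pd1_mul_sub_one (p : ℂ × ℂ) : pd1 (fun p => p.1 * p.2 - 1) p = p.2 := by
  simp only [pd1]
  rw [deriv_sub_const, deriv_mul_const_field]
  simp

theorem pd2_mul_sub_one (p : ℂ × ℂ) : pd2 (fun p => p.1 * p.2 - 1) p = p.1 := by
  simp only [pd2]
  rw [deriv_sub_const, deriv_const_mul_field]
  simp

theorem differentiableOn_mul_sub_one (D : Set (ℂ × ℂ)) :
    DifferentiableOn ℂ (fun p : ℂ × ℂ => p.1 * p.2 - 1) D := by fun_prop

/-- The polarized Laplacian on the curve, of a function vanishing to second order. -/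
theorem d₁_d₂_sq_mul {a₁ a₂ W G : ℂ × ℂ → ℂ} {σ : ℝ} (hσ : 0 < σ)
    (ha₂ : DifferentiableOn ℂ a₂ (Dom σ)) (hG : DifferentiableOn ℂ G (Dom σ))
    (hW : ∀ p ∈ Dom σ, W p = (p.1 * p.2 - 1) * ((p.1 * p.2 - 1) * G p)) {p : ℂ × ℂ}
    (hp : p ∈ unitDiag) : (a₁ * pd1 (a₂ * pd2 W)) p = 2 * a₁ p * a₂ p * G p := by
  have hD := isOpen_Dom σ
  have hpD := unitDiag_subset_Dom hσ hp
  have hp1 := mul_eq_one_of_mem_unitDiag hp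
  have hm := differentiableOn_mul_sub_one (Dom σ)
  have e1 : EqOn (a₂ * pd2 W) (fun q => (q.1 * q.2 - 1) *
      (a₂ q * (2 * q.1 * G q + (q.1 * q.2 - 1) * pd2 G q))) (Dom σ) := fun q hq => by
    rw [Pi.mul_apply, pd2_congr hD hW hq, pd2_mul (G := fun p => (p.1 * p.2 - 1) * G p) hD hm (hm.mul hG) hq, pd2_mul_sub_one,
      pd2_mul hD hm hG hq, pd2_mul_sub_one]
    ring
  have hH : DifferentiableOn ℂ (fun q : ℂ × ℂ => a₂ q *
      (2 * q.1 * G q + (q.1 * q.2 - 1) * pd2 G q)) (Dom σ) :=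
    ha₂.mul (((differentiableOn_fst.const_mul 2).mul hG).add (hm.mul (differentiableOn_pd2 hD hG)))
  rw [Pi.mul_apply, pd1_congr hD e1 hpD, pd1_mul hD hm hH hpD, pd1_mul_sub_one, hp1]
  linear_combination 2 * a₁ p * a₂ p * G p * hp1

namespace IsExteriorMap

variable {Ω U : Set ℂ} {φ : ℂ → ℂ} (hφ : IsExteriorMap Ω U φ)
include hφ

/-- Otherwise openness of `φ` would force `|ζ| ≥ 1` throughout a neighbourhood of a point of the
unit circle. -/
theorem frequently_notMem_closure {z : ℂ} (hz : z ∈ frontier Ω) : ∃ᶠ w in 𝓝 z, w ∉ closure Ω := by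
  intro h
  simp only [not_not] at h
  have h1 : ∀ᶠ ζ in 𝓝 (φ z), 1 ≤ ‖ζ‖ := by
    refine nhds_le_map_of_injOn hφ.isOpen hφ.holo hφ.inj (hφ.frontier_subset hz) ?_
    exact mem_map.2 (mem_of_superset h fun w hw => hφ.one_le_norm hw)
  have hc : Tendsto (fun t : ℝ => (t : ℂ) * φ z) (𝓝 1) (𝓝 (φ z)) := by
    have : Continuous fun t : ℝ => (t : ℂ) * φ z := by fun_prop
    simpa using this.tendsto 1
  obtain ⟨t, ht, ht1⟩ := (((hc.eventually h1).filter_mono nhdsWithin_le_nhds).and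
    (Ioo_mem_nhdsLT (zero_lt_one' ℝ))).exists
  rw [norm_mul, hφ.norm_eq_one hz, Complex.norm_real, Real.norm_of_nonneg ht1.1.le] at ht
  linarith [ht1.2]

section model

variable {V W : ℂ → ℝ} (hV : ∀ z ∈ frontier Ω, DifferentiableAt ℝ V z)
  (hsq : ∀ᶠ z in 𝓝ˢ (frontier Ω), V z ^ 2 = W z) (hpos : ∀ z ∈ Ω, 0 < V z)
  (hneg : ∀ᶠ z in 𝓝ˢ (frontier Ω), z ∉ closure Ω → V z < 0)

include hV hpos hneg in
theorem eq_zero_of_mem_frontier {z : ℂ} (hz : z ∈ frontier Ω) : V z = 0 := by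
  have hc := (hV z hz).continuousAt
  refine le_antisymm (not_lt.1 fun h => ?_) (not_lt.1 fun h => ?_)
  · obtain ⟨w, ⟨h1, h2⟩, h3⟩ := (((hφ.frequently_notMem_closure hz).and_eventually
      (hneg.filter_mono (nhds_le_nhdsSet hz))).and_eventually (hc.eventually_const_lt h)).exists
    linarith [h2 h1]
  · obtain ⟨w, h1, h2⟩ := mem_closure_iff_nhds.1 (frontier_subset_closure hz) _
      (hc.eventually_lt_const h)
    exact lt_asymm h1 (hpos w h2)

include hV hsq hpos hneg in
-- The first factor `z w - 1` splits off because `V` vanishes on the boundary. The second uses only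
-- differentiability of `V`: along the radius `t ↦ t φ(z)` the function `V²` has zero derivative at
-- `t = 1`, whereas the factored form has derivative `2 G₁`. The sign of `G` is that of the limit of
-- `V² / (t² - 1)²`.
theorem exists_sq_factor {σ : ℝ} {F : ℂ × ℂ → ℂ} (hσ : 0 < σ) (hF : DifferentiableOn ℂ F (Dom σ))
    (hWF : toC W =ᶠ[𝓝ˢ (frontier Ω)] pull φ F) : ∃ G : ℂ × ℂ → ℂ, DifferentiableOn ℂ G (Dom σ) ∧
      (∀ p ∈ Dom σ, F p = (p.1 * p.2 - 1) * ((p.1 * p.2 - 1) * G p)) ∧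
      ∀ p ∈ unitDiag, 0 ≤ (G p).re ∧ (G p).im = 0 := by
  have hV0 := fun z hz => hφ.eq_zero_of_mem_frontier hV hpos hneg (z := z) hz
  obtain ⟨G₁, hG₁, hFG₁⟩ := exists_factor hσ hF fun p hp => by
    obtain ⟨z, hz, rfl⟩ := hφ.exists_pair_eq hp
    have h1 := hWF.self_of_nhdsSet hz
    have h2 := hsq.self_of_nhdsSet z hz
    rw [hV0 z hz] at h2
    have : F (φ z, conj (φ z)) = toC W z := h1.symm
    rw [this, toC, ← h2]
    simp
  set ψ := Function.invFunOn φ U with hψ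
  have hE := isOpen_image_of_injOn hφ.isOpen hφ.holo hφ.inj
  have hψd := differentiableOn_invFunOn hφ.isOpen hφ.holo hφ.inj
  -- along a radius
  have radial : ∀ z ∈ frontier Ω,
      DifferentiableAt ℝ (fun t : ℝ => V (ψ (t * φ z))) 1 ∧ ∀ᶠ t : ℝ in 𝓝 1,
        ((V (ψ (t * φ z)) : ℂ)) ^ 2 = F (t * φ z, conj (t * φ z)) := by
    intro z hz
    have hzU := hφ.frontier_subset hz
    have hψ1 : ψ ((1 : ℝ) * φ z) = z := by
      simp [hψ, invFunOn_image_apply hφ.inj hzU]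
    have hψdiff : DifferentiableAt ℝ (fun t : ℝ => ψ (t * φ z)) 1 := by
      refine DifferentiableAt.comp (g := ψ) (1 : ℝ) ?_ (by fun_prop)
      refine DifferentiableAt.restrictScalars ℝ (hψd.differentiableAt (hE.mem_nhds ?_))
      simpa using mem_image_of_mem φ hzU
    refine ⟨DifferentiableAt.comp (g := V) (1 : ℝ) (by rw [hψ1]; exact hV z hz) hψdiff, ?_⟩
    have hct : Tendsto (fun t : ℝ => ψ (t * φ z)) (𝓝 1) (𝓝 z) := by
      have := hψdiff.continuousAt.tendsto
      rwa [hψ1] at this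
    have hct' : Tendsto (fun t : ℝ => (t : ℂ) * φ z) (𝓝 1) (𝓝 (φ z)) := by
      have : Continuous fun t : ℝ => (t : ℂ) * φ z := by fun_prop
      simpa using this.tendsto 1
    filter_upwards [hct.eventually (hsq.filter_mono (nhds_le_nhdsSet hz)),
      hct.eventually (hWF.filter_mono (nhds_le_nhdsSet hz)),
      hct'.eventually_mem (hE.mem_nhds (mem_image_of_mem φ hzU))] with t h1 h2 h3
    have h4 : φ (ψ (t * φ z)) = t * φ z := Function.invFunOn_eq h3
    have h5 : toC W (ψ (t * φ z)) = F (t * φ z, conj (t * φ z)) := by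
      rw [h2, pull, h4]
    rw [← h5, toC, ← h1]
    push_cast
    rfl
  have hprod : ∀ z ∈ frontier Ω, ∀ t : ℝ,
      (t * φ z) * conj (t * φ z) - 1 = ((t ^ 2 - 1 : ℝ) : ℂ) := fun z hz t => by
    rw [Complex.mul_conj, Complex.normSq_eq_norm_sq, norm_mul, hφ.norm_eq_one hz, Complex.norm_real,
      mul_one, Real.norm_eq_abs, sq_abs]
    push_cast; rfl
  have hmemD : ∀ z ∈ frontier Ω, ∀ᶠ t : ℝ in 𝓝 1, ((t * φ z, conj (t * φ z)) : ℂ × ℂ) ∈ Dom σ := by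
    intro z hz
    have hc : Continuous fun t : ℝ => ((t * φ z, conj (t * φ z)) : ℂ × ℂ) := by fun_prop
    refine hc.continuousAt.eventually_mem ((isOpen_Dom σ).mem_nhds ?_)
    have := unitDiag_subset_Dom hσ (hφ.pair_mem_unitDiag hz)
    simpa using this
  have hcd : ∀ z, DifferentiableAt ℝ (fun t : ℝ => ((t * φ z, conj (t * φ z)) : ℂ × ℂ)) 1 := by
    intro z
    have : (fun t : ℝ => ((t * φ z, conj (t * φ z)) : ℂ × ℂ)) =
        fun t : ℝ => ((t * φ z, t * conj (φ z)) : ℂ × ℂ) := by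
      funext t; simp
    rw [this]
    fun_prop
  have hcomp : ∀ (H : ℂ × ℂ → ℂ), DifferentiableOn ℂ H (Dom σ) → ∀ z ∈ frontier Ω,
      DifferentiableAt ℝ (fun t : ℝ => H (t * φ z, conj (t * φ z))) 1 := fun H hH z hz =>
    DifferentiableAt.comp (g := H) (1 : ℝ) (DifferentiableAt.restrictScalars ℝ
      (hH.differentiableAt ((isOpen_Dom σ).mem_nhds (hmemD z hz).self_of_nhds))) (hcd z)
  obtain ⟨G, hG, hG₁G⟩ := exists_factor hσ hG₁ fun p hp => by
    obtain ⟨z, hz, rfl⟩ := hφ.exists_pair_eq hp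
    obtain ⟨hd, hev⟩ := radial z hz
    have h1 : HasDerivAt (fun t : ℝ => ((V (ψ (t * φ z)) ^ 2 : ℝ) : ℂ)) 0 1 := by
      have h := (hd.hasDerivAt.pow 2).ofReal_comp
      have h0 : V (ψ ((1 : ℝ) * φ z)) = 0 := by
        simp [hψ, invFunOn_image_apply hφ.inj (hφ.frontier_subset hz), hV0 z hz]
      rw [h0] at h
      simpa using h
    have h2 := (((hasDerivAt_pow 2 (1 : ℝ)).sub_const 1).ofReal_comp).mul
      (hcomp G₁ hG₁ z hz).hasDerivAt
    have h3 := h1.unique (h2.congr_of_eventuallyEq (by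
      filter_upwards [hev, hmemD z hz] with t h4 h5
      rw [Pi.mul_apply, ← hprod z hz t, ← hFG₁ _ h5, ← h4]
      push_cast; rfl))
    simpa using h3
  have hFG : ∀ p ∈ Dom σ, F p = (p.1 * p.2 - 1) * ((p.1 * p.2 - 1) * G p) := fun p hp => by
    rw [hFG₁ p hp, hG₁G p hp]
  refine ⟨G, hG, hFG, fun p hp => ?_⟩
  obtain ⟨z, hz, rfl⟩ := hφ.exists_pair_eq hp
  have hcl : IsClosed {x : ℂ | 0 ≤ x.re ∧ x.im = 0} :=
    (isClosed_le continuous_const Complex.continuous_re).inter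
      (isClosed_eq Complex.continuous_im continuous_const)
  have ht : Tendsto (fun t : ℝ => G (t * φ z, conj (t * φ z))) (𝓝[>] 1) (𝓝 (G (φ z, conj (φ z)))) := by
    have := (hcomp G hG z hz).continuousAt.tendsto
    simp only [Complex.ofReal_one, one_mul] at this
    exact this.mono_left nhdsWithin_le_nhds
  refine hcl.mem_of_tendsto ht ?_
  filter_upwards [((radial z hz).2.and (hmemD z hz)).filter_mono nhdsWithin_le_nhds,
    self_mem_nhdsWithin] with t h1 h2
  have h3 := hFG _ h1.2
  simp only at h3
  rw [hprod z hz, ← h1.1] at h3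
  have h4 : 0 < t ^ 2 - 1 := by nlinarith [mem_Ioi.1 h2]
  have h4' : ((t ^ 2 - 1 : ℝ) : ℂ) ≠ 0 := by exact_mod_cast h4.ne'
  have h5 : G (t * φ z, conj (t * φ z)) = ((V (ψ (t * φ z)) ^ 2 / (t ^ 2 - 1) ^ 2 : ℝ) : ℂ) := by
    rw [Complex.ofReal_div, eq_div_iff (by simpa using h4')]
    push_cast at h3 ⊢
    linear_combination -h3
  show 0 ≤ (G (t * φ z, conj (t * φ z))).re ∧ (G (t * φ z, conj (t * φ z))).im = 0
  rw [h5]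
  exact ⟨by rw [Complex.ofReal_re]; positivity, Complex.ofReal_im _⟩

include hV hsq hpos hneg in
-- On the curve the quarter Laplacian of `W` equals `2 |φ'|² G`, so `G` has no zeros there, and `k`
-- is its analytic square root. The signs of `V` on the two sides select the root `(z w - 1) k`;
-- thus `V`, assumed only differentiable on the curve, is real-analytic near it.
theorem exists_isModel (hW : ∀ z ∈ frontier Ω, AnalyticAt ℝ W z)
    (hΔ : ∀ z ∈ frontier Ω, Laplacian.laplacian W z ≠ 0) :
    ∃ a₁ a₂ k : ℂ × ℂ → ℂ, ∃ σ : ℝ, IsModel Ω φ V a₁ a₂ k σ := by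
  obtain ⟨σ₁, hσ₁, F, hF, hWF⟩ := hφ.exists_polarization_germ (f := toC W) fun z hz =>
    (Complex.ofRealCLM.analyticAt (W z)).comp (hW z hz)
  obtain ⟨σ₂, hσ₂, a₁, a₂, ha₁, ha₂, hane, hpa₁, hpa₂⟩ := hφ.exists_deriv_polarization
  set σ := min σ₁ σ₂ with hσdef
  have hσ : 0 < σ := lt_min hσ₁ hσ₂
  replace hF := hF.mono (Dom_mono (min_le_left σ₁ σ₂))
  replace ha₁ := ha₁.mono (Dom_mono (min_le_right σ₁ σ₂))
  replace ha₂ := ha₂.mono (Dom_mono (min_le_right σ₁ σ₂))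
  obtain ⟨G, hG, hFG, hGre⟩ := hφ.exists_sq_factor hV hsq hpos hneg hσ hF hWF
  have hGpos : ∀ p ∈ unitDiag, 0 < (G p).re := fun p hp => by
    refine lt_of_le_of_ne (hGre p hp).1 fun h0 => ?_
    have hG0 : G p = 0 := Complex.ext h0.symm (hGre p hp).2
    obtain ⟨z, hz, rfl⟩ := hφ.exists_pair_eq hp
    have h1 := (hφ.qLap_eventuallyEq hpa₁ hpa₂ hσ ha₂ hF hWF).self_of_nhdsSet hz
    rw [pull, d₁_d₂_sq_mul hσ ha₂ hG hFG (hφ.pair_mem_unitDiag hz), hG0, mul_zero,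
      qLap_toC (hW z hz).contDiffAt, Complex.ofReal_eq_zero] at h1
    exact hΔ z hz (by linarith)
  set k : ℂ × ℂ → ℂ := fun p => Complex.exp (1 / 2 * Complex.log (G p)) with hk
  have hslit := eventually_mem_of_continuousOn hσ hG.continuousOn
    (isOpen_lt continuous_const Complex.continuous_re) hGpos
  have hslit2 : ∀ᶠ p : ℂ × ℂ in 𝓝ˢ unitDiag, p.1 * p.2 ∈ Complex.slitPlane :=
    eventually_mem_of_continuousOn hσ (differentiableOn_mul_fst_snd _).continuousOn
      Complex.isOpen_slitPlane fun p hp => by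
        rw [mul_eq_one_of_mem_unitDiag hp]; exact Complex.one_mem_slitPlane
  obtain ⟨s, hs, -, hsub⟩ := exists_Dom_subset ((hslit.and hslit2).and (Dom_mem_nhdsSet hσ))
  have hkd : DifferentiableOn ℂ k (Dom s) := fun p hp => by
    have h1 := (hG.differentiableAt ((isOpen_Dom σ).mem_nhds (hsub hp).2)).clog
      (Or.inl (hsub hp).1.1)
    exact (h1.const_mul (1 / 2)).cexp.differentiableWithinAt
  have hkne : ∀ p, k p ≠ 0 := fun p => Complex.exp_ne_zero _
  have hreal : ∀ p x, G p = ((x : ℝ) : ℂ) → 0 < x →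
      k p = ((Real.sqrt x : ℝ) : ℂ) := fun p x hx hx0 => by
    simp only [hk, hx]
    rw [← Complex.ofReal_log hx0.le, Real.sqrt_eq_rpow, Real.rpow_def_of_pos hx0]
    push_cast
    ring_nf
  have hsD := isOpen_Dom s
  have hm := differentiableOn_mul_sub_one (Dom s)
  have hvd : DifferentiableOn ℂ (polV k) (Dom s) := hm.mul hkd
  have hd₁ : ∀ᶠ p in 𝓝ˢ unitDiag, pd1 (polV k) p ≠ 0 := by
    refine eventually_mem_of_continuousOn hs (differentiableOn_pd1 hsD hvd).continuousOn
      isOpen_compl_singleton fun p hp => ?_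
    have hpD := unitDiag_subset_Dom hs hp
    have hp1 := mul_eq_one_of_mem_unitDiag hp
    have e : pd1 (polV k) p = p.2 * k p := by
      have := pd1_mul hsD hm hkd hpD
      rw [pd1_mul_sub_one, hp1, sub_self, zero_mul, add_zero] at this
      exact this
    rw [mem_compl_singleton_iff, e]
    exact mul_ne_zero (right_ne_zero_of_mul_eq_one hp1) (hkne p)
  have hd₂ : ∀ᶠ p in 𝓝ˢ unitDiag, pd2 (polV k) p ≠ 0 := by
    refine eventually_mem_of_continuousOn hs (differentiableOn_pd2 hsD hvd).continuousOn
      isOpen_compl_singleton fun p hp => ?_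
    have hpD := unitDiag_subset_Dom hs hp
    have hp1 := mul_eq_one_of_mem_unitDiag hp
    have e : pd2 (polV k) p = p.1 * k p := by
      have := pd2_mul hsD hm hkd hpD
      rw [pd2_mul_sub_one, hp1, sub_self, zero_mul, add_zero] at this
      exact this
    rw [mem_compl_singleton_iff, e]
    exact mul_ne_zero (left_ne_zero_of_mul_eq_one hp1) (hkne p)
  obtain ⟨s', hs', -, hsub'⟩ := exists_Dom_subset ((hd₁.and hd₂).and (Dom_mem_nhdsSet hs))
  have hss : Dom s' ⊆ Dom s := fun p hp => (hsub' hp).2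
  have hsσ : Dom s' ⊆ Dom σ := fun p hp => (hsub (hss hp)).2
  have hane' : ∀ p ∈ Dom s', a₁ p ≠ 0 ∧ a₂ p ≠ 0 := fun p hp =>
    hane p (Dom_mono (min_le_right σ₁ σ₂) (hsσ hp))
  refine ⟨a₁, a₂, k, s', hs', ha₁.mono hsσ, ha₂.mono hsσ, hkd.mono hss, fun p _ => hkne p, ?_,
    fun p hp => mul_ne_zero (hane' p hp).1 (hsub' hp).1.1,
    fun p hp => mul_ne_zero (hane' p hp).2 (hsub' hp).1.2,
    fun p hp => (hsub (hss hp)).1.2, hpa₁, hpa₂, ?_⟩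
  · intro p hp
    exact ⟨_, Real.sqrt_pos.2 (hGpos p hp), hreal p (G p).re
      (Complex.ext (by simp) (by simp [(hGre p hp).2])) (hGpos p hp)⟩
  · have hV0 := fun z hz => hφ.eq_zero_of_mem_frontier hV hpos hneg (z := z) hz
    filter_upwards [hsq, hneg, hWF, hφ.frontier_eventually_mem, hφ.eventually_mem_Dom hs']
      with z h1 h2 h3 h4 h5
    set p : ℂ × ℂ := (φ z, conj (φ z)) with hp
    have e1 : p.1 * p.2 - 1 = ((‖φ z‖ ^ 2 - 1 : ℝ) : ℂ) := by
      rw [hp, Complex.mul_conj, Complex.normSq_eq_norm_sq]; push_cast; rfl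
    show (V z : ℂ) = (p.1 * p.2 - 1) * k p
    rw [e1]
    by_cases hn : ‖φ z‖ = 1
    · rw [hV0 z ((hφ.mem_frontier_iff h4).2 hn), hn]; simp
    have hx : ‖φ z‖ ^ 2 - 1 ≠ 0 := fun h => hn (by nlinarith [norm_nonneg (φ z)])
    have hx' : ((‖φ z‖ ^ 2 - 1 : ℝ) : ℂ) ≠ 0 := by exact_mod_cast hx
    have e2 : G p = ((V z ^ 2 / (‖φ z‖ ^ 2 - 1) ^ 2 : ℝ) : ℂ) := by
      have h6 := hFG p (hsσ h5)
      have h7 : toC W z = F p := h3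
      rw [e1, ← h7, toC, ← h1] at h6
      rw [Complex.ofReal_div, eq_div_iff (by simpa using hx')]
      push_cast at h6 ⊢
      linear_combination -h6
    have hpos' : 0 < V z ^ 2 / (‖φ z‖ ^ 2 - 1) ^ 2 := by
      have : 0 < (G p).re := (hsub (hss h5)).1.1
      rwa [e2, Complex.ofReal_re] at this
    rw [hreal p _ e2 hpos', ← Complex.ofReal_mul, Complex.ofReal_inj, Real.sqrt_div (sq_nonneg _),
      Real.sqrt_sq_eq_abs, Real.sqrt_sq_eq_abs]
    rcases lt_or_gt_of_ne hn with hlt | hgt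
    · have hVneg := h2 fun hcl => absurd (hφ.one_le_norm hcl) (not_le.2 hlt)
      have hxneg : ‖φ z‖ ^ 2 - 1 < 0 := by nlinarith [norm_nonneg (φ z)]
      rw [abs_of_neg hVneg, abs_of_neg hxneg]
      field_simp
    · have hVpos := hpos z ((hφ.mem_iff h4).2 hgt)
      have hxpos : 0 < ‖φ z‖ ^ 2 - 1 := by nlinarith [norm_nonneg (φ z)]
      rw [abs_of_pos hVpos, abs_of_pos hxpos]
      field_simp

end model

end IsExteriorMap

namespace IsModel

variable {Ω U : Set ℂ} {φ : ℂ → ℂ} {V : ℂ → ℝ} {a₁ a₂ k : ℂ × ℂ → ℂ} {σ₁ : ℝ}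

/-- The coefficients are continuous near the compact circle, and there `L₀ = |∂V|² / k` is positive,
so uniform bounds hold on a sufficiently small `Dom σ`. -/
theorem exists_good (hM : IsModel Ω φ V a₁ a₂ k σ₁) (hφ : IsExteriorMap Ω U φ) :
    ∃ σ A m : ℝ, σ ≤ σ₁ ∧ (coefs a₁ a₂ k).Good σ A m := by
  set C := coefs a₁ a₂ k with hC
  have hv := hM.diff_polV
  have d1v := hM.diff_d₁ hv
  have d2v := hM.diff_d₂ hv
  have d₁ : DifferentiableOn ℂ C.c₁ (Dom σ₁) := d2v.mul hM.diff_a₁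
  have d₂ : DifferentiableOn ℂ C.c₂ (Dom σ₁) := d1v.mul hM.diff_a₂
  have d₃ : DifferentiableOn ℂ C.c₃ (Dom σ₁) := hM.diff_d₁ d2v
  have d₄ : DifferentiableOn ℂ C.c₄ (Dom σ₁) := (d1v.mul d2v).mul hM.diff_inv
  have dκ : DifferentiableOn ℂ C.κ (Dom σ₁) := hM.diff_inv
  have dL₀ : DifferentiableOn ℂ C.L₀ (Dom σ₁) := ((d1v.mul d2v).mul hM.diff_polLog).const_mul 2
  have dL₁ : DifferentiableOn ℂ C.L₁ (Dom σ₁) := (hM.diff_d₁ (hM.diff_d₂ hM.diff_polLog)).const_mul _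
  have d₅ : DifferentiableOn ℂ C.c₅ (Dom σ₁) := hM.diff_c₅
  have hL₀pos : ∀ p ∈ unitDiag, 0 < (C.L₀ p).re := by
    intro p hp
    have hpD := unitDiag_subset_Dom hM.pos hp
    obtain ⟨r, hr, hkr⟩ := hM.k_pos p hp
    have h1 : ∃ x : ℝ, 0 < x ∧ ((a₁ * pd1 (polV k)) * (a₂ * pd2 (polV k))) p = x := by
      have hne := mul_ne_zero (hM.d₁_ne p hpD) (hM.d₂_ne p hpD)
      obtain ⟨z, hz, rfl⟩ := hφ.exists_pair_eq hp
      have h2 := (hM.gradSq_eventuallyEq hφ).self_of_nhdsSet hz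
      have h3 : ((a₁ * pd1 (polV k)) * (a₂ * pd2 (polV k))) (φ z, conj (φ z)) =
        ((‖dz (toC V) z‖ ^ 2 : ℝ) : ℂ) := h2.symm
      refine ⟨_, lt_of_le_of_ne (sq_nonneg _) fun h0 => hne ?_, h3⟩
      rw [← h0, Complex.ofReal_zero] at h3
      exact h3
    obtain ⟨x, hx, he⟩ := h1
    have e : C.L₀ p = ((x / r : ℝ) : ℂ) := by
      show 2 * (((a₁ * pd1 (polV k)) * (a₂ * pd2 (polV k))) p * polLog k p) = _
      rw [he, polLog, mul_eq_one_of_mem_unitDiag hp, dslope_same,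
        (Complex.hasDerivAt_log Complex.one_mem_slitPlane).deriv, hkr]
      push_cast
      ring
    rw [e, Complex.ofReal_re]
    positivity
  obtain ⟨p₀, hp₀, hmin⟩ := isCompact_unitDiag.exists_isMinOn (f := fun p => (C.L₀ p).re)
    ⟨(1, 1), by simp [unitDiag]⟩ (Complex.continuous_re.comp_continuousOn
      (dL₀.continuousOn.mono (unitDiag_subset_Dom hM.pos)))
  set m := min 1 ((C.L₀ p₀).re / 2) with hm
  have hm0 : 0 < m := lt_min one_pos (half_pos (hL₀pos p₀ hp₀))
  have hev1 : ∀ᶠ p in 𝓝ˢ unitDiag, m < (C.L₀ p).re :=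
    eventually_mem_of_continuousOn hM.pos dL₀.continuousOn
      (isOpen_lt continuous_const Complex.continuous_re) fun p hp => by
        have h1 : (C.L₀ p₀).re ≤ (C.L₀ p).re := hmin hp
        have h2 := min_le_right 1 ((C.L₀ p₀).re / 2)
        have h3 := hL₀pos p₀ hp₀
        show m < (C.L₀ p).re
        linarith
  set S : ℂ × ℂ → ℝ := fun p => ‖C.c₁ p‖ + ‖C.c₂ p‖ + ‖C.c₃ p‖ + ‖C.c₄ p‖ + ‖a₁ p‖ + ‖a₂ p‖ +
    ‖C.κ p‖ + ‖C.L₀ p‖ + ‖C.L₁ p‖ + ‖C.c₅ p‖ with hS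
  have hSc : ContinuousOn S (Dom σ₁) :=
    (((((((((d₁.continuousOn.norm).add d₂.continuousOn.norm).add d₃.continuousOn.norm).add
      d₄.continuousOn.norm).add hM.diff_a₁.continuousOn.norm).add
      hM.diff_a₂.continuousOn.norm).add dκ.continuousOn.norm).add dL₀.continuousOn.norm).add
      dL₁.continuousOn.norm).add d₅.continuousOn.norm
  obtain ⟨B, hB⟩ := isCompact_unitDiag.exists_bound_of_continuousOn
    (hSc.mono (unitDiag_subset_Dom hM.pos))
  have hev2 : ∀ᶠ p in 𝓝ˢ unitDiag, S p < |B| + 1 :=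
    eventually_mem_of_continuousOn hM.pos hSc isOpen_Iio fun p hp => by
      have h1 := hB p hp
      have h2 := le_abs_self (S p)
      have h3 := le_abs_self B
      rw [Real.norm_eq_abs] at h1
      rw [mem_Iio]
      linarith
  obtain ⟨σ, hσ, hσ1, hsub⟩ := exists_Dom_subset ((hev1.and hev2).and (Dom_mem_nhdsSet hM.pos))
  have hmono : Dom (min σ σ₁) ⊆ Dom σ₁ := Dom_mono (min_le_right _ _)
  have hmem : ∀ p ∈ Dom (min σ σ₁), m < (C.L₀ p).re ∧ S p < |B| + 1 := fun p hp =>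
    (hsub (Dom_mono (min_le_left _ _) hp)).1
  have key : ∀ F : ℂ × ℂ → ℂ, DifferentiableOn ℂ F (Dom σ₁) → (∀ p, ‖F p‖ ≤ S p) →
      Bd (min σ σ₁) F (|B| + 1) := fun F hF hFS =>
    ⟨hF.mono hmono, fun p hp => (hFS p).trans (hmem p hp).2.le⟩
  refine ⟨min σ σ₁, |B| + 1, m, min_le_right _ _, ?_⟩
  have hn : ∀ z : ℂ, 0 ≤ ‖z‖ := norm_nonneg
  refine ⟨key _ d₁ fun p => ?_, key _ d₂ fun p => ?_, key _ d₃ fun p => ?_, key _ d₄ fun p => ?_,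
    key a₁ hM.diff_a₁ fun p => ?_, key a₂ hM.diff_a₂ fun p => ?_, key _ dκ fun p => ?_,
    key _ dL₀ fun p => ?_, key _ dL₁ fun p => ?_, key _ d₅ fun p => ?_,
    fun p hp => (hmem p hp).1.le, lt_min hσ hM.pos, (min_le_left _ _).trans hσ1, hm0,
    min_le_left _ _, by linarith [abs_nonneg B]⟩
  all_goals
    simp only [hS]
    linarith [hn (C.c₁ p), hn (C.c₂ p), hn (C.c₃ p), hn (C.c₄ p), hn (a₁ p), hn (a₂ p),
      hn (C.κ p), hn (C.L₀ p), hn (C.L₁ p), hn (C.c₅ p)]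

end IsModel

end BerezinOP
end

noncomputable section
namespace BerezinOP

/-! ### The norm in terms of polarizations -/

section norms

variable {Ω U : Set ℂ} {φ : ℂ → ℂ} {σ B : ℝ} {f : ℂ → ℂ}

theorem hNorm_le {F : ℂ × ℂ → ℂ} (hF : Bd σ F B) (hf : f =ᶠ[𝓝ˢ (frontier Ω)] pull φ F) :
    hNorm (frontier Ω) φ σ f ≤ ENNReal.ofReal B := by
  refine iInf₂_le_of_le (fun p => F (p.1, conj p.2)) ⟨?_, hf⟩ (iSup₂_le fun p hp => ?_)
  · show DifferentiableOn ℂ (fun p : ℂ × ℂ => F (p.1, conj (conj p.2))) (Dom σ)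
    simp only [Complex.conj_conj]
    exact hF.diff
  · rw [← ofReal_norm]
    refine ENNReal.ofReal_le_ofReal (hF.le _ ?_)
    rw [Dom, mem_ofPred_eq]
    simpa using hp

theorem memH_of_bd {F : ℂ × ℂ → ℂ} (hF : Bd σ F B) (hf : f =ᶠ[𝓝ˢ (frontier Ω)] pull φ F) :
    MemH (frontier Ω) φ σ f :=
  (hNorm_le hF hf).trans_lt ENNReal.ofReal_lt_top

theorem IsPolarization.exists_bd {F' : ℂ × ℂ → ℂ} (hF' : IsPolarization (frontier Ω) φ σ f F')
    (hfin : (⨆ p ∈ fatAnnulus σ, ‖F' p‖ₑ) ≠ ∞) : ∃ F : ℂ × ℂ → ℂ,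
      Bd σ F (⨆ p ∈ fatAnnulus σ, ‖F' p‖ₑ).toReal ∧ f =ᶠ[𝓝ˢ (frontier Ω)] pull φ F := by
  refine ⟨fun p => F' (p.1, conj p.2), ⟨hF'.1, fun p hp => ?_⟩, ?_⟩
  · have h : ‖F' (p.1, conj p.2)‖ₑ ≤ ⨆ p ∈ fatAnnulus σ, ‖F' p‖ₑ :=
      le_iSup₂ (f := fun p (_ : p ∈ fatAnnulus σ) => ‖F' p‖ₑ) _ hp
    rw [← toReal_enorm]
    exact ENNReal.toReal_mono hfin h
  · filter_upwards [hF'.2] with z hz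
    simpa [pull] using hz

/-- A bound relative to small polarizations is a bound relative to the norm. -/
theorem hNorm_le_mul_hNorm {g : ℂ → ℂ} {F₀ : ℂ × ℂ → ℂ} {M c s : ℝ} (hM : 0 ≤ M) (hc : 0 ≤ c)
    (hF₀ : Bd σ F₀ M) (hf : f =ᶠ[𝓝ˢ (frontier Ω)] pull φ F₀)
    (h : ∀ (F : ℂ × ℂ → ℂ) (N : ℝ), 0 ≤ N → N ≤ M → Bd σ F N → f =ᶠ[𝓝ˢ (frontier Ω)] pull φ F →
      hNorm (frontier Ω) φ s g ≤ ENNReal.ofReal (c * N)) :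
    hNorm (frontier Ω) φ s g ≤ ENNReal.ofReal c * hNorm (frontier Ω) φ σ f := by
  have hbase := h F₀ M hM le_rfl hF₀ hf
  rcases hc.eq_or_lt with rfl | hc
  · simpa using hbase
  have hc0 : ENNReal.ofReal c ≠ 0 := by simpa using hc
  conv_rhs => rw [hNorm, ENNReal.mul_iInf_of_ne hc0 ENNReal.ofReal_ne_top]
  refine le_iInf fun F' => ?_
  rw [ENNReal.mul_iInf_of_ne hc0 ENNReal.ofReal_ne_top]
  refine le_iInf fun hF' => ?_
  -- A polarization with supremum at least `M` is covered by the bound obtained from `F₀`; any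
  -- smaller one is used itself. Uniqueness of the polarization is not needed.
  rcases le_total (ENNReal.ofReal M) (⨆ p ∈ fatAnnulus σ, ‖F' p‖ₑ) with hle | hle
  · refine hbase.trans ?_
    rw [ENNReal.ofReal_mul hc.le]
    gcongr
  · have hfin : (⨆ p ∈ fatAnnulus σ, ‖F' p‖ₑ) ≠ ∞ := ne_top_of_le_ne_top ENNReal.ofReal_ne_top hle
    obtain ⟨F, hF, hfF⟩ := hF'.exists_bd hfin
    have := h F _ ENNReal.toReal_nonneg (ENNReal.toReal_le_of_le_ofReal hM hle) hF hfF
    rwa [ENNReal.ofReal_mul hc.le, ENNReal.ofReal_toReal hfin] at this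

end norms

/-! ### Iteration of a contraction with loss of domain -/

/-- An operator which, with a loss `δ` of domain, is a contraction with constant `q` on the ball of
radius `2 M`. -/
def IsLossyContraction (T : (ℂ × ℂ → ℂ) → ℂ × ℂ → ℂ) (σ₀ δ q M : ℝ) : Prop :=
  ∀ σ, σ ≤ σ₀ → δ < σ → ∀ F G, Bd σ F (2 * M) → Bd σ G (2 * M) → ∀ d, 0 ≤ d → Bd σ (F - G) d →
    Bd (σ - δ) (T F - T G) (q * d)

namespace IsLossyContraction

variable {T : (ℂ × ℂ → ℂ) → ℂ × ℂ → ℂ} {σ₀ δ q M : ℝ} {n : ℕ}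
  (hT : IsLossyContraction T σ₀ δ q M) (hδ : 0 < δ) (hq0 : 0 ≤ q) (hq : q ≤ 1 / 2) (hM : 0 ≤ M)
  (hT0 : Bd σ₀ (T 0) M) (hn : (n + 1) * δ ≤ σ₀)

include hT hδ hq0 hq hM hT0 hn

/-- Consecutive iterates approach each other with ratio at most `1/2`, so the orbit of `0` stays
below `M (1 + 1/2 + ...)`, inside the ball of radius `2 M` where the contraction property holds. -/
theorem bd_iterate_zero {j : ℕ} (hj : j ≤ n) :
    Bd (σ₀ - j * δ) (T^[j] 0) (2 * M) ∧
    Bd (σ₀ - j * δ) (T^[j + 1] 0) (M * (2 - (1 / 2) ^ j)) ∧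
    Bd (σ₀ - j * δ) (T^[j + 1] 0 - T^[j] 0) (q ^ j * M) := by
  induction j with
  | zero =>
    have h0 : σ₀ - ((0 : ℕ) : ℝ) * δ = σ₀ := by simp
    rw [h0]
    refine ⟨Bd.zero (by linarith), ?_, ?_⟩
    · simpa [show M * (2 - 1) = M by ring] using hT0
    · simpa using hT0
  | succ j ih =>
    obtain ⟨h1, h2, h3⟩ := ih (by omega)
    have hj' : ((j : ℝ) + 1) ≤ n := by exact_mod_cast hj
    have hp : (0 : ℝ) ≤ (1 / 2) ^ j := by positivity
    have h2' : Bd (σ₀ - j * δ) (T^[j + 1] 0) (2 * M) := h2.weaken (by nlinarith)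
    have hlt : δ < σ₀ - j * δ := by nlinarith
    have hstep := hT (σ₀ - j * δ) (by nlinarith [(Nat.cast_nonneg j : (0 : ℝ) ≤ j)]) hlt _ _ h2' h1
      (q ^ j * M) (by positivity) h3
    have hs : σ₀ - ((j + 1 : ℕ) : ℝ) * δ = σ₀ - j * δ - δ := by push_cast; ring
    rw [hs]
    have hle : σ₀ - j * δ - δ ≤ σ₀ - j * δ := by linarith
    have hd : Bd (σ₀ - j * δ - δ) (T^[j + 1 + 1] 0 - T^[j + 1] 0) (q ^ (j + 1) * M) := by
      rw [Function.iterate_succ_apply' T (j + 1), pow_succ', mul_assoc]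
      have e : T^[j + 1] 0 = T (T^[j] 0) := Function.iterate_succ_apply' T j 0
      nth_rewrite 2 [e]
      exact hstep
    refine ⟨h2'.mono hle, ?_, hd⟩
    have e : T^[j + 1 + 1] 0 = T^[j + 1] 0 + (T^[j + 1 + 1] 0 - T^[j + 1] 0) := by abel
    rw [e]
    refine ((h2.mono hle).add hd).weaken ?_
    have : q ^ (j + 1) ≤ (1 / 2) ^ (j + 1) := by gcongr
    rw [pow_succ (1 / 2 : ℝ) j] at *
    nlinarith

/-- The second orbit stays in the ball because `2 - (1/2)^j` and `(1/2)^(j+1)` add up to at most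
`2`. The start `F` is left general so that it can be any polarization of `E_0`, with its own
supremum `N`. -/
theorem bd_iterate_sub {F : ℂ × ℂ → ℂ} {N : ℝ} (hN0 : 0 ≤ N) (hN : N ≤ M) (hF : Bd σ₀ F N) {j : ℕ}
    (hj : j ≤ n) : Bd (σ₀ - j * δ) (T^[j] F) (2 * M) ∧
    Bd (σ₀ - j * δ) (T^[j] 0 - T^[j] F) (q ^ j * N) := by
  induction j with
  | zero =>
    have h0 : σ₀ - ((0 : ℕ) : ℝ) * δ = σ₀ := by simp
    rw [h0]
    refine ⟨hF.weaken (by linarith), ?_⟩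
    have : Bd σ₀ (0 - F) (0 + N) := (Bd.zero le_rfl).sub hF
    simpa using this
  | succ j ih =>
    obtain ⟨h1, h2⟩ := ih (by omega)
    obtain ⟨h3, h4, -⟩ := bd_iterate_zero hT hδ hq0 hq hM hT0 hn (j := j) (by omega)
    have hj' : ((j : ℝ) + 1) ≤ n := by exact_mod_cast hj
    have hlt : δ < σ₀ - j * δ := by nlinarith
    have hstep := hT (σ₀ - j * δ) (by nlinarith [(Nat.cast_nonneg j : (0 : ℝ) ≤ j)]) hlt _ _ h3 h1
      (q ^ j * N) (by positivity) h2
    have hs : σ₀ - ((j + 1 : ℕ) : ℝ) * δ = σ₀ - j * δ - δ := by push_cast; ring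
    rw [hs]
    have hle : σ₀ - j * δ - δ ≤ σ₀ - j * δ := by linarith
    have hd : Bd (σ₀ - j * δ - δ) (T^[j + 1] 0 - T^[j + 1] F) (q ^ (j + 1) * N) := by
      rw [Function.iterate_succ_apply' T j 0, Function.iterate_succ_apply' T j F, pow_succ', mul_assoc]
      exact hstep
    refine ⟨?_, hd⟩
    have e : T^[j + 1] F = T^[j + 1] 0 - (T^[j + 1] 0 - T^[j + 1] F) := by abel
    rw [e]
    refine ((h4.mono hle).sub hd).weaken ?_
    have h5 : q ^ (j + 1) ≤ (1 / 2) ^ (j + 1) := by gcongr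
    have h6 : q ^ (j + 1) * N ≤ (1 / 2) ^ (j + 1) * M := by gcongr
    have h7 : (0 : ℝ) ≤ (1 / 2) ^ j := by positivity
    rw [pow_succ (1 / 2 : ℝ) j] at h6
    nlinarith

end IsLossyContraction

/-! ### The iteration estimate -/

/-- As long as an iterate lies in the ball, the real part is positive and `opT_eventuallyEq` applies
once more; hence bounds for `j ≤ n` identify the germs up to `n + 1`. -/
theorem iterate_eventuallyEq_pull {Ω U : Set ℂ} {φ : ℂ → ℂ} {V : ℂ → ℝ} {a₁ a₂ k : ℂ × ℂ → ℂ}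
    {s₁ A m M K ε σ₀ δ : ℝ} {ϑ : ℂ} {n : ℕ}
    (hM : IsModel Ω φ V a₁ a₂ k s₁) (hφ : IsExteriorMap Ω U φ) (hC : (coefs a₁ a₂ k).Good s₁ A m)
    (hL : ∀ σ δ : ℝ, σ ≤ s₁ / 2 → 0 < δ → δ < σ → ‖ϑ‖ ≤ ε * δ ^ 2 →
      ∀ F : ℂ × ℂ → ℂ, Bd σ F (2 * M) →
        DifferentiableOn ℂ ((coefs a₁ a₂ k).opT ϑ F) (Dom (σ - δ)) ∧
        (∀ p ∈ Dom (σ - δ / 2), 0 < ((coefs a₁ a₂ k).lam ϑ F p).re) ∧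
        ∀ G : ℂ × ℂ → ℂ, Bd σ G (2 * M) → ∀ d : ℝ, Bd σ (F - G) d → 0 ≤ d →
          Bd (σ - δ) ((coefs a₁ a₂ k).opT ϑ F - (coefs a₁ a₂ k).opT ϑ G) (K * (‖ϑ‖ / δ ^ 2) * d))
    (hσ : σ₀ ≤ s₁ / 2) (hδ : 0 < δ) (hn : (n + 1) * δ < σ₀) (hϑ : ‖ϑ‖ ≤ ε * δ ^ 2)
    {f : ℂ → ℂ} {F : ℂ × ℂ → ℂ} (hf : f =ᶠ[𝓝ˢ (frontier Ω)] pull φ F)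
    (hF : ∀ j ≤ n, Bd (σ₀ - j * δ) (((coefs a₁ a₂ k).opT ϑ)^[j] F) (2 * M)) {j : ℕ}
    (hj : j ≤ n + 1) :
    (opT Ω φ V ϑ)^[j] f =ᶠ[𝓝ˢ (frontier Ω)] pull φ (((coefs a₁ a₂ k).opT ϑ)^[j] F) := by
  induction j with
  | zero => exact hf
  | succ j ih =>
    have ih := ih (by omega)
    rw [Function.iterate_succ_apply', Function.iterate_succ_apply']
    have hB := hF j (by omega)
    have hj' : (j : ℝ) ≤ n := by exact_mod_cast (by omega : j ≤ n)
    have hj0 : (0 : ℝ) ≤ j := Nat.cast_nonneg j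
    have hs1 := hC.σ_pos
    have hle : σ₀ - j * δ ≤ s₁ / 2 := by nlinarith
    have hlt : δ < σ₀ - j * δ := by nlinarith
    obtain ⟨-, hre, -⟩ := hL _ δ hle hδ hlt hϑ _ hB
    exact hM.opT_eventuallyEq hφ ϑ (by linarith) (by linarith) (by linarith) hB.diff ih
      ((hC.differentiableOn_lam (by linarith) ϑ hB.diff).mono (Dom_mono (by linarith))) hre

theorem norm_mul_sq_mul_le_one {ϑ : ℂ} {k : ℕ} {c x : ℝ} (hc : 0 < c) (hϑ : ϑ ≠ 0)
    (h : (k : ℝ) ≤ x * ‖ϑ‖ ^ (-(1 / 2) : ℝ) * c ^ (-(1 / 2) : ℝ)) :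
    c * ‖ϑ‖ * (k : ℝ) ^ 2 ≤ x ^ 2 := by
  have hϑ' := norm_pos_iff.2 hϑ
  have hsq : ∀ y : ℝ, 0 < y → y * (y ^ (-(1 / 2) : ℝ)) ^ 2 = 1 := fun y hy => by
    rw [← Real.rpow_natCast, ← Real.rpow_mul hy.le]
    norm_num
    rw [Real.rpow_neg_one, mul_inv_cancel₀ hy.ne']
  have hk : (0 : ℝ) ≤ k := Nat.cast_nonneg k
  calc c * ‖ϑ‖ * (k : ℝ) ^ 2
      ≤ c * ‖ϑ‖ * (x * ‖ϑ‖ ^ (-(1 / 2) : ℝ) * c ^ (-(1 / 2) : ℝ)) ^ 2 := by gcongr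
    _ = (c * (c ^ (-(1 / 2) : ℝ)) ^ 2) * (‖ϑ‖ * (‖ϑ‖ ^ (-(1 / 2) : ℝ)) ^ 2) * x ^ 2 := by ring
    _ = x ^ 2 := by rw [hsq c hc, hsq _ hϑ']; ring

theorem two_le_constC2 (C₁ σs : ℝ) : 2 ≤ constC2 C₁ σs := by
  have := le_max_left 1 (C₁ * (16 / σs ^ 4 + 64 / σs ^ 6))
  rw [constC2]; linarith

theorem le_constC2 {C₁ σs : ℝ} (h1 : 0 ≤ C₁) (h0 : 0 < σs) (hσ : σs ≤ 1) :
    32 * C₁ / σs ^ 2 ≤ constC2 C₁ σs := by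
  have h := le_max_right 1 (C₁ * (16 / σs ^ 4 + 64 / σs ^ 6))
  have h2 : 16 / σs ^ 2 ≤ 16 / σs ^ 4 :=
    div_le_div_of_nonneg_left (by norm_num) (by positivity) (pow_le_pow_of_le_one h0.le hσ (by norm_num))
  have h3 : 0 ≤ 64 / σs ^ 6 := by positivity
  have h4 : C₁ * (16 / σs ^ 2) ≤ C₁ * (16 / σs ^ 4 + 64 / σs ^ 6) := by gcongr; linarith
  have e : 32 * C₁ / σs ^ 2 = 2 * (C₁ * (16 / σs ^ 2)) := by ring
  rw [constC2, e]
  linarith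

/-- The iteration estimate for a fixed parameter `ϑ`. -/
theorem iteration_estimate {Ω U : Set ℂ} {φ : ℂ → ℂ} {V : ℂ → ℝ} {a₁ a₂ κ : ℂ × ℂ → ℂ}
    {s₁ A m M K ε σs C₁ : ℝ} {ϑ : ℂ}
    (hM : IsModel Ω φ V a₁ a₂ κ s₁) (hφ : IsExteriorMap Ω U φ) (hC : (coefs a₁ a₂ κ).Good s₁ A m)
    (hM0 : 0 < M) (hK : 0 < K)
    (hT0 : Bd (s₁ / 2) ((coefs a₁ a₂ κ).opT ϑ 0) M)
    (hL : ∀ σ δ : ℝ, σ ≤ s₁ / 2 → 0 < δ → δ < σ → ‖ϑ‖ ≤ ε * δ ^ 2 →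
      ∀ F : ℂ × ℂ → ℂ, Bd σ F (2 * M) →
        DifferentiableOn ℂ ((coefs a₁ a₂ κ).opT ϑ F) (Dom (σ - δ)) ∧
        (∀ p ∈ Dom (σ - δ / 2), 0 < ((coefs a₁ a₂ κ).lam ϑ F p).re) ∧
        ∀ G : ℂ × ℂ → ℂ, Bd σ G (2 * M) → ∀ d : ℝ, Bd σ (F - G) d → 0 ≤ d →
          Bd (σ - δ) ((coefs a₁ a₂ κ).opT ϑ F - (coefs a₁ a₂ κ).opT ϑ G) (K * (‖ϑ‖ / δ ^ 2) * d))
    (hσ0 : 0 < σs) (hσ : σs ≤ s₁ / 2) (hC₁K : K ≤ C₁) (hC₁ε : 1 ≤ C₁ * ε) {k : ℕ} (hk : 1 ≤ k)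
    (hkϑ : constC2 C₁ σs * ‖ϑ‖ * (k : ℝ) ^ 2 ≤ 1) :
    hNorm (frontier Ω) φ σs (calE Ω φ V ϑ 0) ≤ ENNReal.ofReal M ∧
    MemH (frontier Ω) φ (σs / 2) (calE Ω φ V ϑ k) ∧
    MemH (frontier Ω) φ (σs / 2) (opT Ω φ V ϑ (calE Ω φ V ϑ k)) ∧
    hNorm (frontier Ω) φ (σs / 2) (calE Ω φ V ϑ k - opT Ω φ V ϑ (calE Ω φ V ϑ k)) ≤
      ENNReal.ofReal ((1 / 2 * constC2 C₁ σs * ‖ϑ‖ * (k : ℝ) ^ 2) ^ k) *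
        hNorm (frontier Ω) φ σs (calE Ω φ V ϑ 0) := by
  set C := coefs a₁ a₂ κ with hCdef
  set T := C.opT ϑ with hT
  set n := k + 1 with hn
  have hk1 : (1 : ℝ) ≤ k := by exact_mod_cast hk
  have hncast : (n : ℝ) = k + 1 := by rw [hn]; push_cast; ring
  -- The `k + 1` equal steps use up `σs / 2`. One more application, needed for `T[E_k]`, still fits
  -- because `δ < σs / 2`.
  set δ : ℝ := σs / (2 * (k + 1)) with hδdef
  have hδ : 0 < δ := by positivity
  have hnδ : (n : ℝ) * δ = σs / 2 := by rw [hncast, hδdef]; field_simp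
  have hδlt : δ < σs / 2 := by
    rw [hδdef, div_lt_div_iff₀ (by positivity) (by norm_num)]
    nlinarith
  have hn1 : ((n : ℝ) + 1) * δ < σs := by rw [add_mul, hnδ]; linarith
  have hC₁ : 0 < C₁ := hK.trans_le hC₁K
  have hσ1 : σs ≤ 1 := by linarith [hC.σ_le, hC.σ_pos]
  set X : ℝ := 1 / 2 * constC2 C₁ σs * ‖ϑ‖ * (k : ℝ) ^ 2 with hX
  have hX0 : 0 ≤ X := by
    have := two_le_constC2 C₁ σs
    positivity
  have hX1 : X ≤ 1 / 2 := by
    have : X = 1 / 2 * (constC2 C₁ σs * ‖ϑ‖ * (k : ℝ) ^ 2) := by rw [hX]; ring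
    rw [this]; linarith
  -- Here `(2 (k + 1))² ≤ 16 k²` because `k ≥ 1`, and of `C₂` only the lower bound `32 C₁ / σs²` is
  -- used.
  have hratio : C₁ * (‖ϑ‖ / δ ^ 2) ≤ X := by
    have h1 := le_constC2 hC₁.le hσ0 hσ1
    have h2 : ‖ϑ‖ / δ ^ 2 ≤ 16 * ‖ϑ‖ * (k : ℝ) ^ 2 / σs ^ 2 := by
      rw [hδdef, div_pow, div_div_eq_mul_div]
      refine div_le_div_of_nonneg_right ?_ (by positivity)
      have : (2 * ((k : ℝ) + 1)) ^ 2 ≤ 16 * (k : ℝ) ^ 2 := by nlinarith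
      nlinarith [norm_nonneg ϑ]
    calc C₁ * (‖ϑ‖ / δ ^ 2) ≤ C₁ * (16 * ‖ϑ‖ * (k : ℝ) ^ 2 / σs ^ 2) := by gcongr
      _ = 1 / 2 * (32 * C₁ / σs ^ 2) * ‖ϑ‖ * (k : ℝ) ^ 2 := by ring
      _ ≤ X := by rw [hX]; gcongr
  set q : ℝ := K * (‖ϑ‖ / δ ^ 2) with hq
  have hq0 : 0 ≤ q := by positivity
  have hqX : q ≤ X := le_trans (by rw [hq]; gcongr) hratio
  have hϑδ : ‖ϑ‖ ≤ ε * δ ^ 2 := by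
    rw [← div_le_iff₀ (by positivity)]
    have h1 : C₁ * (‖ϑ‖ / δ ^ 2) ≤ C₁ * ε := by linarith
    exact le_of_mul_le_mul_left h1 hC₁
  have hlossy : IsLossyContraction T σs δ q M := fun σ hσσ hδσ F G hF hG d hd hFG =>
    (hL σ δ (hσσ.trans hσ) hδ hδσ hϑδ F hF).2.2 G hG d hFG hd
  have hT0' : Bd σs (T 0) M := hT0.mono hσ
  have hzero := fun j (hj : j ≤ n) =>
    hlossy.bd_iterate_zero hδ hq0 (hqX.trans hX1) hM0.le hT0' hn1.le (j := j) hj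
  have hs : σs - (n : ℝ) * δ = σs / 2 := by rw [hnδ]; ring
  have germ : ∀ {f : ℂ → ℂ} {F : ℂ × ℂ → ℂ}, f =ᶠ[𝓝ˢ (frontier Ω)] pull φ F →
      (∀ j ≤ n, Bd (σs - j * δ) (T^[j] F) (2 * M)) → ∀ j ≤ n + 1,
      (opT Ω φ V ϑ)^[j] f =ᶠ[𝓝ˢ (frontier Ω)] pull φ (T^[j] F) := fun hf hF j hj =>
    iterate_eventuallyEq_pull hM hφ hC hL hσ hδ hn1 hϑδ hf hF hj
  have germ0 := germ (f := 0) (F := 0) (Eventually.of_forall fun _ => rfl) fun j hj => (hzero j hj).1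
  have gE0 : calE Ω φ V ϑ 0 =ᶠ[𝓝ˢ (frontier Ω)] pull φ (T 0) := germ0 1 (by omega)
  have gEk : calE Ω φ V ϑ k =ᶠ[𝓝ˢ (frontier Ω)] pull φ (T^[n] 0) := germ0 n (by omega)
  have gTEk : opT Ω φ V ϑ (calE Ω φ V ϑ k) =ᶠ[𝓝ˢ (frontier Ω)] pull φ (T^[n + 1] 0) := by
    have := germ0 (n + 1) le_rfl
    rwa [Function.iterate_succ_apply'] at this
  have hn' := hzero n le_rfl
  rw [hs] at hn'
  refine ⟨hNorm_le hT0' gE0, memH_of_bd hn'.1 gEk, memH_of_bd hn'.2.1 gTEk, ?_⟩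
  refine hNorm_le_mul_hNorm hM0.le (by positivity) hT0' gE0 fun F N hN0 hN hF hfF => ?_
  have hsub := fun j (hj : j ≤ n) => hlossy.bd_iterate_sub hδ hq0 (hqX.trans hX1) hM0.le hT0'
    hn1.le hN0 hN hF (j := j) hj
  have gF := germ hfF (fun j hj => (hsub j hj).1) n (by omega)
  -- Both sides are `T^{k+2}[0]`, so the error compares the orbits of `0` and `E_0` after `n = k +
  -- 1` steps.
  have e : (opT Ω φ V ϑ)^[n] (calE Ω φ V ϑ 0) = opT Ω φ V ϑ (calE Ω φ V ϑ k) := by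
    rw [calE, calE, ← Function.iterate_add_apply,
      ← Function.iterate_succ_apply' (opT Ω φ V ϑ) (k + 1)]
  rw [e] at gF
  have hfin := (hsub n le_rfl).2
  rw [hs] at hfin
  refine (hNorm_le hfin ?_).trans (ENNReal.ofReal_le_ofReal ?_)
  · filter_upwards [gEk, gF] with z h1 h2
    rw [Pi.sub_apply, h1, h2]
    rfl
  · gcongr
    -- One of the `k + 1` available factors is given away, as `q ≤ 1`.
    calc q ^ n ≤ q ^ k := pow_le_pow_of_le_one hq0 (by linarith) (by omega)
      _ ≤ X ^ k := by gcongr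

/-- Taking the integer part loses at most one unit in the exponent, hence at most a factor `8`. -/
theorem exp_floor_bound {x X : ℝ} {k : ℕ} (hX0 : 0 ≤ X) (hX : X ≤ 1 / 8)
    (hk : k = ⌊1 / 2 * x⌋₊) : X ^ k ≤ 8 * Real.exp (-(Real.log 8 / 2) * x) := by
  have h1 : 1 / 2 * x < k + 1 := by rw [hk]; exact Nat.lt_floor_add_one _
  have h2 : (1 / 8 : ℝ) ^ k = Real.exp (-(Real.log 8) * k) := by
    rw [mul_comm, Real.exp_nat_mul, Real.exp_neg, Real.exp_log (by norm_num)]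
    norm_num
  have h3 : 0 < Real.log 8 := Real.log_pos (by norm_num)
  calc X ^ k ≤ (1 / 8) ^ k := by gcongr
    _ = Real.exp (-(Real.log 8) * k) := h2
    _ ≤ Real.exp (Real.log 8 + -(Real.log 8 / 2) * x) := by
      rw [Real.exp_le_exp]; nlinarith
    _ = 8 * Real.exp (-(Real.log 8 / 2) * x) := by
      rw [Real.exp_add, Real.exp_log (by norm_num)]

theorem IsExteriorMap.exists_annulus_subset {Ω U : Set ℂ} {φ : ℂ → ℂ} (hφ : IsExteriorMap Ω U φ) :
    ∃ σ : ℝ, 0 < σ ∧ σ ≤ 1 ∧ ∀ s, s < σ → annulus s ⊆ φ '' U := by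
  obtain ⟨σ, h0, h1, hsub⟩ := exists_Dom_subset hφ.eventually_mem_image
  refine ⟨σ, h0, h1, fun s hs z hz => ?_⟩
  have hr := rho_strictAnti hs
  have hz' : z ∈ openAnnulus σ :=
    ⟨hr.trans_le hz.1, hz.2.trans_lt ((inv_lt_inv₀ (rho_pos s) (rho_pos σ)).2 hr)⟩
  have hp : (z, conj z) ∈ Dom σ := mem_Dom.2 ⟨hz', by simpa [openAnnulus] using hz', by simpa using h0⟩
  exact (hsub hp).1

end BerezinOP
end


/-! ### Choice of the constants and proof of the two estimates. -/

open BerezinOP in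
theorem theorem8p1 (Q : ℂ → ℝ) (τ : ℝ) (hQ : IsAdmissible Q τ)
    (Ω Γ : Set ℂ) (hΩ : Ω = outerDomain Q τ) (hΓ : Γ = frontier Ω)
    (U : Set ℂ) (φ : ℂ → ℂ) (hφ : IsExteriorMap Ω U φ)
    (Qb V : ℂ → ℝ) (hV : IsSignedRoot Q τ Qb V) :
    ∃ σ₀ : ℝ, 0 < σ₀ ∧ σ₀ < 1 ∧ annulus σ₀ ⊆ φ '' U ∧
    ∃ C₁ : ℝ, 0 < C₁ ∧
    ∀ σs : ℝ, 0 < σs → σs ≤ σ₀ →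
    ∃ ϱ₀ : ℝ, 0 < ϱ₀ ∧
      -- the iteration estimate
      (∀ ϑ : ℂ, ‖ϑ‖ < ϱ₀ → ∀ k : ℕ, 1 ≤ k →
        (ϑ = 0 ∨ (k : ℝ) ≤ ‖ϑ‖ ^ (-(1 / 2) : ℝ) * constC2 C₁ σs ^ (-(1 / 2) : ℝ)) →
        MemH Γ φ σs (calE Ω φ V ϑ 0) ∧
        MemH Γ φ (σs / 2) (calE Ω φ V ϑ k) ∧
        MemH Γ φ (σs / 2) (opT Ω φ V ϑ (calE Ω φ V ϑ k)) ∧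
        hNorm Γ φ (σs / 2) (calE Ω φ V ϑ k - opT Ω φ V ϑ (calE Ω φ V ϑ k)) ≤
          ENNReal.ofReal ((1 / 2 * constC2 C₁ σs * ‖ϑ‖ * (k : ℝ) ^ 2) ^ k) *
            hNorm Γ φ σs (calE Ω φ V ϑ 0)) ∧
      -- the resulting approximate fixed points
      (∃ C₀ c₀ : ℝ, 0 < C₀ ∧ 0 < c₀ ∧ ∀ ϑ : ℂ, ϑ ≠ 0 → ‖ϑ‖ < ϱ₀ → ∀ k : ℕ,
        k = ⌊1 / 2 * ‖ϑ‖ ^ (-(1 / 2) : ℝ) * constC2 C₁ σs ^ (-(1 / 2) : ℝ)⌋₊ →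
        hNorm Γ φ (σs / 2) (calE Ω φ V ϑ k - opT Ω φ V ϑ (calE Ω φ V ϑ k)) ≤
          ENNReal.ofReal (C₀ * Real.exp (-c₀ * ‖ϑ‖ ^ (-(1 / 2) : ℝ)))) := by
  subst hΓ
  have hcl : frontier Ω ⊆ closure Ω := frontier_subset_closure
  have hVd : ∀ z ∈ frontier Ω, DifferentiableAt ℝ V z := fun z hz =>
    (hV.smooth z (hΩ ▸ hcl hz)).differentiableAt (by norm_num)
  have hsq : ∀ᶠ z in 𝓝ˢ (frontier Ω), V z ^ 2 = (Q - Qb) z := by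
    have h := hV.sq
    rw [← hΩ] at h
    exact h.filter_mono (nhdsSet_mono hcl)
  have hneg : ∀ᶠ z in 𝓝ˢ (frontier Ω), z ∉ closure Ω → V z < 0 := by
    have h := hV.neg
    rw [← hΩ] at h
    exact h.filter_mono (nhdsSet_mono hcl)
  have hQb : ∀ z ∈ frontier Ω, InnerProductSpace.HarmonicAt Qb z := fun z hz =>
    hV.harmonic z (hΩ ▸ hcl hz)
  have hW : ∀ z ∈ frontier Ω, AnalyticAt ℝ (Q - Qb) z := fun z hz =>
    (hQ.analytic z (hΩ ▸ hz)).sub (HarmonicAt.analyticAt (hQb z hz))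
  have hΔ : ∀ z ∈ frontier Ω, Laplacian.laplacian (Q - Qb) z ≠ 0 := fun z hz => by
    rw [hQ.smooth.contDiffAt.laplacian_sub (hQb z hz).1, (hQb z hz).2.self_of_nhds]
    have h := hQ.strict.self_of_nhdsSet z (hΩ ▸ hz)
    simpa using h.ne'
  obtain ⟨a₁, a₂, κ, s, hM'⟩ := hφ.exists_isModel hVd hsq (fun z hz => hV.pos z (hΩ ▸ hz)) hneg hW hΔ
  obtain ⟨s₁, A, m, hs₁, hC⟩ := hM'.exists_good hφ
  have hM := hM'.mono hC.σ_pos hs₁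
  obtain ⟨M, K, ε, hM0, hK, hε, hL⟩ := hC.exists_lipschitz_opT
  obtain ⟨s₂, hs₂, hs₂1, hann⟩ := hφ.exists_annulus_subset
  have hs₁0 := hC.σ_pos
  -- `s₁ / 2` is where `T[0]` is bounded, and `s₂ / 2` puts the closed annulus in the image of `φ`.
  -- `C₁` dominates the Lipschitz constant `K` and also `1/ε`, so that `C₂ ‖ϑ‖ k² ≤ 1` implies the
  -- smallness `‖ϑ‖ ≤ ε δ²` required at each step.
  refine ⟨min (s₁ / 2) (s₂ / 2), by positivity, (min_le_right _ _).trans_lt (by linarith),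
    hann _ ((min_le_right _ _).trans_lt (by linarith)), max K (1 / ε), lt_max_of_lt_left hK,
    fun σs hσ0 hσ => ?_⟩
  set C₁ := max K (1 / ε) with hC₁
  set C₂ := constC2 C₁ σs with hC₂
  have hC₂2 : 2 ≤ C₂ := two_le_constC2 C₁ σs
  have hC₂0 : 0 < C₂ := by linarith
  have hC₁ε : 1 ≤ C₁ * ε := by
    have := le_max_right K (1 / ε)
    rwa [div_le_iff₀ hε] at this
  have main : ∀ ϑ : ℂ, ‖ϑ‖ ≤ ε → ∀ k : ℕ, 1 ≤ k → C₂ * ‖ϑ‖ * (k : ℝ) ^ 2 ≤ 1 → _ :=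
    fun ϑ hϑ k hk hkϑ => iteration_estimate hM hφ hC hM0 hK (hL ϑ hϑ).1 (hL ϑ hϑ).2.2 hσ0
      (hσ.trans (min_le_left _ _)) (le_max_left K (1 / ε)) hC₁ε hk hkϑ
  -- The bound `1 / (4 C₂)` makes the integer part in the second claim at least one, since the
  -- iteration estimate needs `k ≥ 1`. In `8 * M` the `8` comes from the integer part and `M` bounds
  -- the norm of `E_0` uniformly in `ϑ`.
  refine ⟨min ε (1 / (4 * C₂)), by positivity, fun ϑ hϑ k hk hor => ?_, 8 * M,
    Real.log 8 / 2 * C₂ ^ (-(1 / 2) : ℝ), by positivity, ?_, fun ϑ hϑ0 hϑ k hk => ?_⟩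
  · have hkϑ : C₂ * ‖ϑ‖ * (k : ℝ) ^ 2 ≤ 1 := by
      rcases hor with rfl | h
      · simp
      · rcases eq_or_ne ϑ 0 with rfl | h0
        · simp
        · simpa using norm_mul_sq_mul_le_one (x := 1) hC₂0 h0 (by simpa using h)
    obtain ⟨h1, h2⟩ := main ϑ (hϑ.le.trans (min_le_left _ _)) k hk hkϑ
    exact ⟨h1.trans_lt ENNReal.ofReal_lt_top, h2⟩
  · have : 0 < Real.log 8 := Real.log_pos (by norm_num)
    positivity
  · have hϑ' := norm_pos_iff.2 hϑ0
    set x : ℝ := ‖ϑ‖ ^ (-(1 / 2) : ℝ) * C₂ ^ (-(1 / 2) : ℝ) with hx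
    have hx0 : 0 ≤ x := by positivity
    have hkx : k = ⌊1 / 2 * x⌋₊ := by rw [hk, hx, mul_assoc]
    have hx2 : 2 ≤ x := by
      have h1 : ‖ϑ‖ * C₂ ≤ 1 / 4 := by
        have := (hϑ.le.trans (min_le_right _ _))
        rw [le_div_iff₀ (by positivity)] at this
        linarith
      have h2 : x = (‖ϑ‖ * C₂) ^ (-(1 / 2) : ℝ) := (Real.mul_rpow hϑ'.le hC₂0.le).symm
      have h3 : (1 / 4 : ℝ) ^ (-(1 / 2) : ℝ) ≤ (‖ϑ‖ * C₂) ^ (-(1 / 2) : ℝ) :=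
        Real.rpow_le_rpow_of_nonpos (by positivity) h1 (by norm_num)
      have h4 : (1 / 4 : ℝ) ^ (-(1 / 2) : ℝ) = 2 := by
        rw [show (1 / 4 : ℝ) = 2 ^ (-2 : ℝ) by rw [Real.rpow_neg (by norm_num)]; norm_num,
          ← Real.rpow_mul (by norm_num)]
        norm_num
      rw [h2]; linarith
    have hk1 : 1 ≤ k := by
      rw [hkx, Nat.one_le_floor_iff]; linarith
    have hkle : (k : ℝ) ≤ 1 / 2 * x := by
      rw [hkx]; exact Nat.floor_le (by positivity)
    have hkϑ := norm_mul_sq_mul_le_one (ϑ := ϑ) (k := k) (c := C₂) (x := 1 / 2) hC₂0 hϑ0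
      (by rw [mul_assoc]; exact hkle)
    obtain ⟨h1, -, -, h2⟩ := main ϑ (hϑ.le.trans (min_le_left _ _)) k hk1 (by linarith)
    refine h2.trans ?_
    have hX0 : 0 ≤ 1 / 2 * C₂ * ‖ϑ‖ * (k : ℝ) ^ 2 := by positivity
    have hX := exp_floor_bound hX0 (by linarith : 1 / 2 * C₂ * ‖ϑ‖ * (k : ℝ) ^ 2 ≤ 1 / 8) hkx
    calc ENNReal.ofReal ((1 / 2 * C₂ * ‖ϑ‖ * (k : ℝ) ^ 2) ^ k) * hNorm (frontier Ω) φ σs (calE Ω φ V ϑ 0)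
        ≤ ENNReal.ofReal (8 * Real.exp (-(Real.log 8 / 2) * x)) * ENNReal.ofReal M :=
          mul_le_mul' (ENNReal.ofReal_le_ofReal hX) h1
      _ = ENNReal.ofReal (8 * M * Real.exp (-(Real.log 8 / 2 * C₂ ^ (-(1 / 2) : ℝ)) *
            ‖ϑ‖ ^ (-(1 / 2) : ℝ))) := by
        rw [← ENNReal.ofReal_mul (by positivity), hx]
        congr 1
        rw [show -(Real.log 8 / 2) * (‖ϑ‖ ^ (-(1 / 2) : ℝ) * C₂ ^ (-(1 / 2) : ℝ)) =
          -(Real.log 8 / 2 * C₂ ^ (-(1 / 2) : ℝ)) * ‖ϑ‖ ^ (-(1 / 2) : ℝ) by ring]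
        ring
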